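/- Let $N,k\ge 1$ be integers. For $x,x_0\in\mathbb R^N$, $y\in\mathbb R^k$ and $t>0$ let $$K(x,x_0,y;t)=\frac1{(2\pi)^{\frac{N+2k}2}}\int_{\mathbb R^k}\Big(\frac{|\xi|}{\sinh(|\xi|t)}\Big)^{\frac N2}e^{\,i\xi\cdot y-\frac{|\xi|}2\left((|x|^2+|x_0|^2)\coth(|\xi|t)-2x\cdot x_0\,\mathrm{csch}(|\xi|t)\right)}\,d\xi ,$$ the heat kernel of the Grushin operator $\Delta_{\mathcal G}=\frac12(\Delta_x+|x|^2\Delta_y)$ on $\mathbb R^{N+k}=\mathbb R^N\times\mathbb R^k$. For $t>0$ put $$S_{\mathcal G}(t)\varphi(x,y)=\int_{\mathbb R^{N+k}}K(x,w,y-z;t)\,\varphi(w,z)\,d(w,z),$$ and let $S_{\mathcal G}(0)$ be the identity. Here functions are real- or complex-valued. Then: 1. For every $1\le p\le\infty$, $t>0$ and $\varphi\in L^p(\mathbb R^{N+k})$ the integral defining $S_{\mathcal G}(t)\varphi(x,y)$ converges absolutely for every $(x,y)$, and $(S_{\mathcal G}(t))_{t\ge0}$ is a semigroup of bounded linear operators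 on $L^p(\mathbb R^{N+k})$: $S_{\mathcal G}(0)=I$ and $S_{\mathcal G}(s+t)=S_{\mathcal G}(s)S_{\mathcal G}(t)$ for all $s,t\ge0$. 2. For all $1\le p\le r\le\infty$ there is a constant $C$, independent of $t$ and $\varphi$, such that for all $t>0$ and $\varphi\in L^p(\mathbb R^{N+k})$ one has $S_{\mathcal G}(t)\varphi\in L^r(\mathbb R^{N+k})$ and $$\|S_{\mathcal G}(t)\varphi\|_{L^r(\mathbb R^{N+k})}\le C\,t^{-\frac{N+2k}2\left(\frac1p-\frac1r\right)}\,\|\varphi\|_{L^p(\mathbb R^{N+k})}\qquad(1/\infty=0).$$ 3. For all $1\le p\le r\le\infty$, $\varphi\in L^p(\mathbb R^{N+k})$ and $t_0>0$, $$\|S_{\mathcal G}(t)\varphi-S_{\mathcal G}(t_0)\varphi\|_{L^r(\mathbb R^{N+k})}\to0\quad\text{as }t\to t_0 .$$ If $p=r<\infty$, this also holds for $t_0=0$ (with $t\to0^+$). -/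

import Mathlib

open MeasureTheory Filter Topology
open scoped ENNReal NNReal

noncomputable section

/-- The space `ℝ^{N+k} = ℝ^N × ℝ^k` with points `(x, y)`, both factors Euclidean; its `volume` is
the product of the Lebesgue measures. -/
abbrev GrushinSpace (N k : ℕ) : Type :=
  EuclideanSpace ℝ (Fin N) × EuclideanSpace ℝ (Fin k)

/-- The bracket `(|x|² + |x₀|²) coth(|ξ|t) - 2 x·x₀ csch(|ξ|t)`. The value at the single point
`ξ = 0`, where `coth` and `csch` are singular, does not affect the kernel when `k ≥ 1`. -/
def grushinPhase {N k : ℕ} (x x₀ : EuclideanSpace ℝ (Fin N)) (ξ : EuclideanSpace ℝ (Fin k))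
    (t : ℝ) : ℝ :=
  (‖x‖ ^ 2 + ‖x₀‖ ^ 2) * (Real.cosh (‖ξ‖ * t) / Real.sinh (‖ξ‖ * t))
    - 2 * inner ℝ x x₀ * (1 / Real.sinh (‖ξ‖ * t))

/-- The defining inverse Fourier integral of the Grushin heat kernel,
`(2π)^{-(N+2k)/2} ∫ (|ξ| / sinh(|ξ|t))^{N/2} exp(i ξ·y - (|ξ|/2) [...]) dξ`, as a complex number. -/
def grushinKernelComplex {N k : ℕ} (x x₀ : EuclideanSpace ℝ (Fin N))
    (y : EuclideanSpace ℝ (Fin k)) (t : ℝ) : ℂ :=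
  ((1 / (2 * Real.pi) ^ (((N : ℝ) + 2 * k) / 2) : ℝ) : ℂ) *
    ∫ ξ : EuclideanSpace ℝ (Fin k),
      (((‖ξ‖ / Real.sinh (‖ξ‖ * t)) ^ ((N : ℝ) / 2) : ℝ) : ℂ) *
        Complex.exp (Complex.I * ((inner ℝ ξ y : ℝ) : ℂ)
          - ((‖ξ‖ / 2 * grushinPhase x x₀ ξ t : ℝ) : ℂ))

/-- The Grushin heat kernel `K(x, x₀, y; t)` as a real number. The defining integral is real,
see `ofReal_grushinKernel`. -/
def grushinKernel {N k : ℕ} (x x₀ : EuclideanSpace ℝ (Fin N))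
    (y : EuclideanSpace ℝ (Fin k)) (t : ℝ) : ℝ :=
  (grushinKernelComplex x x₀ y t).re

theorem ofReal_grushinKernel {N k : ℕ} (x x₀ : EuclideanSpace ℝ (Fin N))
    (y : EuclideanSpace ℝ (Fin k)) (t : ℝ) :
    ((grushinKernel x x₀ y t : ℝ) : ℂ) = grushinKernelComplex x x₀ y t := by
  unfold grushinKernel
  rw [← Complex.conj_eq_iff_re]
  unfold grushinKernelComplex
  rw [map_mul, Complex.conj_ofReal, ← integral_conj]
  congr 1
  rw [← integral_neg_eq_self]
  refine integral_congr_ae (Eventually.of_forall fun ξ => ?_)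
  simp only [map_mul, Complex.conj_ofReal, ← Complex.exp_conj, map_sub, Complex.conj_I,
    norm_neg, inner_neg_left, grushinPhase]
  push_cast
  ring_nf

/-- The operators `S(t)`: for `t ≠ 0` (only `t > 0` is meaningful),
`S(t)φ(x, y) = ∫ K(x, w, y - z; t) φ(w, z) d(w, z)`, and `S(0)` is the identity. -/
def grushinSemigroup {𝕜 : Type*} [RCLike 𝕜] {N k : ℕ} (t : ℝ) (φ : GrushinSpace N k → 𝕜) :
    GrushinSpace N k → 𝕜 :=
  if t = 0 then φ
  else fun u => ∫ v : GrushinSpace N k, grushinKernel u.1 v.1 (u.2 - v.2) t • φ v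

end

/-! Freezing the dual variable ξ of y turns the Grushin operator into the harmonic oscillator ½(Δ -
|ξ|²|x|²), whose heat kernel is Mehler's. So K is the inverse Fourier transform in ξ of the Mehler
kernel. Chapman–Kolmogorov (`lintegral_gker_mul_gker`) comes from the Gaussian integral
`mehler_comp`. Unit mass (`lintegral_gker`) comes from frequency 0, where the Mehler kernel is the
Euclidean heat kernel.

The decisive fact is K ≥ 0 (`grushinKernel_nonneg`), obtained by Fourier analysis. Up to constants
the Mehler kernel is a power of v / sinh v times exponentials of -v tanh(v/2) and of 2 - v
coth(v/2), where v = |ξ|t. Euler's product for sinh and the partial fractions of coth and tanh write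
these factors as limits of products of (d/(|ξ|²+d))^a and exp(-c|ξ|²/(|ξ|²+d)). Each of these is
built from mixtures of Gaussians, hence preserves nonnegativity of Fourier transforms
(`posMult_mehler`). Positivity also makes K integrable in y and Fourier inversion legitimate.

Since K is nonnegative, symmetric and of mass one, Schur's test makes S(t) a contraction on every
L^p. The bound K ≤ A t^(-(N+2k)/2) (`grushinKernel_le`) maps L^p to L^∞, and interpolation gives the
L^p-L^r estimate.

For continuity at t₀ > 0, the L¹ distance between the kernels at times t and t₀ tends to 0 uniformly
in the base point (`eventually_lintegral_gker_sub_le`). On compact sets of x this is Scheffé's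
lemma. As |x| → ∞, the kernel with y measured in units of |x| tends to a Gaussian
(`tendsto_rescaledKernel`), so the two kernels merge. Schur's test gives continuity on L^p, and the
smoothing of S(t₀/2) improves it to L^r.

For t₀ = 0, parabolic scaling converts small times at x ≠ 0 into time 1 at the distant point x/√t,
so the same Gaussian limit shows that the kernel concentrates. Pointwise convergence for continuous
functions becomes L¹ convergence by domination, then L^p convergence by interpolation, density and
contractivity. -/

noncomputable section

/-! ### Mehler's kernel, regularised at frequency zero -/

/-- The continuous extension of `sinh v / v`. -/
def shc (v : ℝ) : ℝ := dslope Real.sinh 0 v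

theorem shc_zero : shc 0 = 1 := by
  simp [shc, dslope_same]

theorem shc_of_ne {v : ℝ} (hv : v ≠ 0) : shc v = Real.sinh v / v := by
  simp [shc, dslope_of_ne _ hv, slope_def_field]

theorem mul_shc (v : ℝ) : v * shc v = Real.sinh v := by
  rcases eq_or_ne v 0 with rfl | hv
  · simp
  · rw [shc_of_ne hv]; field_simp

@[fun_prop]
theorem continuous_shc : Continuous shc := by
  rw [continuous_iff_continuousAt]
  intro v
  rcases eq_or_ne v 0 with rfl | hv
  · exact continuousAt_dslope_same.2 Real.differentiable_sinh.differentiableAt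
  · exact (continuousAt_dslope_of_ne hv).2 Real.continuous_sinh.continuousAt

theorem shc_neg (v : ℝ) : shc (-v) = shc v := by
  rcases eq_or_ne v 0 with rfl | hv
  · simp
  · rw [shc_of_ne hv, shc_of_ne (neg_ne_zero.2 hv), Real.sinh_neg, neg_div_neg_eq]

theorem one_le_shc (v : ℝ) : 1 ≤ shc v := by
  wlog hv : 0 ≤ v generalizing v
  · rw [← shc_neg]; exact this _ (by linarith)
  rcases hv.eq_or_lt with rfl | hv
  · rw [shc_zero]
  · rw [shc_of_ne hv.ne', one_le_div hv]; exact Real.self_le_sinh_iff.2 hv.le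

theorem shc_pos (v : ℝ) : 0 < shc v := one_pos.trans_le (one_le_shc v)

theorem shc_eq_half (v : ℝ) : shc v = shc (v / 2) * Real.cosh (v / 2) := by
  rcases eq_or_ne v 0 with rfl | hv
  · simp [shc_zero]
  · have h2 : v / 2 ≠ 0 := by positivity
    have := Real.sinh_two_mul (v / 2)
    rw [mul_div_cancel₀ v two_ne_zero] at this
    rw [shc_of_ne hv, shc_of_ne h2, this]; field_simp

/-- Halving the argument exposes a factor cosh(v/2). This bound supplies the exponential decay in
frequency that makes the kernel integrals converge. -/
theorem exp_half_le_shc (v : ℝ) : Real.exp (v / 2) / 2 ≤ shc v := by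
  rw [shc_eq_half]
  have h1 := one_le_shc (v / 2)
  have h2 : Real.exp (v / 2) / 2 ≤ Real.cosh (v / 2) := by
    rw [Real.cosh_eq]; have := Real.exp_pos (-(v / 2)); linarith
  nlinarith [Real.cosh_pos (v / 2)]

/-- The function `v tanh (v / 2)`. -/
def vtanh (v : ℝ) : ℝ := v ^ 2 * (shc (v / 2) / (2 * Real.cosh (v / 2)))

@[fun_prop]
theorem continuous_vtanh : Continuous vtanh := by
  unfold vtanh
  have h : ∀ v : ℝ, 2 * Real.cosh (v / 2) ≠ 0 := fun v => by
    have := Real.cosh_pos (v / 2); positivity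
  exact (continuous_pow 2).mul ((continuous_shc.comp (by fun_prop)).div₀ (by fun_prop) h)

theorem vtanh_nonneg (v : ℝ) : 0 ≤ vtanh v := by
  have := shc_pos (v / 2); have := Real.cosh_pos (v / 2); unfold vtanh; positivity

theorem vtanh_zero : vtanh 0 = 0 := by simp [vtanh]

theorem vtanh_eq (v : ℝ) : vtanh v = v * Real.sinh (v / 2) / Real.cosh (v / 2) := by
  unfold vtanh
  rw [← mul_shc (v / 2)]
  have := (Real.cosh_pos (v / 2)).ne'
  field_simp

theorem vtanh_eq_of_ne {v : ℝ} (hv : v ≠ 0) :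
    vtanh v = v * (Real.cosh v - 1) / Real.sinh v := by
  have h2 : Real.sinh (v / 2) ≠ 0 := by simpa using hv
  have hc := (Real.cosh_pos (v / 2)).ne'
  have e1 := Real.sinh_two_mul (v / 2)
  have e2 := Real.cosh_two_mul (v / 2)
  have e3 := Real.cosh_sq (v / 2)
  rw [mul_div_cancel₀ v two_ne_zero] at e1 e2
  rw [vtanh_eq, e1, e2, e3]
  field_simp
  ring

/-- The lower bound is quadratic near 0 and linear at infinity, like v tanh(v/2) itself. It controls
the Mehler kernel uniformly for distant base points. -/
theorem sq_div_le_vtanh {v : ℝ} (hv : 0 ≤ v) : v ^ 2 / (2 + v) ≤ vtanh v := by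
  have hc := Real.cosh_pos (v / 2)
  -- `cosh u ≤ (1 + u) * shc u`
  have key : Real.cosh (v / 2) ≤ (1 + v / 2) * shc (v / 2) := by
    have h1 : (1 + v / 2) * shc (v / 2) = shc (v / 2) + Real.sinh (v / 2) := by
      rw [← mul_shc (v / 2)]; ring
    have h2 : Real.cosh (v / 2) = Real.sinh (v / 2) + Real.exp (-(v / 2)) := by
      rw [Real.cosh_eq, Real.sinh_eq]; ring
    have h3 : Real.exp (-(v / 2)) ≤ 1 := Real.exp_le_one_iff.2 (by linarith)
    have := one_le_shc (v / 2)
    linarith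
  unfold vtanh
  rw [div_eq_mul_inv]
  refine mul_le_mul_of_nonneg_left ?_ (sq_nonneg v)
  rw [inv_eq_one_div, div_le_div_iff₀ (by positivity) (by positivity)]
  linarith

/-- The Mehler kernel of `½ (Δ - λ² |x|²)`, without the factor `(2π)^{-N/2}`. -/
def mehler {N : ℕ} (x w : EuclideanSpace ℝ (Fin N)) (t l : ℝ) : ℝ :=
  (t * shc (l * t))⁻¹ ^ ((N : ℝ) / 2) *
    Real.exp (-((2 * t)⁻¹ * ((‖x‖ ^ 2 + ‖w‖ ^ 2) * vtanh (l * t)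
      + ‖x - w‖ ^ 2 * (shc (l * t))⁻¹)))

theorem mehler_pos {N : ℕ} (x w : EuclideanSpace ℝ (Fin N)) {t : ℝ} (ht : 0 < t) (l : ℝ) :
    0 < mehler x w t l := by
  have := shc_pos (l * t)
  unfold mehler; positivity

theorem continuousAt_mehler {N : ℕ} (x w : EuclideanSpace ℝ (Fin N)) {t : ℝ} (ht : 0 < t) (l : ℝ) :
    ContinuousAt (fun q : EuclideanSpace ℝ (Fin N) × EuclideanSpace ℝ (Fin N) × ℝ × ℝ =>
      mehler q.1 q.2.1 q.2.2.1 q.2.2.2) (x, w, t, l) := by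
  unfold mehler
  have h1 := shc_pos (l * t)
  have hs : ContinuousAt (fun q : EuclideanSpace ℝ (Fin N) × EuclideanSpace ℝ (Fin N) × ℝ × ℝ =>
      shc (q.2.2.2 * q.2.2.1)) (x, w, t, l) := by fun_prop
  have hv : ContinuousAt (fun q : EuclideanSpace ℝ (Fin N) × EuclideanSpace ℝ (Fin N) × ℝ × ℝ =>
      vtanh (q.2.2.2 * q.2.2.1)) (x, w, t, l) := by fun_prop
  refine ContinuousAt.mul (ContinuousAt.rpow_const (ContinuousAt.inv₀ (by fun_prop) ?_)
    (Or.inl ?_)) (ContinuousAt.rexp (ContinuousAt.neg (ContinuousAt.mul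
      (ContinuousAt.inv₀ (by fun_prop) ?_) (ContinuousAt.add (by fun_prop) (ContinuousAt.mul
      (by fun_prop) (ContinuousAt.inv₀ hs ?_))))))
  all_goals positivity

theorem continuous_mehler_last {N : ℕ} (x w : EuclideanSpace ℝ (Fin N)) {t : ℝ} (ht : 0 < t) :
    Continuous (fun l => mehler x w t l) := by
  rw [continuous_iff_continuousAt]
  intro l
  exact (continuousAt_mehler x w ht l).comp (f := fun l : ℝ => (x, w, t, l)) (by fun_prop)

/-- The Mehler kernel in terms of hyperbolic functions. -/
theorem mehler_eq {N : ℕ} (x w : EuclideanSpace ℝ (Fin N)) {t l : ℝ} (ht : 0 < t) (hl : 0 < l) :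
    mehler x w t l = (l / Real.sinh (l * t)) ^ ((N : ℝ) / 2) *
      Real.exp (-(l / 2 * ((‖x‖ ^ 2 + ‖w‖ ^ 2) * (Real.cosh (l * t) / Real.sinh (l * t))
        - 2 * inner ℝ x w * (1 / Real.sinh (l * t))))) := by
  have hv : l * t ≠ 0 := by positivity
  have hs : Real.sinh (l * t) ≠ 0 := by simpa using! hv
  unfold mehler
  -- Writing 2 x·w = |x|² + |w|² - |x-w|² leaves the coefficient coth v - csch v = tanh(v/2) for
  -- |x|² + |w|², which is regular at 0.
  rw [vtanh_eq_of_ne hv, shc_of_ne hv, @norm_sub_sq_real]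
  congr 2
  · field_simp
  · field_simp
    ring

/-- The Gaussian factor is at most 1 and the power of `shc` alone decays. The bound is therefore
uniform in x and w, and for N ≥ 1 it is exponentially decreasing in l. -/
theorem mehler_le {N : ℕ} (x w : EuclideanSpace ℝ (Fin N)) {t : ℝ} (ht : 0 < t) (l : ℝ) :
    mehler x w t l ≤ (2 / t) ^ ((N : ℝ) / 2) * Real.exp (-(N * t / 4 * l)) := by
  have h1 := shc_pos (l * t)
  have h2 := vtanh_nonneg (l * t)
  have h3 := exp_half_le_shc (l * t)
  have hE : Real.exp (-((2 * t)⁻¹ * ((‖x‖ ^ 2 + ‖w‖ ^ 2) * vtanh (l * t)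
      + ‖x - w‖ ^ 2 * (shc (l * t))⁻¹))) ≤ 1 := Real.exp_le_one_iff.2 (by
    rw [neg_nonpos]; positivity)
  have h4 : (t * shc (l * t))⁻¹ ≤ 2 / t * Real.exp (-(l * t / 2)) := by
    rw [Real.exp_neg, inv_le_comm₀ (by positivity) (by positivity)]
    rw [mul_inv, inv_inv, inv_div]
    calc t / 2 * Real.exp (l * t / 2) = t * (Real.exp (l * t / 2) / 2) := by ring
      _ ≤ _ := by gcongr
  calc mehler x w t l ≤ (t * shc (l * t))⁻¹ ^ ((N : ℝ) / 2) * 1 := by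
        unfold mehler; gcongr
    _ ≤ (2 / t * Real.exp (-(l * t / 2))) ^ ((N : ℝ) / 2) := by
        rw [mul_one]; gcongr
    _ = _ := by
        rw [Real.mul_rpow (by positivity) (Real.exp_pos _).le, ← Real.exp_mul]
        congr 2; ring

theorem integral_rexp_gaussian {V : Type*} [NormedAddCommGroup V] [InnerProductSpace ℝ V]
    [FiniteDimensional ℝ V] [MeasurableSpace V] [BorelSpace V] {b : ℝ} (hb : 0 < b) (v : V) :
    ∫ w : V, Real.exp (-b * ‖w‖ ^ 2 + inner ℝ v w) =
      (Real.pi / b) ^ ((Module.finrank ℝ V : ℝ) / 2) * Real.exp (‖v‖ ^ 2 / (4 * b)) := by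
  have h := GaussianFourier.integral_cexp_neg_mul_sq_norm_add (V := V) (b := b)
    (by simpa using hb) 1 v
  have e : (fun w : V => Complex.exp (-(b : ℂ) * (‖w‖ : ℂ) ^ 2 + 1 * ((inner ℝ v w : ℝ) : ℂ)))
      = fun w => ((Real.exp (-b * ‖w‖ ^ 2 + inner ℝ v w) : ℝ) : ℂ) := by
    ext w; push_cast; ring_nf
  rw [e, integral_complex_ofReal] at h
  apply Complex.ofReal_injective
  rw [h]
  rw [Complex.ofReal_mul, Complex.ofReal_cpow (by positivity)]
  push_cast
  ring_nf

/-- The semigroup property of the Mehler kernels. -/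
theorem mehler_comp {N : ℕ} (x w' : EuclideanSpace ℝ (Fin N)) {s t l : ℝ} (hs : 0 < s)
    (ht : 0 < t) (hl : 0 < l) :
    ∫ w, mehler x w s l * mehler w w' t l =
      (2 * Real.pi) ^ ((N : ℝ) / 2) * mehler x w' (s + t) l := by
  have hS1 : 0 < Real.sinh (l * s) := Real.sinh_pos_iff.2 (by positivity)
  have hS2 : 0 < Real.sinh (l * t) := Real.sinh_pos_iff.2 (by positivity)
  have hS3 : 0 < Real.sinh (l * (s + t)) := Real.sinh_pos_iff.2 (by positivity)
  have hadd : Real.sinh (l * (s + t)) = Real.sinh (l * s) * Real.cosh (l * t)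
      + Real.cosh (l * s) * Real.sinh (l * t) := by rw [mul_add, Real.sinh_add]
  have hcadd : Real.cosh (l * (s + t)) = Real.cosh (l * s) * Real.cosh (l * t)
      + Real.sinh (l * s) * Real.sinh (l * t) := by rw [mul_add, Real.cosh_add]
  have hc1 := Real.cosh_sq (l * s)
  have hc2 := Real.cosh_sq (l * t)
  rw [mehler_eq x w' (by positivity) hl]
  simp_rw [fun w => mehler_eq x w hs hl, fun w => mehler_eq w w' ht hl]
  set S1 := Real.sinh (l * s)
  set S2 := Real.sinh (l * t)
  set C1 := Real.cosh (l * s)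
  set C2 := Real.cosh (l * t)
  set S3 := Real.sinh (l * (s + t))
  set C3 := Real.cosh (l * (s + t))
  -- The product of the two kernels is a Gaussian in w. Its quadratic coefficient is (l/2)(C1/S1 +
  -- C2/S2), which the addition formula for sinh turns into b; its linear coefficient is the vector
  -- v below.
  set b : ℝ := l * S3 / (2 * S1 * S2) with hb
  have hb0 : 0 < b := by positivity
  set v : EuclideanSpace ℝ (Fin N) := (l / S1) • x + (l / S2) • w' with hv
  have e : ∀ w : EuclideanSpace ℝ (Fin N),
      (l / S1) ^ ((N : ℝ) / 2) *
        Real.exp (-(l / 2 * ((‖x‖ ^ 2 + ‖w‖ ^ 2) * (C1 / S1) - 2 * inner ℝ x w * (1 / S1)))) *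
      ((l / S2) ^ ((N : ℝ) / 2) *
        Real.exp (-(l / 2 * ((‖w‖ ^ 2 + ‖w'‖ ^ 2) * (C2 / S2) - 2 * inner ℝ w w' * (1 / S2))))) =
      ((l / S1) ^ ((N : ℝ) / 2) * (l / S2) ^ ((N : ℝ) / 2) *
        Real.exp (-(l / 2 * (‖x‖ ^ 2 * (C1 / S1) + ‖w'‖ ^ 2 * (C2 / S2))))) *
      Real.exp (-b * ‖w‖ ^ 2 + inner ℝ v w) := by
    intro w
    rw [mul_mul_mul_comm, ← Real.exp_add, mul_assoc _ (Real.exp _) (Real.exp _), ← Real.exp_add]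
    congr 2
    rw [hv, inner_add_left, real_inner_smul_left, real_inner_smul_left, real_inner_comm w w', hb,
      hadd]
    field_simp
    ring
  simp_rw [e]
  rw [integral_const_mul, integral_rexp_gaussian hb0, finrank_euclideanSpace_fin]
  have hv2 : ‖v‖ ^ 2 = (l / S1) ^ 2 * ‖x‖ ^ 2 + 2 * (l / S1) * (l / S2) * inner ℝ x w'
      + (l / S2) ^ 2 * ‖w'‖ ^ 2 := by
    rw [hv, @norm_add_sq_real, norm_smul, norm_smul, real_inner_smul_left, real_inner_smul_right,
      mul_pow, mul_pow, Real.norm_eq_abs, Real.norm_eq_abs, sq_abs, sq_abs]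
    ring
  rw [mul_assoc, mul_left_comm (Real.exp _), ← Real.exp_add, ← mul_assoc, ← mul_assoc,
    ← Real.mul_rpow (by positivity) (by positivity),
    ← Real.mul_rpow (by positivity) (by positivity),
    ← Real.mul_rpow (by positivity) (by positivity)]
  congr 2
  · rw [hb]; field_simp
  · rw [hv2, hb]
    field_simp
    rw [hcadd]
    -- These are sinh β = sinh((α+β) - α) and its mirror image. They match the coefficients of |x|²
    -- and |w'|² after completing the square.
    have h1 : C1 * S3 = S2 + S1 * (C1 * C2 + S1 * S2) := by
      rw [hadd]; linear_combination S2 * hc1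
    have h2 : C2 * S3 = S1 + S2 * (C1 * C2 + S1 * S2) := by
      rw [hadd]; linear_combination S1 * hc2
    linear_combination (-4 * (‖x‖ ^ 2 * S2)) * h1 - 4 * (‖w'‖ ^ 2 * S1) * h2

/-- At frequency 0 only the Gaussian in x - w survives. This is the source of the conservation of
mass. -/
theorem integral_mehler_zero {N : ℕ} (x : EuclideanSpace ℝ (Fin N)) {t : ℝ} (ht : 0 < t) :
    ∫ w, mehler x w t 0 = (2 * Real.pi) ^ ((N : ℝ) / 2) := by
  unfold mehler
  simp only [zero_mul, shc_zero, vtanh_zero, mul_zero, zero_add, inv_one, mul_one]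
  rw [integral_const_mul]
  have h := integral_sub_left_eq_self (μ := (volume : Measure (EuclideanSpace ℝ (Fin N))))
    (fun w : EuclideanSpace ℝ (Fin N) => Real.exp (-((2 * t)⁻¹ * ‖w‖ ^ 2))) x
  rw [h]
  have h2 := GaussianFourier.integral_rexp_neg_mul_sq_norm (V := EuclideanSpace ℝ (Fin N))
    (b := (2 * t)⁻¹) (by positivity)
  simp only [neg_mul] at h2
  rw [h2, finrank_euclideanSpace_fin, ← Real.mul_rpow (by positivity) (by positivity)]
  congr 1
  field_simp

end

/-! ### Multipliers that preserve nonnegativity of the Fourier transform -/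

noncomputable section

open scoped FourierTransform ComplexOrder

section PosMult

variable {V : Type*} [NormedAddCommGroup V] [InnerProductSpace ℝ V] [MeasurableSpace V]
  [BorelSpace V] [FiniteDimensional ℝ V]

theorem complex_integral_nonneg {X : Type*} [MeasurableSpace X] {μ : Measure X} {f : X → ℂ}
    (hf : ∀ x, 0 ≤ f x) : 0 ≤ ∫ x, f x ∂μ := by
  have e : f = fun x => ((f x).re : ℂ) := by
    ext x
    exact (Complex.eq_re_of_ofReal_le (hf x))
  rw [e, integral_complex_ofReal, Complex.zero_le_real]
  exact integral_nonneg fun x => (Complex.nonneg_iff.1 (hf x)).1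

theorem fourier_nonneg_of_tendsto {ι : Type*} {l : Filter ι} [l.NeBot] [l.IsCountablyGenerated]
    {F : ι → V → ℂ} {f : V → ℂ} {b : V → ℝ} (hF : ∀ i, AEStronglyMeasurable (F i))
    (hb : Integrable b) (hFb : ∀ i ξ, ‖F i ξ‖ ≤ b ξ)
    (hlim : ∀ ξ, Tendsto (fun i => F i ξ) l (𝓝 (f ξ))) (hpos : ∀ᶠ i in l, ∀ y, 0 ≤ 𝓕 (F i) y)
    (y : V) : 0 ≤ 𝓕 f y := by
  have h : Tendsto (fun i => 𝓕 (F i) y) l (𝓝 (𝓕 f y)) := by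
    simp only [Real.fourier_eq']
    refine tendsto_integral_filter_of_dominated_convergence b ?_ ?_ hb ?_
    · refine Eventually.of_forall fun i => AEStronglyMeasurable.fun_smul ?_ (hF i)
      exact Continuous.aestronglyMeasurable (by fun_prop)
    · refine Eventually.of_forall fun i => Eventually.of_forall fun ξ => ?_
      rw [norm_smul, Complex.norm_exp_ofReal_mul_I, one_mul]
      exact hFb i ξ
    · exact Eventually.of_forall fun ξ => (hlim ξ).const_smul _
  exact ge_of_tendsto h (hpos.mono fun i hi => hi y)

/-- Bounded continuous multipliers that preserve nonnegativity of the Fourier transform. -/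
def PosMult (g : V → ℝ) : Prop :=
  Continuous g ∧ (∃ B, ∀ ξ, |g ξ| ≤ B) ∧
    ∀ f : V → ℂ, Integrable f → (∀ y, 0 ≤ 𝓕 f y) → ∀ y, 0 ≤ 𝓕 (fun ξ => (g ξ : ℂ) * f ξ) y

theorem integrable_ofReal_mul {g : V → ℝ} (hg : Continuous g) {B : ℝ} (hB : ∀ ξ, |g ξ| ≤ B)
    {f : V → ℂ} (hf : Integrable f) : Integrable (fun ξ => (g ξ : ℂ) * f ξ) := by
  refine hf.bdd_mul (c := B) (Continuous.aestronglyMeasurable (by fun_prop))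
    (Eventually.of_forall fun ξ => ?_)
  simpa using hB ξ

theorem PosMult.integrable_mul {g : V → ℝ} (hg : PosMult g) {f : V → ℂ} (hf : Integrable f) :
    Integrable (fun ξ => (g ξ : ℂ) * f ξ) := by
  obtain ⟨B, hB⟩ := hg.2.1
  exact integrable_ofReal_mul hg.1 hB hf

theorem PosMult.mul {g h : V → ℝ} (hg : PosMult g) (hh : PosMult h) :
    PosMult (fun ξ => g ξ * h ξ) := by
  refine ⟨hg.1.mul hh.1, ?_, fun f hf hpos y => ?_⟩
  · obtain ⟨B, hB⟩ := hg.2.1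
    obtain ⟨C, hC⟩ := hh.2.1
    refine ⟨B * C, fun ξ => ?_⟩
    rw [abs_mul]
    exact mul_le_mul (hB ξ) (hC ξ) (abs_nonneg _) ((abs_nonneg _).trans (hB ξ))
  · have := hg.2.2 _ (hh.integrable_mul hf) (hh.2.2 f hf hpos) y
    simpa [mul_assoc] using this

theorem PosMult.add {g h : V → ℝ} (hg : PosMult g) (hh : PosMult h) :
    PosMult (fun ξ => g ξ + h ξ) := by
  refine ⟨hg.1.add hh.1, ?_, fun f hf hpos y => ?_⟩
  · obtain ⟨B, hB⟩ := hg.2.1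
    obtain ⟨C, hC⟩ := hh.2.1
    exact ⟨B + C, fun ξ => (abs_add_le _ _).trans (add_le_add (hB ξ) (hC ξ))⟩
  · have h1 := hg.2.2 f hf hpos y
    have h2 := hh.2.2 f hf hpos y
    have e : 𝓕 (fun ξ => ((g ξ + h ξ : ℝ) : ℂ) * f ξ) y =
        𝓕 (fun ξ => (g ξ : ℂ) * f ξ) y + 𝓕 (fun ξ => (h ξ : ℂ) * f ξ) y := by
      simp only [Real.fourier_eq]
      rw [← integral_add]
      · simp [add_mul]
      · exact (Real.fourierIntegral_convergent_iff y).2 (hg.integrable_mul hf)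
      · exact (Real.fourierIntegral_convergent_iff y).2 (hh.integrable_mul hf)
    rw [e]
    exact add_nonneg h1 h2

theorem PosMult.const {c : ℝ} (hc : 0 ≤ c) : PosMult (fun _ : V => c) := by
  refine ⟨continuous_const, ⟨|c|, fun _ => le_rfl⟩, fun f hf hpos y => ?_⟩
  have e : 𝓕 (fun ξ => ((c : ℝ) : ℂ) * f ξ) y = c * 𝓕 f y := by
    simp only [Real.fourier_eq']
    rw [← integral_const_mul]
    congr 1; ext ξ; simp only [smul_eq_mul]; ring
  rw [e]
  exact mul_nonneg (Complex.zero_le_real.2 hc) (hpos y)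

theorem PosMult.pow {g : V → ℝ} (hg : PosMult g) (n : ℕ) : PosMult (fun ξ => g ξ ^ n) := by
  induction n with
  | zero => simpa using PosMult.const (V := V) zero_le_one
  | succ n ih => simpa [pow_succ] using ih.mul hg

theorem PosMult.prod {g : ℕ → V → ℝ} (hg : ∀ j, PosMult (g j)) (n : ℕ) :
    PosMult (fun ξ => ∏ j ∈ Finset.range n, g j ξ) := by
  induction n with
  | zero => simpa using PosMult.const (V := V) zero_le_one
  | succ n ih => simpa [Finset.prod_range_succ] using ih.mul (hg n)

theorem PosMult.of_tendsto {g : ℕ → V → ℝ} {h : V → ℝ} (hg : ∀ n, PosMult (g n)) {B : ℝ}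
    (hB : ∀ n ξ, |g n ξ| ≤ B) (hh : Continuous h)
    (hlim : ∀ ξ, Tendsto (fun n => g n ξ) atTop (𝓝 (h ξ))) : PosMult h := by
  refine ⟨hh, ⟨B, fun ξ => le_of_tendsto (hlim ξ).abs (Eventually.of_forall fun n => hB n ξ)⟩,
    fun f hf hpos y => ?_⟩
  refine fourier_nonneg_of_tendsto (F := fun n ξ => (g n ξ : ℂ) * f ξ) (l := atTop)
    (b := fun ξ => B * ‖f ξ‖) (fun n => ((hg n).integrable_mul hf).1) (hf.norm.const_mul B)
    (fun n ξ => ?_) (fun ξ => ?_) (Eventually.of_forall fun n => (hg n).2.2 f hf hpos) y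
  · rw [norm_mul, Complex.norm_real]
    exact mul_le_mul_of_nonneg_right (hB n ξ) (norm_nonneg _)
  · exact ((Complex.continuous_ofReal.tendsto _).comp (hlim ξ)).mul_const _

theorem integrable_cexp_gaussian {b : ℝ} (hb : 0 < b) :
    Integrable (fun v : V => Complex.exp (-b * ‖v‖ ^ 2)) := by
  simpa using GaussianFourier.integrable_cexp_neg_mul_sq_norm_add (V := V) (b := (b : ℂ))
    (by simpa using hb) 0 0

theorem fourier_translated_gaussian {b : ℝ} (hb : 0 < b) (p w : V) :
    𝓕 (fun v : V => Complex.exp (-b * ‖v - p‖ ^ 2)) w =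
      (((Real.pi / b) ^ ((Module.finrank ℝ V : ℝ) / 2) : ℝ) : ℂ) *
        (Complex.exp ((-2 * Real.pi * inner ℝ p w : ℝ) * Complex.I) *
          Complex.exp (-(Real.pi ^ 2 / b) * ‖w‖ ^ 2)) := by
  have h := fourier_gaussian_innerProductSpace (V := V) (b := b) (by simpa using hb) w
  have e : 𝓕 (fun v : V => Complex.exp (-b * ‖v - p‖ ^ 2)) w =
      Complex.exp ((-2 * Real.pi * inner ℝ p w : ℝ) * Complex.I) *
        𝓕 (fun v : V => Complex.exp (-b * ‖v‖ ^ 2)) w := by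
    rw [Real.fourier_eq', Real.fourier_eq', ← integral_const_mul,
      ← integral_sub_right_eq_self (fun v : V => Complex.exp
        ((-2 * Real.pi * inner ℝ p w : ℝ) * Complex.I) *
        Complex.exp ((-2 * Real.pi * inner ℝ v w : ℝ) * Complex.I) •
          Complex.exp (-b * ‖v‖ ^ 2)) p]
    congr 1; ext v
    simp only [smul_eq_mul, ← Complex.exp_add, inner_sub_left]
    congr 1
    push_cast; ring
  rw [e, h, Complex.ofReal_cpow (by positivity)]
  push_cast
  rw [mul_left_comm]
  congr 3
  ring

/-- A Gaussian multiplier convolves the Fourier transform with a positive Gaussian. The convolution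
at y appears by moving the Fourier transform from f onto a Gaussian centred at y. -/
theorem PosMult.gaussian {u : ℝ} (hu : 0 < u) :
    PosMult (fun ξ : V => Real.exp (-u * ‖ξ‖ ^ 2)) := by
  refine ⟨by fun_prop, ⟨1, fun ξ => ?_⟩, fun f hf hpos y => ?_⟩
  · rw [abs_of_pos (Real.exp_pos _), Real.exp_le_one_iff]
    nlinarith [sq_nonneg ‖ξ‖]
  -- With this b, the transform of exp(-b|v-y|²) is a positive multiple of exp(-u|ξ|²) times the
  -- character at y.
  set b : ℝ := Real.pi ^ 2 / u with hb
  have hb0 : 0 < b := by positivity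
  have hbu : Real.pi ^ 2 / b = u := by rw [hb]; field_simp
  have J : Integrable (fun v : V => Complex.exp (-b * ‖v - y‖ ^ 2)) :=
    (integrable_cexp_gaussian hb0).comp_sub_right y
  have flip : ∫ ξ, 𝓕 (fun v : V => Complex.exp (-b * ‖v - y‖ ^ 2)) ξ • f ξ =
      ∫ v, Complex.exp (-b * ‖v - y‖ ^ 2) • 𝓕 f v := by
    simpa using! VectorFourier.integral_fourierIntegral_smul_eq_flip (L := innerₗ V)
      Real.continuous_fourierChar continuous_inner J hf
  set C : ℝ := (Real.pi / b) ^ ((Module.finrank ℝ V : ℝ) / 2) with hC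
  have hC0 : 0 < C := by positivity
  have e : ∫ ξ, 𝓕 (fun v : V => Complex.exp (-b * ‖v - y‖ ^ 2)) ξ • f ξ =
      C * 𝓕 (fun ξ => ((Real.exp (-u * ‖ξ‖ ^ 2) : ℝ) : ℂ) * f ξ) y := by
    rw [Real.fourier_eq', ← integral_const_mul]
    congr 1; ext ξ
    rw [fourier_translated_gaussian hb0, ← hC, smul_eq_mul, smul_eq_mul, real_inner_comm]
    have : (Real.pi : ℂ) ^ 2 / (b : ℂ) = u := by exact_mod_cast hbu
    rw [this]
    push_cast
    ring
  have h0 : 0 ≤ (C : ℂ) * 𝓕 (fun ξ => ((Real.exp (-u * ‖ξ‖ ^ 2) : ℝ) : ℂ) * f ξ) y := by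
    rw [← e, flip]
    refine complex_integral_nonneg fun v => mul_nonneg ?_ (hpos v)
    have : Complex.exp (-b * ‖v - y‖ ^ 2) = ((Real.exp (-b * ‖v - y‖ ^ 2) : ℝ) : ℂ) := by
      push_cast; rfl
    rw [this]
    exact Complex.zero_le_real.2 (Real.exp_pos _).le
  have h1 : (0 : ℂ) ≤ ((C⁻¹ : ℝ) : ℂ) := Complex.zero_le_real.2 (by positivity)
  have h2 := mul_nonneg h1 h0
  rwa [← mul_assoc, ← Complex.ofReal_mul, inv_mul_cancel₀ hC0.ne', Complex.ofReal_one,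
    one_mul] at h2

/-- The multiplier `(d / (|ξ|² + d))^a` is a mixture of Gaussians. -/
theorem PosMult.rational {a d : ℝ} (ha : 0 < a) (hd : 0 < d) :
    PosMult (fun ξ : V => (d / (‖ξ‖ ^ 2 + d)) ^ a) := by
  have hcont : Continuous (fun ξ : V => (d / (‖ξ‖ ^ 2 + d)) ^ a) := by
    refine Continuous.rpow_const (continuous_const.div₀ (by fun_prop) fun ξ => ?_)
      (fun ξ => Or.inr ha.le)
    positivity
  refine ⟨hcont, ⟨1, fun ξ => ?_⟩, fun f hf hpos y => ?_⟩
  · rw [abs_of_nonneg (by positivity)]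
    refine Real.rpow_le_one (by positivity) ?_ ha.le
    rw [div_le_one (by positivity)]; nlinarith [sq_nonneg ‖ξ‖]
  -- The Gamma density of shape a and rate d: its Laplace transform at |ξ|² is the multiplier.
  set ρ : ℝ → ℝ := fun u => d ^ a / Real.Gamma a * (u ^ (a - 1) * Real.exp (-(d * u))) with hρ
  have hG := Real.Gamma_pos_of_pos ha
  have hρint : IntegrableOn ρ (Set.Ioi 0) := by
    refine Integrable.const_mul ?_ _
    -- A non-integrable function has integral 0 by convention, contradicting the positive value of
    -- the Gamma integral.
    by_contra hni
    have := Real.integral_rpow_mul_exp_neg_mul_Ioi ha hd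
    rw [integral_undef hni] at this
    have h2 : 0 < (1 / d) ^ a * Real.Gamma a := by positivity
    linarith
  have hmix : ∀ ξ : V, ((d / (‖ξ‖ ^ 2 + d)) ^ a : ℝ) =
      ∫ u in Set.Ioi (0 : ℝ), ρ u * Real.exp (-u * ‖ξ‖ ^ 2) := by
    intro ξ
    have hr : 0 < ‖ξ‖ ^ 2 + d := by positivity
    have := Real.integral_rpow_mul_exp_neg_mul_Ioi ha hr
    have e : ∀ u : ℝ, ρ u * Real.exp (-u * ‖ξ‖ ^ 2) =
        d ^ a / Real.Gamma a * (u ^ (a - 1) * Real.exp (-((‖ξ‖ ^ 2 + d) * u))) := by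
      intro u
      rw [hρ, mul_assoc, mul_assoc, ← Real.exp_add]
      congr 3; ring
    simp_rw [e]
    rw [integral_const_mul, this, Real.div_rpow hd.le hr.le, Real.div_rpow zero_le_one hr.le,
      Real.one_rpow]
    field_simp
  have hρm : Measurable ρ := by fun_prop
  have hprod : Integrable (fun q : V × ℝ => Complex.exp ((-2 * Real.pi * inner ℝ q.1 y : ℝ)
      * Complex.I) * (((ρ q.2 * Real.exp (-q.2 * ‖q.1‖ ^ 2) : ℝ) : ℂ) * f q.1))
      ((volume : Measure V).prod (volume.restrict (Set.Ioi 0))) := by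
    have h1 : Integrable (fun q : V × ℝ => f q.1 * ((ρ q.2 : ℝ) : ℂ))
        ((volume : Measure V).prod (volume.restrict (Set.Ioi 0))) :=
      hf.mul_prod (Integrable.ofReal hρint)
    have hpos2 : ∀ᵐ q : V × ℝ ∂((volume : Measure V).prod (volume.restrict (Set.Ioi 0))),
        0 < q.2 := by
      have := Measure.ae_prod_mem_iff_ae_ae_mem (μ := (volume : Measure V))
        (ν := volume.restrict (Set.Ioi (0:ℝ))) (s := {q : V × ℝ | 0 < q.2})
        (measurableSet_lt measurable_const measurable_snd)
      refine this.2 (Eventually.of_forall fun x => ?_)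
      exact ae_restrict_mem measurableSet_Ioi
    refine (h1.bdd_mul (c := 1) (f := fun q : V × ℝ => Complex.exp ((-2 * Real.pi * inner ℝ q.1 y : ℝ)
      * Complex.I) * ((Real.exp (-q.2 * ‖q.1‖ ^ 2) : ℝ) : ℂ)) ?_ ?_).congr
        (Eventually.of_forall fun q => ?_)
    · exact Continuous.aestronglyMeasurable (by fun_prop)
    · filter_upwards [hpos2] with q hq
      rw [norm_mul, Complex.norm_exp_ofReal_mul_I, one_mul, Complex.norm_real, Real.norm_eq_abs,
        abs_of_pos (Real.exp_pos _), Real.exp_le_one_iff]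
      nlinarith [sq_nonneg ‖q.1‖]
    · dsimp only
      push_cast
      ring
  have e : 𝓕 (fun ξ : V => (((d / (‖ξ‖ ^ 2 + d)) ^ a : ℝ) : ℂ) * f ξ) y =
      ∫ u in Set.Ioi (0 : ℝ), (ρ u : ℂ) *
        𝓕 (fun ξ => ((Real.exp (-u * ‖ξ‖ ^ 2) : ℝ) : ℂ) * f ξ) y := by
    simp_rw [hmix, Real.fourier_eq', ← integral_complex_ofReal, smul_eq_mul,
      ← integral_mul_const, ← integral_const_mul]
    rw [integral_integral_swap hprod]
    congr 1; ext u
    congr 1; ext ξ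
    push_cast
    ring
  rw [e, ← integral_indicator measurableSet_Ioi]
  refine complex_integral_nonneg fun u => ?_
  by_cases hu : u ∈ Set.Ioi (0 : ℝ)
  · rw [Set.indicator_of_mem hu]
    have hu' : 0 < u := hu
    refine mul_nonneg (Complex.zero_le_real.2 ?_) ((PosMult.gaussian hu').2.2 f hf hpos y)
    rw [hρ]; positivity
  · rw [Set.indicator_of_notMem hu]

/-- The approximants (1 + h/n)^n are built from sums and products, and are bounded by exp B when |h|
≤ B. -/
theorem PosMult.exp {h : V → ℝ} (hh : PosMult h) : PosMult (fun ξ => Real.exp (h ξ)) := by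
  obtain ⟨B, hB⟩ := hh.2.1
  have hB0 : 0 ≤ B := (abs_nonneg _).trans (hB 0)
  refine PosMult.of_tendsto (g := fun n ξ => (1 + h ξ / n) ^ n) (B := Real.exp B) (fun n => ?_)
    (fun n ξ => ?_) (Real.continuous_exp.comp hh.1) (fun ξ => Real.tendsto_one_add_div_pow_exp _)
  · refine PosMult.pow ?_ n
    have := (PosMult.const (V := V) zero_le_one).add
      (hh.mul (PosMult.const (V := V) (c := (n : ℝ)⁻¹) (by positivity)))
    simpa [div_eq_mul_inv] using this
  · rw [abs_pow]
    have h1 : |1 + h ξ / n| ≤ Real.exp (B / n) := by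
      calc |1 + h ξ / n| ≤ 1 + B / n := by
            refine (abs_add_le _ _).trans ?_
            rw [abs_one, abs_div, Nat.abs_cast]
            gcongr
            exact hB ξ
        _ ≤ _ := by rw [add_comm]; exact Real.add_one_le_exp _
    refine (pow_le_pow_left₀ (abs_nonneg _) h1 n).trans ?_
    rw [← Real.exp_nat_mul]
    refine Real.exp_le_exp.2 ?_
    rcases eq_or_ne n 0 with rfl | hn
    · simpa using hB0
    · have : (n : ℝ) ≠ 0 := by exact_mod_cast hn
      rw [mul_div_cancel₀ _ this]

/-- Since |ξ|²/(|ξ|²+d) = 1 - d/(|ξ|²+d), the minus sign in the exponent disappears: the function is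
e^(-c) times the exponential of a nonnegative multiple of an admissible multiplier. -/
theorem PosMult.exp_neg_div {c d : ℝ} (hc : 0 ≤ c) (hd : 0 < d) :
    PosMult (fun ξ : V => Real.exp (-(c * (‖ξ‖ ^ 2 / (‖ξ‖ ^ 2 + d))))) := by
  have h1 := (PosMult.const (V := V) (Real.exp_pos (-c)).le).mul
    (((PosMult.const (V := V) hc).mul (PosMult.rational (V := V) one_pos hd)).exp)
  convert h1 using 2 with ξ
  rw [← Real.exp_add, Real.rpow_one]
  congr 1
  have : 0 < ‖ξ‖ ^ 2 + d := by positivity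
  field_simp
  ring

theorem PosMult.exp_neg_series {c : ℝ} (hc : 0 ≤ c) {d : ℕ → ℝ} (hd : ∀ j, 0 < d j) {h : V → ℝ}
    (hh : Continuous h)
    (hlim : ∀ ξ, Tendsto (fun n => ∑ j ∈ Finset.range n, ‖ξ‖ ^ 2 / (‖ξ‖ ^ 2 + d j)) atTop
      (𝓝 (h ξ))) : PosMult (fun ξ : V => Real.exp (-(c * h ξ))) := by
  refine PosMult.of_tendsto (g := fun n ξ => ∏ j ∈ Finset.range n,
    Real.exp (-(c * (‖ξ‖ ^ 2 / (‖ξ‖ ^ 2 + d j))))) (B := 1)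
    (fun n => PosMult.prod (fun j => PosMult.exp_neg_div hc (hd j)) n) (fun n ξ => ?_)
    (by fun_prop) (fun ξ => ?_)
  · rw [Finset.abs_prod]
    refine Finset.prod_le_one (fun j _ => abs_nonneg _) fun j _ => ?_
    rw [abs_of_pos (Real.exp_pos _), Real.exp_le_one_iff, neg_nonpos]
    have := hd j
    positivity
  · simp_rw [← Real.exp_sum, Finset.sum_neg_distrib, ← Finset.mul_sum]
    exact (Real.continuous_exp.tendsto _).comp ((hlim ξ).const_mul c).neg

/-- The function 1 is not integrable, so the multiplier is applied to ever wider Gaussians, whose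
transforms are nonnegative. -/
theorem PosMult.fourier_nonneg {g : V → ℝ} (hg : PosMult g) (hi : Integrable g) (y : V) :
    0 ≤ 𝓕 (fun ξ => (g ξ : ℂ)) y := by
  refine fourier_nonneg_of_tendsto (l := atTop)
    (F := fun (n : ℕ) ξ => (g ξ : ℂ) * Complex.exp (-((n : ℝ) + 1 : ℝ)⁻¹ * ‖ξ‖ ^ 2))
    (b := fun ξ => ‖g ξ‖) (fun n => ?_) hi.norm (fun n ξ => ?_) (fun ξ => ?_)
    (Eventually.of_forall fun n => ?_) y
  · exact hi.ofReal.1.mul (Continuous.aestronglyMeasurable (by fun_prop))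
  · rw [norm_mul, Complex.norm_real]
    refine mul_le_of_le_one_right (norm_nonneg _) ?_
    rw [Complex.norm_exp, Real.exp_le_one_iff]
    norm_cast
    rw [neg_mul, neg_nonpos]
    positivity
  · have h1 : Tendsto (fun n : ℕ => (((n : ℝ) + 1 : ℝ)⁻¹)) atTop (𝓝 0) := by
      simpa using tendsto_one_div_add_atTop_nhds_zero_nat (𝕜 := ℝ)
    have h2 : Tendsto (fun n : ℕ => Complex.exp (-((((n : ℝ) + 1 : ℝ)⁻¹ : ℝ) : ℂ) * ‖ξ‖ ^ 2))
        atTop (𝓝 (Complex.exp (-((0 : ℝ) : ℂ) * ‖ξ‖ ^ 2))) := by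
      refine (Complex.continuous_exp.tendsto _).comp (Tendsto.mul_const _ (Tendsto.neg ?_))
      exact (Complex.continuous_ofReal.tendsto _).comp h1
    simpa using h2.const_mul (g ξ : ℂ)
  · have hn : (0 : ℝ) < ((n : ℝ) + 1)⁻¹ := by positivity
    refine hg.2.2 _ (by simpa using integrable_cexp_gaussian (V := V) hn) fun w => ?_
    have := fourier_translated_gaussian hn (0 : V) w
    simp only [sub_zero, inner_zero_left, mul_zero, Complex.ofReal_zero, zero_mul,
      Complex.exp_zero, one_mul, Complex.ofReal_inv] at this
    simp only [Complex.ofReal_inv]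
    rw [this]
    refine mul_nonneg (Complex.zero_le_real.2 (by positivity)) ?_
    have e : Complex.exp (-((Real.pi : ℂ) ^ 2 / (((n : ℝ) + 1 : ℝ) : ℂ)⁻¹) * (‖w‖ : ℂ) ^ 2) =
        ((Real.exp (-(Real.pi ^ 2 / ((n : ℝ) + 1)⁻¹) * ‖w‖ ^ 2) : ℝ) : ℂ) := by
      push_cast; rfl
    rw [e]
    exact Complex.zero_le_real.2 (Real.exp_pos _).le

/-- A continuous integrable function with nonnegative Fourier transform has an integrable Fourier
transform. -/
theorem integrable_fourier_of_nonneg {f : V → ℂ} (hc : Continuous f) (hf : Integrable f)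
    (hpos : ∀ y, 0 ≤ 𝓕 f y) : Integrable (𝓕 f) := by
  have hcont : Continuous (𝓕 f) :=
    VectorFourier.fourierIntegral_continuous Real.continuous_fourierChar
      (by exact continuous_inner) hf
  have hbd : ∀ y, ‖𝓕 f y‖ ≤ ∫ ξ, ‖f ξ‖ := fun y =>
    VectorFourier.norm_fourierIntegral_le_integral_norm _ _ _ _ _
  -- Gaussian summation of the inversion integral at the origin, valid at a point of continuity of f
  -- without integrability of its transform.
  have hT : Tendsto (fun n : ℕ => ∫ w : V, Complex.exp (-((n : ℝ) + 1 : ℝ)⁻¹ * ‖w‖ ^ 2) * 𝓕 f w)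
      atTop (𝓝 (f 0)) := by
    have h := Real.tendsto_integral_gaussian_smul' hf (v := 0) hc.continuousAt
    have h' := h.comp (tendsto_atTop_add_const_right _ (1 : ℝ) tendsto_natCast_atTop_atTop)
    refine h'.congr fun n => ?_
    have hn : (0 : ℝ) < (((n : ℝ) + 1))⁻¹ := by positivity
    have flip : ∫ ξ, 𝓕 (fun v : V => Complex.exp (-(((n : ℝ) + 1 : ℝ)⁻¹ : ℝ) * ‖v‖ ^ 2)) ξ • f ξ =
        ∫ v, Complex.exp (-(((n : ℝ) + 1 : ℝ)⁻¹ : ℝ) * ‖v‖ ^ 2) • 𝓕 f v := by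
      simpa using! VectorFourier.integral_fourierIntegral_smul_eq_flip (L := innerₗ V)
        Real.continuous_fourierChar continuous_inner (integrable_cexp_gaussian hn) hf
    have hre : (0 : ℝ) < ((((n : ℝ) + 1)⁻¹ : ℝ) : ℂ).re := by rwa [Complex.ofReal_re]
    simp_rw [fourier_gaussian_innerProductSpace hre] at flip
    simp only [smul_eq_mul] at flip ⊢
    rw [← flip]
    simp only [Function.comp_apply]
    congr 1; ext w
    congr 2
    · congr 1
      rw [Complex.ofReal_inv, div_inv_eq_mul]
    · rw [zero_sub, norm_neg, Complex.ofReal_inv, div_inv_eq_mul]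
      ring_nf
  have hmeas : ∀ n : ℕ, Integrable
      (fun w : V => Complex.exp (-((n : ℝ) + 1 : ℝ)⁻¹ * ‖w‖ ^ 2) * 𝓕 f w) := fun n => by
    have hn : (0 : ℝ) < (((n : ℝ) + 1))⁻¹ := by positivity
    have := (integrable_cexp_gaussian (V := V) hn).mul_bdd (c := ∫ ξ, ‖f ξ‖)
      hcont.aestronglyMeasurable (Eventually.of_forall hbd)
    simpa using this
  refine ⟨hcont.aestronglyMeasurable, ?_⟩
  have hnorm : ∀ n : ℕ, ∫⁻ w : V, ‖Complex.exp (-((n : ℝ) + 1 : ℝ)⁻¹ * ‖w‖ ^ 2) * 𝓕 f w‖ₑ =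
      ENNReal.ofReal (∫ w : V, Complex.exp (-((n : ℝ) + 1 : ℝ)⁻¹ * ‖w‖ ^ 2) * 𝓕 f w).re := by
    intro n
    rw [← ofReal_integral_norm_eq_lintegral_enorm (hmeas n)]
    congr 1
    have e : ∀ w : V, Complex.exp (-((n : ℝ) + 1 : ℝ)⁻¹ * ‖w‖ ^ 2) * 𝓕 f w =
        ((‖Complex.exp (-((n : ℝ) + 1 : ℝ)⁻¹ * ‖w‖ ^ 2) * 𝓕 f w‖ : ℝ) : ℂ) := by
      intro w
      have h0 : 0 ≤ Complex.exp (-((n : ℝ) + 1 : ℝ)⁻¹ * ‖w‖ ^ 2) := by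
        have e1 : Complex.exp (-((n : ℝ) + 1 : ℝ)⁻¹ * ‖w‖ ^ 2)
            = ((Real.exp (-((n : ℝ) + 1)⁻¹ * ‖w‖ ^ 2) : ℝ) : ℂ) := by push_cast; rfl
        rw [e1]; exact Complex.zero_le_real.2 (Real.exp_pos _).le
      exact Complex.eq_coe_norm_of_nonneg (mul_nonneg h0 (hpos w))
    conv_rhs => rw [show (fun w : V => Complex.exp (-((n : ℝ) + 1 : ℝ)⁻¹ * ‖w‖ ^ 2) * 𝓕 f w) =
      fun w => ((‖Complex.exp (-((n : ℝ) + 1 : ℝ)⁻¹ * ‖w‖ ^ 2) * 𝓕 f w‖ : ℝ) : ℂ) from funext e]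
    rw [integral_complex_ofReal, Complex.ofReal_re]
  have hlim : Tendsto (fun n : ℕ =>
      ∫⁻ w : V, ‖Complex.exp (-((n : ℝ) + 1 : ℝ)⁻¹ * ‖w‖ ^ 2) * 𝓕 f w‖ₑ) atTop
      (𝓝 (ENNReal.ofReal (f 0).re)) := by
    simp_rw [hnorm]
    exact ENNReal.tendsto_ofReal ((Complex.continuous_re.tendsto _).comp hT)
  -- By nonnegativity the Gaussian means are already integrals of absolute values, so Fatou bounds
  -- the L¹ norm by f 0.
  have hfatou : ∫⁻ w, ‖𝓕 f w‖ₑ ≤ ENNReal.ofReal (f 0).re := by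
    rw [← hlim.liminf_eq]
    have hpt : ∀ w : V, ‖𝓕 f w‖ₑ = liminf (fun n : ℕ =>
        ‖Complex.exp (-((n : ℝ) + 1 : ℝ)⁻¹ * ‖w‖ ^ 2) * 𝓕 f w‖ₑ) atTop := by
      intro w
      refine (Tendsto.liminf_eq ?_).symm
      have h1 : Tendsto (fun n : ℕ => (((n : ℝ) + 1 : ℝ)⁻¹)) atTop (𝓝 0) := by
        simpa using tendsto_one_div_add_atTop_nhds_zero_nat (𝕜 := ℝ)
      have h2 : Tendsto (fun n : ℕ => Complex.exp (-((((n : ℝ) + 1 : ℝ)⁻¹ : ℝ) : ℂ) * ‖w‖ ^ 2)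
          * 𝓕 f w) atTop (𝓝 (Complex.exp (-((0 : ℝ) : ℂ) * ‖w‖ ^ 2) * 𝓕 f w)) := by
        refine Tendsto.mul_const _ ((Complex.continuous_exp.tendsto _).comp
          (Tendsto.mul_const _ (Tendsto.neg ?_)))
        exact (Complex.continuous_ofReal.tendsto _).comp h1
      simpa using h2.enorm
    simp_rw [hpt]
    exact lintegral_liminf_le' fun n => (hmeas n).1.enorm
  exact hfatou.trans_lt ENNReal.ofReal_lt_top

end PosMult

end

/-! ### Product and partial fraction expansions of hyperbolic functions -/

noncomputable section

open scoped FourierTransform ComplexOrder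

/-- Euler's sine product at the imaginary point iv/π. -/
theorem tendsto_shc_prod (v : ℝ) :
    Tendsto (fun n : ℕ => ∏ j ∈ Finset.range n, (1 + v ^ 2 / (Real.pi ^ 2 * ((j : ℝ) + 1) ^ 2)))
      atTop (𝓝 (shc v)) := by
  rcases eq_or_ne v 0 with rfl | hv
  · simp [shc_zero]
  have hpi : (Real.pi : ℂ) ≠ 0 := by exact_mod_cast Real.pi_ne_zero
  have h := Complex.tendsto_euler_sin_prod (v * Complex.I / Real.pi)
  rw [mul_div_cancel₀ _ hpi, Complex.sin_mul_I] at h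
  have hvc : (v : ℂ) * Complex.I ≠ 0 :=
    mul_ne_zero (by exact_mod_cast hv) Complex.I_ne_zero
  have h2 := h.const_mul ((v : ℂ) * Complex.I)⁻¹
  have h3 := (Complex.continuous_re.tendsto _).comp h2
  have e : (((v : ℂ) * Complex.I)⁻¹ * (Complex.sinh v * Complex.I)).re = shc v := by
    rw [shc_of_ne hv, mul_inv, mul_mul_mul_comm, inv_mul_cancel₀ Complex.I_ne_zero, mul_one,
      ← Complex.ofReal_sinh, ← Complex.ofReal_inv, ← Complex.ofReal_mul, Complex.ofReal_re]
    ring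
  rw [e] at h3
  refine h3.congr fun n => ?_
  simp only [Function.comp_apply]
  rw [← mul_assoc, inv_mul_cancel₀ hvc, one_mul]
  have e2 : ∏ j ∈ Finset.range n, ((1 : ℂ) - (v * Complex.I / Real.pi) ^ 2 / ((j : ℂ) + 1) ^ 2) =
      ((∏ j ∈ Finset.range n, (1 + v ^ 2 / (Real.pi ^ 2 * ((j : ℝ) + 1) ^ 2)) : ℝ) : ℂ) := by
    push_cast
    refine Finset.prod_congr rfl fun j _ => ?_
    rw [div_pow, mul_pow, Complex.I_sq, div_div]
    ring
  rw [e2, Complex.ofReal_re]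

/-- The Mittag-Leffler expansion of the cotangent at iv/π, multiplied by iv/π to make every term
real. -/
theorem tendsto_vcoth_sum {v : ℝ} (hv : v ≠ 0) :
    Tendsto (fun n : ℕ => ∑ j ∈ Finset.range n,
      2 * v ^ 2 / (v ^ 2 + Real.pi ^ 2 * ((j : ℝ) + 1) ^ 2))
      atTop (𝓝 (v * Real.cosh v / Real.sinh v - 1)) := by
  have hpi : (Real.pi : ℂ) ≠ 0 := by exact_mod_cast Real.pi_ne_zero
  have hvc : (v : ℂ) ≠ 0 := by exact_mod_cast hv
  have hsc : Complex.sinh v ≠ 0 := by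
    rw [← Complex.ofReal_sinh]; exact_mod_cast (Real.sinh_ne_zero.2 hv)
  have hmem : (v * Complex.I / Real.pi : ℂ) ∈ Complex.integerComplement := by
    rw [Complex.mem_integerComplement_iff]
    rintro ⟨n, hn⟩
    have := congrArg Complex.im hn
    rw [Complex.intCast_im, Complex.div_ofReal_im, Complex.im_ofReal_mul, Complex.I_im,
      mul_one] at this
    exact (div_ne_zero hv Real.pi_ne_zero) this.symm
  have h := tendsto_logDeriv_euler_cot_sub hmem
  rw [mul_div_cancel₀ _ hpi, Complex.cot_eq_cos_div_sin, Complex.sin_mul_I, Complex.cos_mul_I] at h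
  have h2 := h.const_mul ((v : ℂ) * Complex.I / Real.pi)
  have h3 := (Complex.continuous_re.tendsto _).comp h2
  have e : ((v : ℂ) * Complex.I / Real.pi * (Real.pi * (Complex.cosh v /
      (Complex.sinh v * Complex.I)) - 1 / (v * Complex.I / Real.pi))).re =
      v * Real.cosh v / Real.sinh v - 1 := by
    have : (v : ℂ) * Complex.I / Real.pi * (Real.pi * (Complex.cosh v /
      (Complex.sinh v * Complex.I)) - 1 / (v * Complex.I / Real.pi)) =
      ((v * Real.cosh v / Real.sinh v - 1 : ℝ) : ℂ) := by
      push_cast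
      have := Complex.I_ne_zero
      field_simp
    rw [this, Complex.ofReal_re]
  rw [e] at h3
  refine h3.congr fun n => ?_
  simp only [Function.comp_apply]
  have e2 : (v : ℂ) * Complex.I / Real.pi *
      ∑ j ∈ Finset.range n, cotTerm (v * Complex.I / Real.pi) j =
      ((∑ j ∈ Finset.range n, 2 * v ^ 2 / (v ^ 2 + Real.pi ^ 2 * ((j : ℝ) + 1) ^ 2) : ℝ) : ℂ) := by
    rw [Finset.mul_sum]
    push_cast
    refine Finset.sum_congr rfl fun j _ => ?_
    rw [cotTerm_identity hmem]
    have hd : (v : ℂ) ^ 2 + (Real.pi : ℂ) ^ 2 * ((j : ℂ) + 1) ^ 2 ≠ 0 := by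
      have : 0 < v ^ 2 + Real.pi ^ 2 * ((j : ℝ) + 1) ^ 2 := by positivity
      exact_mod_cast this.ne'
    have e3 : ((v : ℂ) * Complex.I / Real.pi + (j + 1)) * (v * Complex.I / Real.pi - (j + 1)) =
        -((v : ℂ) ^ 2 + (Real.pi : ℂ) ^ 2 * ((j : ℂ) + 1) ^ 2) / (Real.pi : ℂ) ^ 2 := by
      field_simp
      linear_combination (v : ℂ) ^ 2 * Complex.I_sq
    rw [e3]
    field_simp
    linear_combination (-1 : ℂ) * Complex.I_sq
  rw [e2, Complex.ofReal_re]

/-- The continuous extension of `v coth (v / 2)`. -/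
def vcoth (v : ℝ) : ℝ := 2 * Real.cosh (v / 2) / shc (v / 2)

@[fun_prop]
theorem continuous_vcoth : Continuous vcoth := by
  unfold vcoth
  exact Continuous.div₀ (by fun_prop) (continuous_shc.comp (by fun_prop)) fun v => (shc_pos _).ne'

theorem vcoth_sub_vtanh (v : ℝ) : vcoth v - vtanh v = 2 * (shc v)⁻¹ := by
  have h1 := (shc_pos (v / 2)).ne'
  have h2 := (Real.cosh_pos (v / 2)).ne'
  have h3 := Real.cosh_sq (v / 2)
  rw [← mul_shc] at h3
  rw [shc_eq_half v, vcoth, vtanh]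
  field_simp
  linear_combination 4 * h3

theorem tendsto_vcoth (v : ℝ) :
    Tendsto (fun n : ℕ => ∑ j ∈ Finset.range n,
      4 * v ^ 2 / (v ^ 2 + 4 * Real.pi ^ 2 * ((j : ℝ) + 1) ^ 2)) atTop (𝓝 (vcoth v - 2)) := by
  rcases eq_or_ne v 0 with rfl | hv
  · simp [vcoth, shc_zero]
  have h2 : v / 2 ≠ 0 := by positivity
  have h := (tendsto_vcoth_sum h2).const_mul 2
  have hs := Real.sinh_ne_zero.2 h2
  have e : 2 * (v / 2 * Real.cosh (v / 2) / Real.sinh (v / 2) - 1) = vcoth v - 2 := by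
    rw [vcoth, shc_of_ne h2]
    field_simp
  rw [e] at h
  refine h.congr fun n => ?_
  rw [Finset.mul_sum]
  refine Finset.sum_congr rfl fun j _ => ?_
  have : 0 < v ^ 2 + 4 * Real.pi ^ 2 * ((j : ℝ) + 1) ^ 2 := by positivity
  have : 0 < (v / 2) ^ 2 + Real.pi ^ 2 * ((j : ℝ) + 1) ^ 2 := by positivity
  rw [mul_div_assoc', div_eq_div_iff (by positivity) (by positivity)]
  ring

/-- From v tanh(v/2) = 2v coth v - v coth(v/2): along partial sums of even length, subtracting the
second series removes the poles of even index and leaves the odd ones. -/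
theorem tendsto_vtanh (v : ℝ) :
    Tendsto (fun n : ℕ => ∑ j ∈ Finset.range n,
      4 * v ^ 2 / (v ^ 2 + Real.pi ^ 2 * (2 * (j : ℝ) + 1) ^ 2)) atTop (𝓝 (vtanh v)) := by
  rcases eq_or_ne v 0 with rfl | hv
  · simp [vtanh_zero]
  have h1 := ((tendsto_vcoth_sum hv).comp
    (tendsto_id.const_mul_atTop' (by norm_num : 0 < 2))).const_mul 2
  have h2 := h1.sub (tendsto_vcoth v)
  have hs := Real.sinh_ne_zero.2 hv
  have e : 2 * (v * Real.cosh v / Real.sinh v - 1) - (vcoth v - 2) = vtanh v := by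
    have h3 := vcoth_sub_vtanh v
    have h4 := vtanh_eq_of_ne hv
    rw [shc_of_ne hv] at h3
    have h5 : vcoth v = v * (Real.cosh v - 1) / Real.sinh v + 2 * (Real.sinh v / v)⁻¹ := by
      linarith
    rw [h4, h5]
    field_simp
    ring
  rw [e] at h2
  refine h2.congr fun n => ?_
  simp only [Function.comp_apply, id]
  -- Each step adds two terms of the first series; the one of index 2n+1 cancels against the new
  -- term of the second.
  induction n with
  | zero => simp
  | succ n ih =>
    rw [Finset.sum_range_succ _ n, Finset.sum_range_succ _ n, ← ih, mul_add 2 n 1, mul_one,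
      show 2 * n + 2 = 2 * n + 1 + 1 from rfl, Finset.sum_range_succ _ (2 * n + 1),
      Finset.sum_range_succ _ (2 * n)]
    push_cast
    have e1 : 4 * v ^ 2 / (v ^ 2 + 4 * Real.pi ^ 2 * ((n : ℝ) + 1) ^ 2) =
        2 * (2 * v ^ 2 / (v ^ 2 + Real.pi ^ 2 * (2 * (n : ℝ) + 1 + 1) ^ 2)) := by
      rw [mul_div_assoc']
      congr 1 <;> ring
    rw [e1]
    ring

/-! ### Positivity, size and partial Fourier transform of the Grushin kernel -/

section Kernel

variable {N k : ℕ}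

/-- The parallelogram law and 2/`shc` = `vcoth` - `vtanh` diagonalise the exponent in x + w and x -
w. Subtracting 2 from `vcoth` makes that exponent vanish at l = 0, so both nonconstant exponents
have expansions with nonnegative terms. -/
theorem mehler_eq_vcoth (x w : EuclideanSpace ℝ (Fin N)) {t : ℝ} (ht : 0 < t) (l : ℝ) :
    mehler x w t l = t⁻¹ ^ ((N : ℝ) / 2) * (shc (l * t))⁻¹ ^ ((N : ℝ) / 2) *
      (Real.exp (-((4 * t)⁻¹ * ‖x + w‖ ^ 2 * vtanh (l * t))) *
      (Real.exp (-((4 * t)⁻¹ * ‖x - w‖ ^ 2 * (vcoth (l * t) - 2))) *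
        Real.exp (-((2 * t)⁻¹ * ‖x - w‖ ^ 2)))) := by
  have hs := shc_pos (l * t)
  rw [mehler, ← Real.exp_add, ← Real.exp_add, mul_inv,
    Real.mul_rpow (by positivity) (by positivity)]
  congr 2
  have h := vcoth_sub_vtanh (l * t)
  have h2 : vcoth (l * t) = vtanh (l * t) + 2 * (shc (l * t))⁻¹ := by linarith
  have h3 : ‖x‖ ^ 2 + ‖w‖ ^ 2 = (‖x + w‖ ^ 2 + ‖x - w‖ ^ 2) / 2 := by
    have := parallelogram_law_with_norm ℝ x w
    nlinarith
  rw [h2, h3, mul_inv, mul_inv]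
  ring

/-- Euler's product handles the power of `shc`, with exponent N/2 in each factor;
`PosMult.exp_neg_series` handles the two exponentials. The factor 4 common to the terms of both
series is moved into the constant, and the numbers d are the poles divided by t². -/
theorem posMult_mehler (hN : 1 ≤ N) (x w : EuclideanSpace ℝ (Fin N)) {t : ℝ} (ht : 0 < t) :
    PosMult (fun ξ : EuclideanSpace ℝ (Fin k) => mehler x w t ‖ξ‖) := by
  have hN' : (0 : ℝ) < N := by exact_mod_cast hN
  have e : (fun ξ : EuclideanSpace ℝ (Fin k) => mehler x w t ‖ξ‖) = fun ξ =>
      t⁻¹ ^ ((N : ℝ) / 2) * (shc (‖ξ‖ * t))⁻¹ ^ ((N : ℝ) / 2) *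
      (Real.exp (-((4 * t)⁻¹ * ‖x + w‖ ^ 2 * 4 * (vtanh (‖ξ‖ * t) / 4))) *
      (Real.exp (-((4 * t)⁻¹ * ‖x - w‖ ^ 2 * 4 * ((vcoth (‖ξ‖ * t) - 2) / 4))) *
        Real.exp (-((2 * t)⁻¹ * ‖x - w‖ ^ 2)))) := by
    ext ξ
    have h4 : ∀ a b : ℝ, a * 4 * (b / 4) = a * b := fun a b => by ring
    rw [h4, h4, mehler_eq_vcoth x w ht ‖ξ‖]
  rw [e]
  have h0 : ∀ ξ : EuclideanSpace ℝ (Fin k), 0 ≤ ‖ξ‖ ^ 2 := fun ξ => by positivity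
  refine PosMult.mul (PosMult.mul (PosMult.const (by positivity)) ?_) (PosMult.mul
    (PosMult.exp_neg_series (d := fun j => Real.pi ^ 2 * (2 * (j : ℝ) + 1) ^ 2 / t ^ 2)
      (by positivity) (fun j => by positivity) (by fun_prop) fun ξ => ?_)
    (PosMult.mul (PosMult.exp_neg_series
      (d := fun j => 4 * Real.pi ^ 2 * ((j : ℝ) + 1) ^ 2 / t ^ 2) (by positivity)
      (fun j => by positivity) (by fun_prop) fun ξ => ?_)
      (PosMult.const (Real.exp_pos _).le)))
  · refine PosMult.of_tendsto (B := 1) (g := fun n ξ => ∏ j ∈ Finset.range n,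
      ((Real.pi ^ 2 * ((j : ℝ) + 1) ^ 2 / t ^ 2) /
        (‖ξ‖ ^ 2 + Real.pi ^ 2 * ((j : ℝ) + 1) ^ 2 / t ^ 2)) ^ ((N : ℝ) / 2))
      (fun n => PosMult.prod (fun j => PosMult.rational (by positivity) (by positivity)) n)
      (fun n ξ => ?_) ?_ (fun ξ => ?_)
    · rw [Finset.abs_prod]
      refine Finset.prod_le_one (fun j _ => abs_nonneg _) fun j _ => ?_
      rw [abs_of_nonneg (by positivity)]
      refine Real.rpow_le_one (by positivity) ?_ (by positivity)
      rw [div_le_one (by positivity)]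
      linarith [h0 ξ]
    · refine Continuous.rpow_const (Continuous.inv₀ (by fun_prop) fun ξ => (shc_pos _).ne')
        (fun ξ => Or.inr (by positivity))
    · have h := ((tendsto_shc_prod (‖ξ‖ * t)).inv₀ (shc_pos _).ne').rpow_const
        (p := (N : ℝ) / 2) (Or.inr (by positivity))
      refine h.congr fun n => ?_
      rw [← Finset.prod_inv_distrib, ← Real.finsetProd_rpow _ _ (fun j _ => by positivity)]
      refine Finset.prod_congr rfl fun j _ => ?_
      congr 1
      have : 0 < ‖ξ‖ ^ 2 + Real.pi ^ 2 * ((j : ℝ) + 1) ^ 2 / t ^ 2 := by positivity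
      field_simp
      ring
  · refine ((tendsto_vtanh (‖ξ‖ * t)).div_const 4).congr fun n => ?_
    rw [Finset.sum_div]
    refine Finset.sum_congr rfl fun j _ => ?_
    have : 0 < ‖ξ‖ ^ 2 + Real.pi ^ 2 * (2 * (j : ℝ) + 1) ^ 2 / t ^ 2 := by positivity
    have : 0 < (‖ξ‖ * t) ^ 2 + Real.pi ^ 2 * (2 * (j : ℝ) + 1) ^ 2 := by positivity
    field_simp
  · refine ((tendsto_vcoth (‖ξ‖ * t)).div_const 4).congr fun n => ?_
    rw [Finset.sum_div]
    refine Finset.sum_congr rfl fun j _ => ?_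
    have : 0 < ‖ξ‖ ^ 2 + 4 * Real.pi ^ 2 * ((j : ℝ) + 1) ^ 2 / t ^ 2 := by positivity
    have : 0 < (‖ξ‖ * t) ^ 2 + 4 * Real.pi ^ 2 * ((j : ℝ) + 1) ^ 2 := by positivity
    field_simp

theorem integrable_exp_neg_norm {V : Type*} [NormedAddCommGroup V] [NormedSpace ℝ V]
    [FiniteDimensional ℝ V] [MeasurableSpace V] [BorelSpace V] (μ : Measure V)
    [μ.IsAddHaarMeasure] {c : ℝ} (hc : 0 < c) :
    Integrable (fun ξ : V => Real.exp (-(c * ‖ξ‖))) μ := by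
  set m := Module.finrank ℝ V + 1 with hm
  have h := integrable_one_add_norm (μ := μ) (E := V) (r := m) (by rw [hm]; push_cast; linarith)
  refine (h.const_mul (m.factorial / c ^ m * Real.exp c)).mono'
    (Continuous.aestronglyMeasurable (by fun_prop)) (Eventually.of_forall fun ξ => ?_)
  rw [Real.norm_eq_abs, abs_of_pos (Real.exp_pos _), Real.rpow_neg (by positivity),
    Real.rpow_natCast, Real.exp_neg]
  have h1 := Real.pow_div_factorial_le_exp (c * (1 + ‖ξ‖)) (by positivity) m
  rw [mul_add, mul_one, Real.exp_add, div_le_iff₀ (by positivity)] at h1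
  rw [inv_le_iff_one_le_mul₀ (Real.exp_pos _)]
  have h3 : c ^ m * (1 + ‖ξ‖) ^ m ≤ Real.exp c * Real.exp (c * ‖ξ‖) * m.factorial := by
    rw [← mul_pow, mul_add, mul_one]; exact h1
  have e : ↑m.factorial / c ^ m * Real.exp c * ((1 + ‖ξ‖) ^ m)⁻¹ * Real.exp (c * ‖ξ‖) =
      (Real.exp c * Real.exp (c * ‖ξ‖) * m.factorial) / (c ^ m * (1 + ‖ξ‖) ^ m) := by
    field_simp
  rw [e, one_le_div (by positivity)]
  exact h3

theorem continuous_mehler_norm (x w : EuclideanSpace ℝ (Fin N)) {t : ℝ} (ht : 0 < t) :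
    Continuous (fun ξ : EuclideanSpace ℝ (Fin k) => mehler x w t ‖ξ‖) :=
  (continuous_mehler_last x w ht).comp continuous_norm

theorem integrable_mehler (hN : 1 ≤ N) (x w : EuclideanSpace ℝ (Fin N)) {t : ℝ} (ht : 0 < t) :
    Integrable (fun ξ : EuclideanSpace ℝ (Fin k) => mehler x w t ‖ξ‖) := by
  have hN' : (0 : ℝ) < N := by exact_mod_cast hN
  refine ((integrable_exp_neg_norm (c := N * t / 4) volume (by positivity)).const_mul
    ((2 / t) ^ ((N : ℝ) / 2))).mono' (continuous_mehler_norm x w ht).aestronglyMeasurable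
    (Eventually.of_forall fun ξ => ?_)
  rw [Real.norm_eq_abs, abs_of_pos (mehler_pos x w ht _)]
  exact mehler_le x w ht _

/-- The normalizing constant of the Grushin kernel. -/
def grushinConst (N k : ℕ) : ℝ := 1 / (2 * Real.pi) ^ (((N : ℝ) + 2 * k) / 2)

theorem grushinConst_pos (N k : ℕ) : 0 < grushinConst N k := by
  unfold grushinConst; positivity

theorem grushinConst_mul (N k : ℕ) :
    grushinConst N k * (2 * Real.pi) ^ k * (2 * Real.pi) ^ ((N : ℝ) / 2) = 1 := by
  unfold grushinConst
  rw [← Real.rpow_natCast, mul_assoc, ← Real.rpow_add (by positivity), one_div_mul_eq_div,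
    div_eq_one_iff_eq (by positivity)]
  congr 1; ring

/-- The original integrand and the regularised one agree off ξ = 0, a null set because k ≥ 1. -/
theorem grushinKernelComplex_eq (hk : 1 ≤ k) (x w : EuclideanSpace ℝ (Fin N))
    (y : EuclideanSpace ℝ (Fin k)) {t : ℝ} (ht : 0 < t) :
    grushinKernelComplex x w y t = (grushinConst N k : ℂ) *
      ∫ ξ : EuclideanSpace ℝ (Fin k), (mehler x w t ‖ξ‖ : ℂ) *
        Complex.exp ((inner ℝ ξ y : ℝ) * Complex.I) := by
  have : Nonempty (Fin k) := ⟨⟨0, hk⟩⟩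
  unfold grushinKernelComplex grushinConst
  congr 1
  refine integral_congr_ae ?_
  filter_upwards [compl_mem_ae_iff.2 (measure_singleton (0 : EuclideanSpace ℝ (Fin k)))] with ξ hξ
  have hξ' : 0 < ‖ξ‖ := norm_pos_iff.2 hξ
  rw [mehler_eq x w ht hξ', Complex.ofReal_mul (_ ^ _), mul_assoc ((_ : ℝ) : ℂ),
    Complex.ofReal_exp, ← Complex.exp_add, grushinPhase, Complex.ofReal_neg]
  congr 2
  ring

theorem grushinKernelComplex_eq_fourierInv (hk : 1 ≤ k) (x w : EuclideanSpace ℝ (Fin N))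
    (y : EuclideanSpace ℝ (Fin k)) {t : ℝ} (ht : 0 < t) :
    grushinKernelComplex x w y t = (grushinConst N k : ℂ) *
      𝓕⁻ (fun ξ : EuclideanSpace ℝ (Fin k) => (mehler x w t ‖ξ‖ : ℂ)) ((2 * Real.pi)⁻¹ • y) := by
  rw [grushinKernelComplex_eq hk x w y ht, Real.fourierInv_eq']
  congr 2; ext ξ
  rw [smul_eq_mul, mul_comm, real_inner_smul_right, ← mul_assoc, mul_inv_cancel₀ (by positivity),
    one_mul]

theorem grushinKernel_nonneg (hN : 1 ≤ N) (hk : 1 ≤ k) (x w : EuclideanSpace ℝ (Fin N))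
    (y : EuclideanSpace ℝ (Fin k)) {t : ℝ} (ht : 0 < t) : 0 ≤ grushinKernel x w y t := by
  rw [← Complex.zero_le_real, ofReal_grushinKernel, grushinKernelComplex_eq_fourierInv hk x w y ht,
    Real.fourierInv_eq_fourier_neg]
  exact mul_nonneg (Complex.zero_le_real.2 (grushinConst_pos N k).le)
    ((posMult_mehler hN x w ht).fourier_nonneg (integrable_mehler hN x w ht) _)

theorem grushinKernel_comm (x w : EuclideanSpace ℝ (Fin N)) (y : EuclideanSpace ℝ (Fin k))
    (t : ℝ) : grushinKernel x w y t = grushinKernel w x y t := by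
  unfold grushinKernel grushinKernelComplex
  have : ∀ ξ : EuclideanSpace ℝ (Fin k), grushinPhase x w ξ t = grushinPhase w x ξ t := by
    intro ξ
    unfold grushinPhase
    rw [add_comm (‖x‖ ^ 2), real_inner_comm]
  simp_rw [this]

theorem grushinKernel_neg (x w : EuclideanSpace ℝ (Fin N)) (y : EuclideanSpace ℝ (Fin k))
    (t : ℝ) : grushinKernel x w (-y) t = grushinKernel x w y t := by
  unfold grushinKernel grushinKernelComplex
  congr 2
  rw [← integral_neg_eq_self]
  simp [grushinPhase, inner_neg_left]

/-- Discard the oscillation and integrate `mehler_le`: the prefactor contributes t^(-N/2), and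
rescaling ξ by t contributes t^(-k). -/
theorem grushinKernel_le (hN : 1 ≤ N) (hk : 1 ≤ k) : ∃ A : ℝ≥0,
    ∀ (x w : EuclideanSpace ℝ (Fin N)) (y : EuclideanSpace ℝ (Fin k)) (t : ℝ), 0 < t →
      grushinKernel x w y t ≤ A * t ^ (-(((N : ℝ) + 2 * k) / 2)) := by
  have hN' : (0 : ℝ) < N := by exact_mod_cast hN
  have hI : 0 ≤ ∫ ξ : EuclideanSpace ℝ (Fin k), Real.exp (-(N / 4 * ‖ξ‖)) :=
    integral_nonneg fun ξ => (Real.exp_pos _).le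
  refine ⟨(grushinConst N k * (2 ^ ((N : ℝ) / 2) *
    ∫ ξ : EuclideanSpace ℝ (Fin k), Real.exp (-(N / 4 * ‖ξ‖)))).toNNReal, fun x w y t ht => ?_⟩
  have hc := grushinConst_pos N k
  have h1 : grushinKernel x w y t ≤ ‖grushinKernelComplex x w y t‖ :=
    (le_abs_self _).trans (Complex.abs_re_le_norm _)
  refine h1.trans ?_
  rw [grushinKernelComplex_eq hk x w y ht, norm_mul, Complex.norm_real, Real.norm_eq_abs,
    abs_of_pos (grushinConst_pos N k)]
  have h2 : ‖∫ ξ : EuclideanSpace ℝ (Fin k), (mehler x w t ‖ξ‖ : ℂ) *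
        Complex.exp ((inner ℝ ξ y : ℝ) * Complex.I)‖ ≤
      ∫ ξ : EuclideanSpace ℝ (Fin k), (2 / t) ^ ((N : ℝ) / 2) * Real.exp (-(N * t / 4 * ‖ξ‖)) := by
    refine norm_integral_le_of_norm_le ((integrable_exp_neg_norm (c := N * t / 4) volume
      (by positivity)).const_mul _) (Eventually.of_forall fun ξ => ?_)
    rw [norm_mul, Complex.norm_exp_ofReal_mul_I, mul_one, Complex.norm_real, Real.norm_eq_abs,
      abs_of_pos (mehler_pos x w ht _)]
    exact mehler_le x w ht _
  have h3 : ∫ ξ : EuclideanSpace ℝ (Fin k), Real.exp (-(N * t / 4 * ‖ξ‖)) =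
      (t ^ k)⁻¹ * ∫ ξ : EuclideanSpace ℝ (Fin k), Real.exp (-(N / 4 * ‖ξ‖)) := by
    have := Measure.integral_comp_smul_of_nonneg (volume : Measure (EuclideanSpace ℝ (Fin k)))
      (fun ξ => Real.exp (-(N / 4 * ‖ξ‖))) t (hR := ht.le)
    rw [finrank_euclideanSpace_fin, smul_eq_mul] at this
    rw [← this]
    congr 1; ext ξ
    rw [norm_smul, Real.norm_eq_abs, abs_of_pos ht]
    ring_nf
  rw [integral_const_mul, h3] at h2
  refine (mul_le_mul_of_nonneg_left h2 (grushinConst_pos N k).le).trans (le_of_eq ?_)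
  rw [Real.coe_toNNReal _ (by positivity), Real.div_rpow zero_le_two ht.le, Real.rpow_neg ht.le, add_div,
    Real.rpow_add ht, mul_div_cancel_left₀ _ (two_ne_zero), Real.rpow_natCast]
  field_simp

/-- Positivity of the transform takes the place of decay estimates in y; integrability of K in y and
Fourier inversion both rest on this. -/
theorem integrable_fourierInv_mehler (hN : 1 ≤ N) (x w : EuclideanSpace ℝ (Fin N)) {t : ℝ}
    (ht : 0 < t) :
    Integrable (𝓕 (fun ξ : EuclideanSpace ℝ (Fin k) => (mehler x w t ‖ξ‖ : ℂ))) :=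
  integrable_fourier_of_nonneg
    (Complex.continuous_ofReal.comp (continuous_mehler_norm x w ht))
    (integrable_mehler hN x w ht).ofReal
    ((posMult_mehler hN x w ht).fourier_nonneg (integrable_mehler hN x w ht))

theorem integrable_grushinKernel (hN : 1 ≤ N) (hk : 1 ≤ k) (x w : EuclideanSpace ℝ (Fin N))
    {t : ℝ} (ht : 0 < t) :
    Integrable (fun y : EuclideanSpace ℝ (Fin k) => grushinKernel x w y t) := by
  have h1 := (integrable_fourierInv_mehler (k := k) hN x w ht).comp_neg
  have h2 := h1.comp_smul (R := (2 * Real.pi)⁻¹) (by positivity)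
  have h3 := (h2.const_mul (grushinConst N k : ℂ)).re
  refine h3.congr (Eventually.of_forall fun y => ?_)
  simp only [grushinKernel]
  rw [grushinKernelComplex_eq_fourierInv hk x w y ht, Real.fourierInv_eq_fourier_neg]
  rfl

/-- The partial Fourier transform of the Grushin kernel is the Mehler kernel. -/
theorem integral_grushinKernel_mul_exp (hN : 1 ≤ N) (hk : 1 ≤ k) (x w : EuclideanSpace ℝ (Fin N))
    {t : ℝ} (ht : 0 < t) (ξ : EuclideanSpace ℝ (Fin k)) :
    ∫ y : EuclideanSpace ℝ (Fin k), (grushinKernel x w y t : ℂ) *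
      Complex.exp ((-inner ℝ ξ y : ℝ) * Complex.I) =
      (((2 * Real.pi) ^ ((N : ℝ) / 2))⁻¹ * mehler x w t ‖ξ‖ : ℝ) := by
  have hinv := (Complex.continuous_ofReal.comp (continuous_mehler_norm x w ht)).fourier_fourierInv_eq
    (integrable_mehler (k := k) hN x w ht).ofReal (integrable_fourierInv_mehler hN x w ht)
  have h := congrFun hinv ξ
  rw [Real.fourier_eq'] at h
  -- The substitution y ↦ y/(2π) passes from the 2π-normalised transform to the character
  -- exp(-iξ·y). Its Jacobian (2π)^k times `grushinConst` is (2π)^(-N/2).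
  have hsc := Measure.integral_comp_smul_of_nonneg (volume : Measure (EuclideanSpace ℝ (Fin k)))
    (fun v => Complex.exp ((-2 * Real.pi * inner ℝ v ξ : ℝ) * Complex.I) •
      𝓕⁻ (fun ξ : EuclideanSpace ℝ (Fin k) => (mehler x w t ‖ξ‖ : ℂ)) v) (2 * Real.pi)⁻¹
      (hR := by positivity)
  simp only [Function.comp_def] at h
  rw [h, finrank_euclideanSpace_fin] at hsc
  have e : ∀ y : EuclideanSpace ℝ (Fin k), (grushinKernel x w y t : ℂ) *
      Complex.exp ((-inner ℝ ξ y : ℝ) * Complex.I) = (grushinConst N k : ℂ) *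
      (Complex.exp ((-2 * Real.pi * inner ℝ ((2 * Real.pi)⁻¹ • y) ξ : ℝ) * Complex.I) •
      𝓕⁻ (fun ξ : EuclideanSpace ℝ (Fin k) => (mehler x w t ‖ξ‖ : ℂ)) ((2 * Real.pi)⁻¹ • y)) := by
    intro y
    have e1 : -2 * Real.pi * inner ℝ ((2 * Real.pi)⁻¹ • y) ξ = -inner ℝ ξ y := by
      rw [real_inner_smul_left, real_inner_comm]
      field_simp
    rw [ofReal_grushinKernel, grushinKernelComplex_eq_fourierInv hk x w y ht, e1, smul_eq_mul]
    ring
  simp_rw [e]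
  rw [integral_const_mul, hsc, Complex.real_smul, ← Complex.ofReal_mul, ← Complex.ofReal_mul]
  congr 1
  rw [← mul_assoc]
  congr 1
  have h4 := grushinConst_mul N k
  rw [inv_pow, inv_inv]
  exact eq_inv_of_mul_eq_one_left h4

end Kernel

end

/-! ### Continuity, unit mass and Chapman–Kolmogorov -/

noncomputable section

open scoped FourierTransform ComplexOrder

section Kernel

variable {N k : ℕ}

theorem continuousAt_grushinKernel (hN : 1 ≤ N) (hk : 1 ≤ k) (x w : EuclideanSpace ℝ (Fin N))
    (y : EuclideanSpace ℝ (Fin k)) {t : ℝ} (ht : 0 < t) :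
    ContinuousAt (fun q : EuclideanSpace ℝ (Fin N) × EuclideanSpace ℝ (Fin N) ×
      EuclideanSpace ℝ (Fin k) × ℝ => grushinKernel q.1 q.2.1 q.2.2.1 q.2.2.2) (x, w, y, t) := by
  have hN' : (0 : ℝ) < N := by exact_mod_cast hN
  -- Keeping times above t/2 gives one integrable majorant for all nearby parameters.
  have hev : ∀ᶠ q : EuclideanSpace ℝ (Fin N) × EuclideanSpace ℝ (Fin N) ×
      EuclideanSpace ℝ (Fin k) × ℝ in 𝓝 (x, w, y, t), t / 2 < q.2.2.2 := by
    have : ContinuousAt (fun q : EuclideanSpace ℝ (Fin N) × EuclideanSpace ℝ (Fin N) ×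
      EuclideanSpace ℝ (Fin k) × ℝ => q.2.2.2) (x, w, y, t) := by fun_prop
    exact this.eventually (lt_mem_nhds (by simpa using half_lt_self ht))
  have hmain : ContinuousAt (fun q : EuclideanSpace ℝ (Fin N) × EuclideanSpace ℝ (Fin N) ×
      EuclideanSpace ℝ (Fin k) × ℝ => ∫ ξ : EuclideanSpace ℝ (Fin k),
        (mehler q.1 q.2.1 q.2.2.2 ‖ξ‖ : ℂ) *
        Complex.exp ((inner ℝ ξ q.2.2.1 : ℝ) * Complex.I)) (x, w, y, t) := by
    refine continuousAt_of_dominated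
      (bound := fun ξ => (2 / (t / 2)) ^ ((N : ℝ) / 2) * Real.exp (-(N * (t / 2) / 4 * ‖ξ‖)))
      ?_ ?_ ((integrable_exp_neg_norm volume (by positivity)).const_mul _) ?_
    · filter_upwards [hev] with q hq
      have hq0 : 0 < q.2.2.2 := (half_pos ht).trans hq
      exact ((Complex.continuous_ofReal.comp (continuous_mehler_norm q.1 q.2.1 hq0)).mul
        (by fun_prop)).aestronglyMeasurable
    · filter_upwards [hev] with q hq
      have hq0 : 0 < q.2.2.2 := (half_pos ht).trans hq
      refine Eventually.of_forall fun ξ => ?_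
      rw [norm_mul, Complex.norm_exp_ofReal_mul_I, mul_one, Complex.norm_real, Real.norm_eq_abs,
        abs_of_pos (mehler_pos _ _ hq0 _)]
      refine (mehler_le _ _ hq0 _).trans ?_
      gcongr
    · refine Eventually.of_forall fun ξ => ContinuousAt.mul ?_ (by fun_prop)
      exact Complex.continuous_ofReal.continuousAt.comp
        ((continuousAt_mehler x w ht ‖ξ‖).comp (f := fun q : EuclideanSpace ℝ (Fin N) ×
        EuclideanSpace ℝ (Fin N) × EuclideanSpace ℝ (Fin k) × ℝ =>
        (q.1, q.2.1, q.2.2.2, ‖ξ‖)) (x := (x, w, y, t)) (by fun_prop))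
  have hc : ContinuousAt (fun q : EuclideanSpace ℝ (Fin N) × EuclideanSpace ℝ (Fin N) ×
      EuclideanSpace ℝ (Fin k) × ℝ => grushinKernelComplex q.1 q.2.1 q.2.2.1 q.2.2.2)
      (x, w, y, t) := by
    refine (hmain.const_mul (grushinConst N k : ℂ)).congr ?_
    filter_upwards [hev] with q hq
    exact (grushinKernelComplex_eq hk _ _ _ ((half_pos ht).trans hq)).symm
  exact Complex.continuous_re.continuousAt.comp hc

theorem continuous_grushinKernel (hN : 1 ≤ N) (hk : 1 ≤ k) {t : ℝ} (ht : 0 < t) :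
    Continuous (fun q : EuclideanSpace ℝ (Fin N) × EuclideanSpace ℝ (Fin N) ×
      EuclideanSpace ℝ (Fin k) => grushinKernel q.1 q.2.1 q.2.2 t) := by
  rw [continuous_iff_continuousAt]
  intro q
  exact (continuousAt_grushinKernel hN hk q.1 q.2.1 q.2.2 ht).comp
    (f := fun q : EuclideanSpace ℝ (Fin N) × EuclideanSpace ℝ (Fin N) ×
      EuclideanSpace ℝ (Fin k) => (q.1, q.2.1, q.2.2, t)) (x := q) (by fun_prop)

/-- The integral kernel of `S(t)` on `ℝ^{N+k}`. -/
def gker (t : ℝ) (u v : GrushinSpace N k) : ℝ := grushinKernel u.1 v.1 (u.2 - v.2) t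

theorem continuous_gker (hN : 1 ≤ N) (hk : 1 ≤ k) {t : ℝ} (ht : 0 < t) :
    Continuous (fun q : GrushinSpace N k × GrushinSpace N k => gker t q.1 q.2) := by
  unfold gker
  exact (continuous_grushinKernel hN hk ht).comp (f := fun q : GrushinSpace N k × GrushinSpace N k =>
    (q.1.1, q.2.1, q.1.2 - q.2.2)) (by fun_prop)

theorem gker_comm (t : ℝ) (u v : GrushinSpace N k) : gker t u v = gker t v u := by
  unfold gker
  rw [grushinKernel_comm, ← grushinKernel_neg, neg_sub]

theorem gker_nonneg (hN : 1 ≤ N) (hk : 1 ≤ k) {t : ℝ} (ht : 0 < t) (u v : GrushinSpace N k) :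
    0 ≤ gker t u v := grushinKernel_nonneg hN hk _ _ _ ht

theorem integral_grushinKernel (hN : 1 ≤ N) (hk : 1 ≤ k) (x w : EuclideanSpace ℝ (Fin N))
    {t : ℝ} (ht : 0 < t) :
    ∫ y : EuclideanSpace ℝ (Fin k), grushinKernel x w y t =
      ((2 * Real.pi) ^ ((N : ℝ) / 2))⁻¹ * mehler x w t 0 := by
  have h := integral_grushinKernel_mul_exp hN hk x w ht (0 : EuclideanSpace ℝ (Fin k))
  simp only [inner_zero_left, neg_zero, Complex.ofReal_zero, zero_mul, Complex.exp_zero, mul_one,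
    norm_zero] at h
  rw [integral_complex_ofReal] at h
  exact_mod_cast h

theorem integrable_of_integral_pos {X : Type*} [MeasurableSpace X] {μ : Measure X} {f : X → ℝ}
    (h : 0 < ∫ x, f x ∂μ) : Integrable f μ := by
  by_contra hf
  rw [integral_undef hf] at h
  exact h.false

/-- Integrating out z evaluates the partial Fourier transform at 0, leaving the normalised Gaussian
heat kernel in w. -/
theorem lintegral_gker (hN : 1 ≤ N) (hk : 1 ≤ k) {t : ℝ} (ht : 0 < t) (u : GrushinSpace N k) :
    ∫⁻ v : GrushinSpace N k, ENNReal.ofReal (gker t u v) = 1 := by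
  have hm : Measurable (fun v : GrushinSpace N k => ENNReal.ofReal (gker t u v)) :=
    ENNReal.measurable_ofReal.comp ((continuous_gker hN hk ht).comp
      (f := fun v => (u, v)) (by fun_prop)).measurable
  rw [Measure.volume_eq_prod, lintegral_prod _ hm.aemeasurable]
  have inner_eq : ∀ w : EuclideanSpace ℝ (Fin N),
      ∫⁻ z : EuclideanSpace ℝ (Fin k), ENNReal.ofReal (gker t u (w, z)) =
      ENNReal.ofReal (((2 * Real.pi) ^ ((N : ℝ) / 2))⁻¹ * mehler u.1 w t 0) := by
    intro w
    rw [← integral_grushinKernel hN hk u.1 w ht]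
    simp only [gker]
    rw [lintegral_sub_left_eq_self (fun z => ENNReal.ofReal (grushinKernel u.1 w z t)) u.2,
      ofReal_integral_eq_lintegral_ofReal (integrable_grushinKernel hN hk u.1 w ht)
        (Eventually.of_forall fun z => grushinKernel_nonneg hN hk _ _ _ ht)]
  simp_rw [inner_eq]
  have h := integral_mehler_zero u.1 ht
  have hi : Integrable (fun w => mehler u.1 w t 0) :=
    integrable_of_integral_pos (by rw [h]; positivity)
  rw [← ofReal_integral_eq_lintegral_ofReal (hi.const_mul _)
    (Eventually.of_forall fun w => ?_), integral_const_mul, h, inv_mul_cancel₀ (by positivity),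
    ENNReal.ofReal_one]
  have := mehler_pos u.1 w ht 0
  show 0 ≤ _
  positivity

/-- Convolution in the second variable multiplies the Mehler kernels. -/
theorem integral_grushinKernel_mul (hN : 1 ≤ N) (hk : 1 ≤ k) (x v w : EuclideanSpace ℝ (Fin N))
    (a b : EuclideanSpace ℝ (Fin k)) {s t : ℝ} (hs : 0 < s) (ht : 0 < t) :
    ((∫ z, grushinKernel x v (a - z) s * grushinKernel v w (z - b) t : ℝ) : ℂ) =
      ((grushinConst N k * ((2 * Real.pi) ^ ((N : ℝ) / 2))⁻¹ : ℝ) : ℂ) *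
      ∫ ξ : EuclideanSpace ℝ (Fin k), ((mehler x v s ‖ξ‖ * mehler v w t ‖ξ‖ : ℝ) : ℂ) *
        Complex.exp ((inner ℝ ξ (a - b) : ℝ) * Complex.I) := by
  rw [← integral_complex_ofReal]
  -- Only the first kernel is expanded as a Fourier integral. Fubini applies because the second is
  -- integrable in z and the Mehler factor in ξ; the z-integral is then a partial Fourier transform.
  have e1 : ∀ z, ((grushinKernel x v (a - z) s * grushinKernel v w (z - b) t : ℝ) : ℂ) =
      (grushinConst N k : ℂ) * ∫ ξ : EuclideanSpace ℝ (Fin k), (mehler x v s ‖ξ‖ : ℂ) *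
        Complex.exp ((inner ℝ ξ (a - z) : ℝ) * Complex.I) * grushinKernel v w (z - b) t := by
    intro z
    rw [integral_mul_const, ← mul_assoc, ← grushinKernelComplex_eq hk x v _ hs,
      ← ofReal_grushinKernel, Complex.ofReal_mul]
  simp_rw [e1]
  rw [integral_const_mul, Complex.ofReal_mul, mul_assoc]
  congr 1
  have hint : Integrable (fun q : EuclideanSpace ℝ (Fin k) × EuclideanSpace ℝ (Fin k) =>
      (mehler x v s ‖q.2‖ : ℂ) * Complex.exp ((inner ℝ q.2 (a - q.1) : ℝ) * Complex.I) *
        grushinKernel v w (q.1 - b) t) (volume.prod volume) := by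
    have h1 := (((integrable_grushinKernel hN hk v w ht).comp_sub_right b).ofReal (𝕜 := ℂ)).mul_prod
      ((integrable_mehler (k := k) hN x v hs).ofReal (𝕜 := ℂ))
    refine (h1.bdd_mul (c := 1) (f := fun q : EuclideanSpace ℝ (Fin k) × EuclideanSpace ℝ (Fin k) =>
      Complex.exp ((inner ℝ q.2 (a - q.1) : ℝ) * Complex.I))
      (Continuous.aestronglyMeasurable (by fun_prop)) (Eventually.of_forall fun q =>
        (Complex.norm_exp_ofReal_mul_I _).le)).congr (Eventually.of_forall fun q => ?_)
    simp only [RCLike.ofReal_eq_complex_ofReal]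
    ring
  rw [integral_integral_swap hint, ← integral_const_mul]
  congr 1; ext ξ
  have h2 := integral_grushinKernel_mul_exp hN hk v w ht ξ
  rw [← integral_sub_right_eq_self _ b] at h2
  have e3 : ∀ z, (mehler x v s ‖ξ‖ : ℂ) * Complex.exp ((inner ℝ ξ (a - z) : ℝ) * Complex.I) *
      grushinKernel v w (z - b) t = (mehler x v s ‖ξ‖ : ℂ) *
        Complex.exp ((inner ℝ ξ (a - b) : ℝ) * Complex.I) * ((grushinKernel v w (z - b) t : ℂ) *
        Complex.exp ((-inner ℝ ξ (z - b) : ℝ) * Complex.I)) := by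
    intro z
    have e4 : inner ℝ ξ (a - z) = inner ℝ ξ (a - b) + -inner ℝ ξ (z - b) := by
      simp only [inner_sub_right]; ring
    rw [e4, Complex.ofReal_add, add_mul, Complex.exp_add]
    ring
  simp_rw [e3]
  rw [integral_const_mul, h2]
  push_cast
  ring

theorem continuous_mehler_space {s : ℝ} (hs : 0 < s) :
    Continuous (fun q : EuclideanSpace ℝ (Fin N) × EuclideanSpace ℝ (Fin N) × ℝ =>
      mehler q.1 q.2.1 s q.2.2) := by
  rw [continuous_iff_continuousAt]
  intro q
  exact (continuousAt_mehler q.1 q.2.1 hs q.2.2).comp (f := fun q : EuclideanSpace ℝ (Fin N) ×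
    EuclideanSpace ℝ (Fin N) × ℝ => (q.1, q.2.1, s, q.2.2)) (x := q) (by fun_prop)

theorem integrable_grushinKernel_mul (hN : 1 ≤ N) (hk : 1 ≤ k) (x v w : EuclideanSpace ℝ (Fin N))
    (a b : EuclideanSpace ℝ (Fin k)) {s t : ℝ} (hs : 0 < s) (ht : 0 < t) :
    Integrable (fun z => grushinKernel x v (a - z) s * grushinKernel v w (z - b) t) := by
  obtain ⟨A, hA⟩ := grushinKernel_le hN hk
  refine ((integrable_grushinKernel hN hk v w ht).comp_sub_right b).bdd_mul
    (c := A * s ^ (-(((N : ℝ) + 2 * k) / 2))) ?_ (Eventually.of_forall fun z => ?_)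
  · exact ((continuous_grushinKernel hN hk hs).comp
      (f := fun z => (x, v, a - z)) (by fun_prop)).aestronglyMeasurable
  · rw [Real.norm_eq_abs, abs_of_nonneg (grushinKernel_nonneg hN hk _ _ _ hs)]
    exact hA _ _ _ _ hs

/-- The Chapman–Kolmogorov identity. -/
theorem lintegral_gker_mul_gker (hN : 1 ≤ N) (hk : 1 ≤ k) {s t : ℝ} (hs : 0 < s) (ht : 0 < t)
    (u u' : GrushinSpace N k) :
    ∫⁻ v : GrushinSpace N k, ENNReal.ofReal (gker s u v) * ENNReal.ofReal (gker t v u') =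
      ENNReal.ofReal (gker (s + t) u u') := by
  have hst : 0 < s + t := by positivity
  have hm1 : Measurable (fun v : GrushinSpace N k => ENNReal.ofReal (gker s u v)) :=
    ENNReal.measurable_ofReal.comp ((continuous_gker hN hk hs).comp
      (f := fun v => (u, v)) (by fun_prop)).measurable
  have hm2 : Measurable (fun v : GrushinSpace N k => ENNReal.ofReal (gker t v u')) :=
    ENNReal.measurable_ofReal.comp ((continuous_gker hN hk ht).comp
      (f := fun v => (v, u')) (by fun_prop)).measurable
  rw [Measure.volume_eq_prod, lintegral_prod _ (hm1.fun_mul hm2).aemeasurable]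
  set J : EuclideanSpace ℝ (Fin N) → ℝ := fun v =>
    ∫ z, grushinKernel u.1 v (u.2 - z) s * grushinKernel v u'.1 (z - u'.2) t with hJ
  have hJ0 : ∀ v, 0 ≤ J v := fun v => integral_nonneg fun z =>
    mul_nonneg (grushinKernel_nonneg hN hk _ _ _ hs) (grushinKernel_nonneg hN hk _ _ _ ht)
  have inner_eq : ∀ v : EuclideanSpace ℝ (Fin N), ∫⁻ z : EuclideanSpace ℝ (Fin k),
      ENNReal.ofReal (gker s u (v, z)) * ENNReal.ofReal (gker t (v, z) u') =
      ENNReal.ofReal (J v) := by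
    intro v
    rw [hJ, ofReal_integral_eq_lintegral_ofReal
      (integrable_grushinKernel_mul hN hk u.1 v u'.1 u.2 u'.2 hs ht)
      (Eventually.of_forall fun z => mul_nonneg (grushinKernel_nonneg hN hk _ _ _ hs)
        (grushinKernel_nonneg hN hk _ _ _ ht))]
    refine lintegral_congr fun z => ?_
    rw [← ENNReal.ofReal_mul (gker_nonneg hN hk hs _ _)]
    rfl
  simp_rw [inner_eq]
  set G : EuclideanSpace ℝ (Fin N) × EuclideanSpace ℝ (Fin k) → ℝ := fun q =>
    mehler u.1 q.1 s ‖q.2‖ * mehler q.1 u'.1 t ‖q.2‖ with hG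
  have hGc : Continuous G :=
    ((continuous_mehler_space hs).comp (f := fun q : EuclideanSpace ℝ (Fin N) × EuclideanSpace ℝ (Fin k)
      => (u.1, q.1, ‖q.2‖)) (by fun_prop)).mul
    ((continuous_mehler_space ht).comp (f := fun q : EuclideanSpace ℝ (Fin N) × EuclideanSpace ℝ (Fin k)
      => (q.1, u'.1, ‖q.2‖)) (by fun_prop))
  have hG0 : ∀ q, 0 < G q := fun q => mul_pos (mehler_pos _ _ hs _) (mehler_pos _ _ ht _)
  have : Nonempty (Fin k) := ⟨⟨0, hk⟩⟩
  have hne : ∀ᵐ ξ : EuclideanSpace ℝ (Fin k), 0 < ‖ξ‖ := by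
    filter_upwards [compl_mem_ae_iff.2 (measure_singleton (0 : EuclideanSpace ℝ (Fin k)))] with ξ hξ
    exact norm_pos_iff.2 hξ
  have hcomp : ∀ᵐ ξ : EuclideanSpace ℝ (Fin k), ∫ v, G (v, ξ) =
      (2 * Real.pi) ^ ((N : ℝ) / 2) * mehler u.1 u'.1 (s + t) ‖ξ‖ := by
    filter_upwards [hne] with ξ hξ
    exact mehler_comp u.1 u'.1 hs ht hξ
  -- As G is positive, the composition formula itself gives absolute integrability, which justifies
  -- exchanging the integrals in v and ξ.
  have hGi : Integrable G (volume.prod volume) := by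
    rw [integrable_prod_iff' hGc.aestronglyMeasurable]
    constructor
    · filter_upwards [hcomp] with ξ hξ
      refine integrable_of_integral_pos ?_
      rw [hξ]
      have := mehler_pos u.1 u'.1 hst ‖ξ‖
      positivity
    · refine ((integrable_mehler hN u.1 u'.1 hst).const_mul ((2 * Real.pi) ^ ((N : ℝ) / 2))).congr ?_
      filter_upwards [hcomp] with ξ hξ
      rw [← hξ]
      simp_rw [Real.norm_eq_abs, abs_of_pos (hG0 _)]
  have hGe : Integrable (fun q : EuclideanSpace ℝ (Fin N) × EuclideanSpace ℝ (Fin k) =>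
      (G q : ℂ) * Complex.exp ((inner ℝ q.2 (u.2 - u'.2) : ℝ) * Complex.I))
      (volume.prod volume) :=
    (hGi.ofReal (𝕜 := ℂ)).mul_bdd (c := 1) (Continuous.aestronglyMeasurable (by fun_prop))
      (Eventually.of_forall fun q => (Complex.norm_exp_ofReal_mul_I _).le)
  have hJc : ∀ v, (J v : ℂ) = ((grushinConst N k * ((2 * Real.pi) ^ ((N : ℝ) / 2))⁻¹ : ℝ) : ℂ) *
      ∫ ξ : EuclideanSpace ℝ (Fin k), (G (v, ξ) : ℂ) *
        Complex.exp ((inner ℝ ξ (u.2 - u'.2) : ℝ) * Complex.I) := fun v =>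
    integral_grushinKernel_mul hN hk u.1 v u'.1 u.2 u'.2 hs ht
  have hJi : Integrable J := by
    have h1 := (hGe.integral_prod_left.const_mul
      ((grushinConst N k * ((2 * Real.pi) ^ ((N : ℝ) / 2))⁻¹ : ℝ) : ℂ)).re
    refine h1.congr (Eventually.of_forall fun v => ?_)
    show RCLike.re (_ : ℂ) = J v
    rw [← hJc v]
    simp
  rw [← ofReal_integral_eq_lintegral_ofReal hJi (Eventually.of_forall hJ0)]
  congr 1
  apply Complex.ofReal_injective
  rw [← integral_complex_ofReal]
  simp_rw [hJc]
  rw [integral_const_mul, integral_integral_swap hGe, gker, ofReal_grushinKernel,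
    grushinKernelComplex_eq hk _ _ _ hst, Complex.ofReal_mul, mul_assoc]
  congr 1
  rw [← integral_const_mul]
  refine integral_congr_ae ?_
  filter_upwards [hcomp] with ξ hξ
  rw [integral_mul_const, integral_complex_ofReal, hξ]
  push_cast
  rw [← mul_assoc, ← mul_assoc, inv_mul_cancel₀, one_mul]
  have : (0 : ℝ) < (2 * Real.pi) ^ ((N : ℝ) / 2) := by positivity
  exact_mod_cast this.ne'

end Kernel

end

/-! ### Integral operators: Schur's test and interpolation -/

noncomputable section

section IntegralOperator

variable {X E : Type*} [MeasurableSpace X] {μ : Measure X} [NormedAddCommGroup E]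
  {K : X → X → ℝ} {φ : X → E} {p : ℝ≥0∞}

theorem lintegral_enorm_mul_eq (hK : Measurable (Function.uncurry K))
    (hφ : AEStronglyMeasurable φ μ) (u : X) :
    ∫⁻ v, ‖K u v‖ₑ * ‖φ v‖ₑ ∂μ = eLpNorm φ 1 (μ.withDensity fun v => ‖K u v‖ₑ) := by
  have hm : Measurable fun v => ‖K u v‖ₑ := (hK.comp measurable_prodMk_left).enorm
  rw [eLpNorm_one_eq_lintegral_enorm,
    lintegral_withDensity_eq_lintegral_mul₀ hm.aemeasurable hφ.enorm]
  rfl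

/-- Hölder's inequality read as the comparison of the L¹ and L^p norms for the finite measure
|K(u,·)|μ. -/
theorem lintegral_enorm_mul_le (hK : Measurable (Function.uncurry K)) {δ : ℝ≥0∞} (hp : 1 ≤ p)
    (hδ : ∀ u, ∫⁻ v, ‖K u v‖ₑ ∂μ ≤ δ) (hφ : AEStronglyMeasurable φ μ) (u : X) :
    ∫⁻ v, ‖K u v‖ₑ * ‖φ v‖ₑ ∂μ ≤
      eLpNorm φ p (μ.withDensity fun v => ‖K u v‖ₑ) * δ ^ (1 - 1 / p.toReal) := by
  rw [lintegral_enorm_mul_eq hK hφ]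
  have hφ' : AEStronglyMeasurable φ (μ.withDensity fun v => ‖K u v‖ₑ) :=
    hφ.mono_ac (withDensity_absolutelyContinuous _ _)
  refine (eLpNorm_le_eLpNorm_mul_rpow_measure_univ hp hφ').trans ?_
  rw [ENNReal.toReal_one, div_one]
  gcongr
  · rw [sub_nonneg]
    rcases eq_or_ne p ∞ with rfl | hpt
    · simp
    · have : 1 ≤ p.toReal := by simpa using ENNReal.toReal_mono hpt hp
      rw [div_le_one (by linarith)]
      exact this
  · rw [withDensity_apply _ MeasurableSet.univ, Measure.restrict_univ]
    exact hδ u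

theorem eLpNorm_withDensity_le_of_bound {A : ℝ≥0∞} (u : X)
    (hA : ∀ v, ‖K u v‖ₑ ≤ A) (hA0 : A ≠ 0) :
    eLpNorm φ p (μ.withDensity fun v => ‖K u v‖ₑ) ≤ A ^ (1 / p).toReal * eLpNorm φ p μ := by
  have h1 : μ.withDensity (fun v => ‖K u v‖ₑ) ≤ A • μ := by
    rw [← withDensity_const]
    exact withDensity_mono (Eventually.of_forall hA)
  refine (eLpNorm_mono_measure _ h1).trans ?_
  rw [eLpNorm_smul_measure_of_ne_zero hA0, smul_eq_mul]

/-- Interpolation between `L^p` and `L^∞`. -/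
theorem eLpNorm_le_interpolate_top {r : ℝ≥0∞} (hp : 1 ≤ p) (hpr : p ≤ r) {f : X → E}
    (htop : eLpNorm f ∞ μ ≠ ∞) :
    eLpNorm f r μ ≤ eLpNorm f p μ ^ (p.toReal / r.toReal) *
      eLpNorm f ∞ μ ^ (1 - p.toReal / r.toReal) := by
  -- Here `toReal` of r is 0 and division by it gives 0, so the claim reduces to equality of sup
  -- norms.
  rcases eq_or_ne r ∞ with rfl | hr
  · simp
  have hpt : p ≠ ∞ := (hpr.trans_lt hr.lt_top).ne
  have hp0 : p ≠ 0 := (one_pos.trans_le hp).ne'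
  have hr0 : r ≠ 0 := (one_pos.trans_le (hp.trans hpr)).ne'
  have hpp : 0 < p.toReal := ENNReal.toReal_pos hp0 hpt
  have hrr : 0 < r.toReal := ENNReal.toReal_pos hr0 hr
  have hpr' : p.toReal ≤ r.toReal := ENNReal.toReal_mono hr hpr
  have hfr : 0 ≤ 1 - p.toReal / r.toReal := by rw [sub_nonneg, div_le_one hrr]; exact hpr'
  rw [← ENNReal.rpow_le_rpow_iff hrr, ENNReal.mul_rpow_of_nonneg _ _ hrr.le,
    eLpNorm_eq_lintegral_rpow_enorm_toReal hr0 hr, eLpNorm_eq_lintegral_rpow_enorm_toReal hp0 hpt,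
    ← ENNReal.rpow_mul, ← ENNReal.rpow_mul, ← ENNReal.rpow_mul, ← ENNReal.rpow_mul,
    one_div_mul_cancel hrr.ne', ENNReal.rpow_one]
  have e1 : 1 / p.toReal * (p.toReal / r.toReal * r.toReal) = 1 := by field_simp
  have e2 : (1 - p.toReal / r.toReal) * r.toReal = r.toReal - p.toReal := by field_simp
  rw [e1, e2, ENNReal.rpow_one]
  rw [← lintegral_mul_const' _ _ (ENNReal.rpow_ne_top_of_nonneg (by linarith) htop)]
  refine lintegral_mono_ae ?_
  filter_upwards [ae_le_eLpNormEssSup (f := f) (μ := μ)] with x hx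
  calc ‖f x‖ₑ ^ r.toReal = ‖f x‖ₑ ^ p.toReal * ‖f x‖ₑ ^ (r.toReal - p.toReal) := by
        rw [← ENNReal.rpow_add_of_nonneg _ _ hpp.le (by linarith)]; congr 1; ring
    _ ≤ _ := by
        rw [eLpNorm_exponent_top]
        gcongr

/-- Pointwise bound for an integral operator with bounded kernel of mass at most one. -/
theorem lintegral_enorm_mul_le_of_bound (hK : Measurable (Function.uncurry K)) {A : ℝ≥0∞}
    (hp : 1 ≤ p) (hδ : ∀ u, ∫⁻ v, ‖K u v‖ₑ ∂μ ≤ 1) (hA : ∀ u v, ‖K u v‖ₑ ≤ A) (hA0 : A ≠ 0)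
    (hφ : AEStronglyMeasurable φ μ) (u : X) :
    ∫⁻ v, ‖K u v‖ₑ * ‖φ v‖ₑ ∂μ ≤ A ^ (1 / p).toReal * eLpNorm φ p μ := by
  refine (lintegral_enorm_mul_le hK hp hδ hφ u).trans ?_
  rw [ENNReal.one_rpow, mul_one]
  exact eLpNorm_withDensity_le_of_bound u (hA u) hA0

variable [NormedSpace ℝ E]

theorem enorm_integral_kernel_smul_le (u : X) :
    ‖∫ v, K u v • φ v ∂μ‖ₑ ≤ ∫⁻ v, ‖K u v‖ₑ * ‖φ v‖ₑ ∂μ := by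
  refine (enorm_integral_le_lintegral_enorm _).trans (le_of_eq ?_)
  simp_rw [enorm_smul]

theorem integrable_kernel_smul (hK : Measurable (Function.uncurry K)) {A : ℝ≥0∞}
    (hp : 1 ≤ p) (hδ : ∀ u, ∫⁻ v, ‖K u v‖ₑ ∂μ ≤ 1) (hA : ∀ u v, ‖K u v‖ₑ ≤ A) (hA0 : A ≠ 0)
    (hAt : A ≠ ∞) (hφ : MemLp φ p μ) (u : X) : Integrable (fun v => K u v • φ v) μ := by
  refine ⟨(hK.comp measurable_prodMk_left).aestronglyMeasurable.fun_smul hφ.1, ?_⟩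
  unfold HasFiniteIntegral
  simp_rw [enorm_smul]
  refine (lintegral_enorm_mul_le_of_bound hK hp hδ hA hA0 hφ.1 u).trans_lt ?_
  exact ENNReal.mul_lt_top (ENNReal.rpow_lt_top_of_nonneg ENNReal.toReal_nonneg hAt) hφ.2

variable [SFinite μ]

theorem aestronglyMeasurable_integral_kernel_smul (hK : Measurable (Function.uncurry K))
    (hφ : AEStronglyMeasurable φ μ) :
    AEStronglyMeasurable (fun u => ∫ v, K u v • φ v ∂μ) μ := by
  have h : AEStronglyMeasurable (fun q : X × X => K q.1 q.2 • φ q.2) (μ.prod μ) :=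
    hK.aestronglyMeasurable.fun_smul hφ.comp_snd
  exact h.integral_prod_right'

/-- Schur's test. -/
theorem eLpNorm_integral_kernel_smul_le (hK : Measurable (Function.uncurry K)) {δ : ℝ≥0∞}
    (hp : 1 ≤ p) (hδ : ∀ u, ∫⁻ v, ‖K u v‖ₑ ∂μ ≤ δ) (hδ' : ∀ v, ∫⁻ u, ‖K u v‖ₑ ∂μ ≤ δ)
    (hφ : AEStronglyMeasurable φ μ) :
    eLpNorm (fun u => ∫ v, K u v • φ v ∂μ) p μ ≤ δ * eLpNorm φ p μ := by
  have hmK : ∀ u, Measurable fun v => ‖K u v‖ₑ := fun u => (hK.comp measurable_prodMk_left).enorm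
  rcases eq_or_ne p ∞ with rfl | hpt
  · rw [eLpNorm_exponent_top]
    refine eLpNormEssSup_le_of_ae_enorm_bound (Eventually.of_forall fun u => ?_)
    refine (enorm_integral_kernel_smul_le u).trans
      ((lintegral_enorm_mul_le (p := ∞) hK hp hδ hφ u).trans ?_)
    rw [ENNReal.toReal_top, div_zero, sub_zero, ENNReal.rpow_one, mul_comm]
    rw [eLpNorm_exponent_top, eLpNorm_exponent_top]
    exact mul_le_mul_right
      (eLpNormEssSup_mono_measure φ (withDensity_absolutelyContinuous μ _)) δ
  · have hp0 : p ≠ 0 := (one_pos.trans_le hp).ne'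
    have hp1 : 1 ≤ p.toReal := by simpa using ENNReal.toReal_mono hpt hp
    have hpp : 0 < p.toReal := by linarith
    rw [← ENNReal.rpow_le_rpow_iff hpp, ENNReal.mul_rpow_of_nonneg _ _ hpp.le,
      eLpNorm_eq_lintegral_rpow_enorm_toReal hp0 hpt, eLpNorm_eq_lintegral_rpow_enorm_toReal hp0 hpt,
      ← ENNReal.rpow_mul, ← ENNReal.rpow_mul, one_div_mul_cancel hpp.ne', ENNReal.rpow_one,
      ENNReal.rpow_one]
    -- The p-th power of Hölder's inequality leaves δ^(p-1); the last factor δ comes from the mass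
    -- in the other variable, after Tonelli.
    have hpt1 : ∀ u, ‖∫ v, K u v • φ v ∂μ‖ₑ ^ p.toReal ≤
        δ ^ (p.toReal - 1) * ∫⁻ v, ‖K u v‖ₑ * ‖φ v‖ₑ ^ p.toReal ∂μ := by
      intro u
      have h1 := (enorm_integral_kernel_smul_le u).trans (lintegral_enorm_mul_le hK hp hδ hφ u)
      refine (ENNReal.rpow_le_rpow h1 hpp.le).trans (le_of_eq ?_)
      rw [ENNReal.mul_rpow_of_nonneg _ _ hpp.le, eLpNorm_eq_lintegral_rpow_enorm_toReal hp0 hpt,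
        ← ENNReal.rpow_mul, ← ENNReal.rpow_mul, one_div_mul_cancel hpp.ne', ENNReal.rpow_one,
        lintegral_withDensity_eq_lintegral_mul₀ (hmK u).aemeasurable (hφ.enorm.pow_const _),
        mul_comm]
      congr 2
      field_simp
    have hm2 : AEMeasurable (fun q : X × X => ‖K q.1 q.2‖ₑ * ‖φ q.2‖ₑ ^ p.toReal) (μ.prod μ) :=
      hK.enorm.aemeasurable.mul ((hφ.comp_snd).enorm.pow_const _)
    calc ∫⁻ u, ‖∫ v, K u v • φ v ∂μ‖ₑ ^ p.toReal ∂μ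
        ≤ ∫⁻ u, δ ^ (p.toReal - 1) * ∫⁻ v, ‖K u v‖ₑ * ‖φ v‖ₑ ^ p.toReal ∂μ ∂μ :=
          lintegral_mono hpt1
      _ = δ ^ (p.toReal - 1) * ∫⁻ u, ∫⁻ v, ‖K u v‖ₑ * ‖φ v‖ₑ ^ p.toReal ∂μ ∂μ :=
          lintegral_const_mul'' _ hm2.lintegral_prod_right'
      _ = δ ^ (p.toReal - 1) * ∫⁻ v, ∫⁻ u, ‖K u v‖ₑ * ‖φ v‖ₑ ^ p.toReal ∂μ ∂μ := by
          rw [lintegral_lintegral_swap hm2]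
      _ ≤ δ ^ (p.toReal - 1) * ∫⁻ v, δ * ‖φ v‖ₑ ^ p.toReal ∂μ := by
          gcongr with v
          rw [lintegral_mul_const _ (show Measurable fun u => ‖K u v‖ₑ from
            (hK.comp measurable_prodMk_right).enorm)]
          gcongr
          exact hδ' v
      _ = _ := by
          rw [lintegral_const_mul'' _ (hφ.enorm.pow_const _), ← mul_assoc]
          congr 1
          nth_rw 2 [← ENNReal.rpow_one δ]
          rw [← ENNReal.rpow_add_of_nonneg _ _ (by linarith) zero_le_one, sub_add_cancel]

end IntegralOperator

end

/-! ### Two convergence lemmas in L¹ -/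

noncomputable section

theorem enorm_sub_eq_add (a b : ℝ) :
    ‖a - b‖ₑ = ENNReal.ofReal (a - b) + ENNReal.ofReal (b - a) := by
  rw [Real.enorm_eq_ofReal_abs]
  rcases le_total a b with h | h
  · rw [abs_of_nonpos (by linarith), ENNReal.ofReal_of_nonpos (p := a - b) (by linarith), zero_add,
      neg_sub]
  · rw [abs_of_nonneg (by linarith), ENNReal.ofReal_of_nonpos (p := b - a) (by linarith), add_zero]

/-- **Scheffé's lemma**: pointwise convergence of nonnegative functions with the same finite
integral implies convergence in `L¹`. -/
theorem tendsto_lintegral_enorm_sub_of_tendsto {X ι : Type*} [MeasurableSpace X] {μ : Measure X}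
    {l : Filter ι} [l.IsCountablyGenerated] {f : ι → X → ℝ} {g : X → ℝ} {m : ℝ≥0∞} (hm : m ≠ ∞)
    (hf : ∀ᶠ i in l, AEMeasurable (f i) μ ∧ (∀ x, 0 ≤ f i x) ∧
      ∫⁻ x, ENNReal.ofReal (f i x) ∂μ = m)
    (hg : AEMeasurable g μ) (hg0 : ∀ x, 0 ≤ g x) (hgm : ∫⁻ x, ENNReal.ofReal (g x) ∂μ = m)
    (hlim : ∀ᵐ x ∂μ, Tendsto (fun i => f i x) l (𝓝 (g x))) :
    Tendsto (fun i => ∫⁻ x, ‖f i x - g x‖ₑ ∂μ) l (𝓝 0) := by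
  -- The positive part of g - f_i is dominated by g, so no majorant of f_i is needed.
  have h1 : Tendsto (fun i => ∫⁻ x, ENNReal.ofReal (g x - f i x) ∂μ) l (𝓝 (∫⁻ _, 0 ∂μ)) := by
    refine tendsto_lintegral_filter_of_dominated_convergence' (fun x => ENNReal.ofReal (g x))
      ?_ ?_ (by rw [hgm]; exact hm) ?_
    · filter_upwards [hf] with i hi
      exact (hg.sub hi.1).ennreal_ofReal
    · filter_upwards [hf] with i hi
      exact Eventually.of_forall fun x => ENNReal.ofReal_le_ofReal (by linarith [hi.2.1 x])
    · filter_upwards [hlim] with x hx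
      have := (ENNReal.continuous_ofReal.tendsto _).comp (hx.const_sub (g x))
      simpa [Function.comp_def] using this
  rw [lintegral_zero] at h1
  have h2 := h1.add h1
  rw [add_zero] at h2
  refine h2.congr' ?_
  filter_upwards [hf] with i hi
  have hm1 : AEMeasurable (fun x => ENNReal.ofReal (f i x)) μ := hi.1.ennreal_ofReal
  have hm2 : AEMeasurable (fun x => ENNReal.ofReal (g x)) μ := hg.ennreal_ofReal
  -- Equal finite masses force the positive and negative parts of the difference to have equal
  -- integrals.
  have e : ∫⁻ x, ENNReal.ofReal (f i x - g x) ∂μ = ∫⁻ x, ENNReal.ofReal (g x - f i x) ∂μ := by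
    have h3 : ∫⁻ x, ENNReal.ofReal (g x) + ENNReal.ofReal (f i x - g x) ∂μ =
        ∫⁻ x, ENNReal.ofReal (f i x) + ENNReal.ofReal (g x - f i x) ∂μ := by
      refine lintegral_congr fun x => ?_
      rcases le_total (f i x) (g x) with h | h
      · rw [ENNReal.ofReal_of_nonpos (p := f i x - g x) (by linarith), add_zero,
          ← ENNReal.ofReal_add (hi.2.1 x) (by linarith)]
        congr 1; ring
      · rw [ENNReal.ofReal_of_nonpos (p := g x - f i x) (by linarith), add_zero,
          ← ENNReal.ofReal_add (hg0 x) (by linarith)]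
        congr 1; ring
    rw [lintegral_add_left' hm2, lintegral_add_left' hm1, hgm, hi.2.2] at h3
    exact (ENNReal.add_right_inj hm).1 h3
  simp_rw [enorm_sub_eq_add]
  rw [lintegral_add_left' (hi.1.fun_sub hg).ennreal_ofReal, e]

/-- Domination by functions converging in `L¹`. -/
theorem tendsto_lintegral_of_le_add {X ι : Type*} [MeasurableSpace X] {μ : Measure X}
    {l : Filter ι} [l.IsCountablyGenerated] {f : ι → X → ℝ≥0∞} {a : ι → X → ℝ} {b : X → ℝ}
    (hf : ∀ᶠ i in l, AEMeasurable (f i) μ)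
    (hfa : ∀ᶠ i in l, ∀ x, f i x ≤ ENNReal.ofReal (a i x) + ENNReal.ofReal (b x))
    (hb : ∫⁻ x, ENNReal.ofReal (b x) ∂μ ≠ ∞) (hbm : AEMeasurable b μ)
    (hab : Tendsto (fun i => ∫⁻ x, ‖a i x - b x‖ₑ ∂μ) l (𝓝 0))
    (hlim : ∀ᵐ x ∂μ, Tendsto (fun i => f i x) l (𝓝 0)) :
    Tendsto (fun i => ∫⁻ x, f i x ∂μ) l (𝓝 0) := by
  have hbm' : AEMeasurable (fun x => ENNReal.ofReal (b x)) μ := hbm.ennreal_ofReal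
  -- The truncation of f_i at 2b is dominated, and the excess over 2b is at most |a_i - b|.
  have h1 : Tendsto (fun i => ∫⁻ x, min (f i x) (ENNReal.ofReal (b x) + ENNReal.ofReal (b x)) ∂μ) l
      (𝓝 (∫⁻ _, 0 ∂μ)) := by
    refine tendsto_lintegral_filter_of_dominated_convergence'
      (fun x => ENNReal.ofReal (b x) + ENNReal.ofReal (b x)) ?_ ?_ ?_ ?_
    · filter_upwards [hf] with i hi
      exact hi.min (hbm'.add hbm')
    · exact Eventually.of_forall fun i => Eventually.of_forall fun x => min_le_right _ _
    · rw [lintegral_add_left' hbm']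
      exact ENNReal.add_ne_top.2 ⟨hb, hb⟩
    · filter_upwards [hlim] with x hx
      exact tendsto_of_tendsto_of_tendsto_of_le_of_le tendsto_const_nhds hx (fun _ => zero_le)
        fun _ => min_le_left _ _
  rw [lintegral_zero] at h1
  have h2 := h1.add hab
  rw [add_zero] at h2
  refine tendsto_of_tendsto_of_tendsto_of_le_of_le' tendsto_const_nhds h2
    (Eventually.of_forall fun _ => zero_le) ?_
  filter_upwards [hf, hfa] with i hi hia
  rw [← lintegral_add_left' (hi.min (hbm'.fun_add hbm'))]
  refine lintegral_mono fun x => ?_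
  rcases le_total (f i x) (ENNReal.ofReal (b x) + ENNReal.ofReal (b x)) with h | h
  · simp only [min_eq_left h]; exact le_self_add
  · simp only [min_eq_right h]
    refine (hia x).trans ?_
    rw [add_comm (ENNReal.ofReal (a i x)), add_assoc]
    gcongr
    calc ENNReal.ofReal (a i x) ≤ ENNReal.ofReal (b x + ‖a i x - b x‖) :=
          ENNReal.ofReal_le_ofReal (by
            have := le_abs_self (a i x - b x); rw [Real.norm_eq_abs]; linarith)
      _ ≤ _ := ENNReal.ofReal_add_le.trans (by rw [ofReal_norm])

theorem lintegral_eq_affine {V : Type*} [NormedAddCommGroup V] [NormedSpace ℝ V]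
    [FiniteDimensional ℝ V] [MeasurableSpace V] [BorelSpace V] (μ : Measure V)
    [μ.IsAddHaarMeasure] {f : V → ℝ≥0∞} (hf : Measurable f) (x : V) {c : ℝ} (hc : c ≠ 0) :
    ∫⁻ v, f v ∂μ = ENNReal.ofReal (|c| ^ Module.finrank ℝ V) * ∫⁻ v, f (x + c • v) ∂μ := by
  have h1 : ∫⁻ v, f (x + c • v) ∂μ = ∫⁻ v, f (x + v) ∂(Measure.map (c • ·) μ) := by
    rw [lintegral_map (f := fun v => f (x + v)) (hf.comp (measurable_const_add x))
      (measurable_const_smul c)]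
  rw [h1, Measure.map_addHaar_smul μ hc, lintegral_smul_measure, lintegral_add_left_eq_self,
    smul_eq_mul, ← mul_assoc, ← ENNReal.ofReal_mul (by positivity), abs_inv, abs_pow,
    mul_inv_cancel₀ (by positivity), ENNReal.ofReal_one, one_mul]

/-! ### The Gaussian limit of the kernel far from the degenerate set x = 0 -/

section Kernel

variable {N k : ℕ}

theorem lintegral_grushinSpace_affine {f : GrushinSpace N k → ℝ≥0∞} (hf : Measurable f)
    (u : GrushinSpace N k) {a r : ℝ} (ha : 0 < a) (hr : 0 < r) :
    ∫⁻ v, f v = ENNReal.ofReal (a ^ N * r ^ k) *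
      ∫⁻ v : GrushinSpace N k, f (u.1 + a • v.1, u.2 - r • v.2) := by
  have hm : Measurable fun v : GrushinSpace N k => f (u.1 + a • v.1, u.2 - r • v.2) :=
    hf.comp (by fun_prop)
  rw [Measure.volume_eq_prod, lintegral_prod _ hf.aemeasurable, lintegral_prod _ hm.aemeasurable,
    lintegral_eq_affine _ hf.lintegral_prod_right' u.1 ha.ne', finrank_euclideanSpace_fin,
    abs_of_pos ha, ENNReal.ofReal_mul (by positivity), mul_assoc]
  congr 1
  rw [← lintegral_const_mul _ hm.lintegral_prod_right']
  refine lintegral_congr fun w => ?_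
  rw [lintegral_eq_affine (f := fun y => f (u.1 + a • w, y)) _
    (hf.comp measurable_prodMk_left) u.2 (neg_ne_zero.2 hr.ne'),
    finrank_euclideanSpace_fin, abs_neg, abs_of_pos hr]
  simp [sub_eq_add_neg]

/-- The Grushin kernel around `x`, with the second variable measured in units of `|x|`. -/
def rescaledKernel (x : EuclideanSpace ℝ (Fin N)) (t : ℝ) (v : GrushinSpace N k) : ℝ :=
  ‖x‖ ^ k * grushinKernel x (x + v.1) (‖x‖ • v.2) t

/-- The Gaussian limit of the rescaled kernels. -/
def gaussLimit (t : ℝ) (v : GrushinSpace N k) : ℝ :=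
  grushinConst N k * t⁻¹ ^ ((N : ℝ) / 2) * (2 * Real.pi / t) ^ ((k : ℝ) / 2) *
    (Real.exp (-((2 * t)⁻¹ * ‖v.1‖ ^ 2)) * Real.exp (-((2 * t)⁻¹ * ‖v.2‖ ^ 2)))

theorem continuous_gaussLimit (t : ℝ) : Continuous (gaussLimit (N := N) (k := k) t) := by
  unfold gaussLimit; fun_prop

theorem gaussLimit_nonneg {t : ℝ} (ht : 0 < t) (v : GrushinSpace N k) : 0 ≤ gaussLimit t v := by
  have := grushinConst_pos N k
  unfold gaussLimit; positivity

theorem lintegral_gaussLimit {t : ℝ} (ht : 0 < t) :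
    ∫⁻ v : GrushinSpace N k, ENNReal.ofReal (gaussLimit t v) = 1 := by
  have hg : ∀ n : ℕ, ∫ v : EuclideanSpace ℝ (Fin n), Real.exp (-((2 * t)⁻¹ * ‖v‖ ^ 2)) =
      (2 * Real.pi * t) ^ ((n : ℝ) / 2) := by
    intro n
    have h2 := GaussianFourier.integral_rexp_neg_mul_sq_norm (V := EuclideanSpace ℝ (Fin n))
      (b := (2 * t)⁻¹) (by positivity)
    simp only [neg_mul] at h2
    rw [h2, finrank_euclideanSpace_fin]
    congr 1
    field_simp
  have hi : ∀ n : ℕ, Integrable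
      (fun v : EuclideanSpace ℝ (Fin n) => Real.exp (-((2 * t)⁻¹ * ‖v‖ ^ 2))) := fun n =>
    integrable_of_integral_pos (by rw [hg]; positivity)
  have hint := ((hi N).mul_prod (hi k)).const_mul
    (grushinConst N k * t⁻¹ ^ ((N : ℝ) / 2) * (2 * Real.pi / t) ^ ((k : ℝ) / 2))
  have e : ∫ v : GrushinSpace N k, gaussLimit t v = 1 := by
    unfold gaussLimit
    rw [integral_const_mul, Measure.volume_eq_prod, integral_prod_mul
      (fun w : EuclideanSpace ℝ (Fin N) => Real.exp (-((2 * t)⁻¹ * ‖w‖ ^ 2)))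
      (fun w : EuclideanSpace ℝ (Fin k) => Real.exp (-((2 * t)⁻¹ * ‖w‖ ^ 2))), hg, hg,
      ← grushinConst_mul N k, Real.inv_rpow ht.le, Real.div_rpow (by positivity) ht.le,
      Real.mul_rpow (by positivity) ht.le, Real.mul_rpow (by positivity) ht.le]
    have e2 : (2 * Real.pi) ^ k = (2 * Real.pi) ^ ((k : ℝ) / 2) * (2 * Real.pi) ^ ((k : ℝ) / 2) := by
      rw [← Real.rpow_add (by positivity), add_halves, Real.rpow_natCast]
    rw [e2]
    field_simp
  have hint' : Integrable (gaussLimit (N := N) (k := k) t) := hint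
  rw [← ofReal_integral_eq_lintegral_ofReal hint'
    (Eventually.of_forall fun v => gaussLimit_nonneg ht v), e, ENNReal.ofReal_one]

theorem gaussLimit_eq_integral {t : ℝ} (ht : 0 < t) (v : GrushinSpace N k) :
    (gaussLimit t v : ℂ) = (grushinConst N k : ℂ) * ∫ η : EuclideanSpace ℝ (Fin k),
      ((t⁻¹ ^ ((N : ℝ) / 2) * Real.exp (-((2 * t)⁻¹ * (‖v.1‖ ^ 2 + t ^ 2 * ‖η‖ ^ 2))) : ℝ) : ℂ) *
        Complex.exp ((inner ℝ η v.2 : ℝ) * Complex.I) := by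
  have h := GaussianFourier.integral_cexp_neg_mul_sq_norm_add (V := EuclideanSpace ℝ (Fin k))
    (b := ((t / 2 : ℝ) : ℂ)) (by rw [Complex.ofReal_re]; positivity) Complex.I v.2
  have e : ∀ η : EuclideanSpace ℝ (Fin k),
      ((t⁻¹ ^ ((N : ℝ) / 2) * Real.exp (-((2 * t)⁻¹ * (‖v.1‖ ^ 2 + t ^ 2 * ‖η‖ ^ 2))) : ℝ) : ℂ) *
        Complex.exp ((inner ℝ η v.2 : ℝ) * Complex.I) =
      ((t⁻¹ ^ ((N : ℝ) / 2) * Real.exp (-((2 * t)⁻¹ * ‖v.1‖ ^ 2)) : ℝ) : ℂ) *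
        Complex.exp (-((t / 2 : ℝ) : ℂ) * (‖η‖ : ℂ) ^ 2 + Complex.I * (inner ℝ v.2 η : ℝ)) := by
    intro η
    have e1 : -((2 * t)⁻¹ * (‖v.1‖ ^ 2 + t ^ 2 * ‖η‖ ^ 2)) =
        -((2 * t)⁻¹ * ‖v.1‖ ^ 2) + -(t / 2) * ‖η‖ ^ 2 := by
      field_simp
      ring
    rw [e1, Real.exp_add, real_inner_comm, Complex.exp_add]
    push_cast
    ring_nf
  simp_rw [e]
  rw [integral_const_mul, h, finrank_euclideanSpace_fin, Complex.I_sq]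
  have e3 : ((Real.pi : ℂ) / ((t / 2 : ℝ) : ℂ)) ^ ((k : ℂ) / 2) =
      (((2 * Real.pi / t) ^ ((k : ℝ) / 2) : ℝ) : ℂ) := by
    rw [Complex.ofReal_cpow (by positivity)]
    push_cast
    congr 1
    have : (t : ℂ) ≠ 0 := by exact_mod_cast ht.ne'
    field_simp
  have e4 : Complex.exp (-1 * (‖v.2‖ : ℂ) ^ 2 / (4 * ((t / 2 : ℝ) : ℂ))) =
      ((Real.exp (-((2 * t)⁻¹ * ‖v.2‖ ^ 2)) : ℝ) : ℂ) := by
    push_cast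
    congr 1
    have : (t : ℂ) ≠ 0 := by exact_mod_cast ht.ne'
    field_simp
    ring
  rw [e3, e4, gaussLimit]
  push_cast
  ring

/-- The substitution ξ = η/|x| absorbs the factor |x|^k and makes the character independent of x, so
only the Mehler factor varies in the limit. -/
theorem rescaledKernel_eq_integral (hk : 1 ≤ k) {x : EuclideanSpace ℝ (Fin N)} (hx : x ≠ 0) {t : ℝ}
    (ht : 0 < t) (v : GrushinSpace N k) :
    (rescaledKernel x t v : ℂ) = (grushinConst N k : ℂ) * ∫ η : EuclideanSpace ℝ (Fin k),
      (mehler x (x + v.1) t (‖x‖⁻¹ * ‖η‖) : ℂ) *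
        Complex.exp ((inner ℝ η v.2 : ℝ) * Complex.I) := by
  have hx' : 0 < ‖x‖ := norm_pos_iff.2 hx
  have h := Measure.integral_comp_smul_of_nonneg (volume : Measure (EuclideanSpace ℝ (Fin k)))
    (fun ξ => (mehler x (x + v.1) t ‖ξ‖ : ℂ) *
      Complex.exp ((inner ℝ ξ (‖x‖ • v.2) : ℝ) * Complex.I)) ‖x‖⁻¹ (hR := by positivity)
  rw [finrank_euclideanSpace_fin, inv_pow, inv_inv] at h
  rw [rescaledKernel, Complex.ofReal_mul, ofReal_grushinKernel, grushinKernelComplex_eq hk _ _ _ ht,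
    mul_left_comm, ← Complex.real_smul (x := ‖x‖ ^ k), ← h]
  congr 2; ext η
  rw [norm_smul, norm_inv, norm_norm, real_inner_smul_left, real_inner_smul_right, ← mul_assoc,
    inv_mul_cancel₀ hx'.ne', one_mul]

theorem vtanh_eq_sq_mul (v : ℝ) :
    vtanh v = v ^ 2 * (shc (v / 2) / (2 * Real.cosh (v / 2))) := rfl

/-- The majorant for the limit |x| → ∞. For |x| ≥ 1, `sq_div_le_vtanh` gives |x|² `vtanh`(rt/|x|) ≥
(rt)²/(2+rt), which grows linearly in r independently of x. -/
theorem mehler_rescaled_le {x w : EuclideanSpace ℝ (Fin N)} (hx : 1 ≤ ‖x‖) {t t₀ : ℝ}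
    (h1 : t₀ / 2 < t) (h2 : t < 2 * t₀) {r : ℝ} (hr : 0 ≤ r) :
    mehler x w t (‖x‖⁻¹ * r) ≤
      (2 / t₀) ^ ((N : ℝ) / 2) * Real.exp (1 / (8 * t₀)) * Real.exp (-(1 / 8 * r)) := by
  have ht₀ : 0 < t₀ := by linarith
  have ht : 0 < t := by linarith
  have hx0 : 0 < ‖x‖ := one_pos.trans_le hx
  have hs := one_le_shc (‖x‖⁻¹ * r * t)
  have hs0 := shc_pos (‖x‖⁻¹ * r * t)
  have hE : (t₀ * r - 1) / (8 * t₀) ≤ (2 * t)⁻¹ * ((‖x‖ ^ 2 + ‖w‖ ^ 2) * vtanh (‖x‖⁻¹ * r * t)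
      + ‖x - w‖ ^ 2 * (shc (‖x‖⁻¹ * r * t))⁻¹) := by
    have hv := sq_div_le_vtanh (v := ‖x‖⁻¹ * r * t) (by positivity)
    have hv0 := vtanh_nonneg (‖x‖⁻¹ * r * t)
    have h3 : (r * t) ^ 2 / (2 + r * t) ≤ ‖x‖ ^ 2 * vtanh (‖x‖⁻¹ * r * t) := by
      refine le_trans ?_ (mul_le_mul_of_nonneg_left hv (by positivity))
      have h4 : ‖x‖⁻¹ * r * t ≤ r * t := by
        have : ‖x‖⁻¹ ≤ 1 := inv_le_one_of_one_le₀ hx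
        have hrt : 0 ≤ r * t := by positivity
        nlinarith
      rw [mul_div_assoc']
      have e : ‖x‖ ^ 2 * (‖x‖⁻¹ * r * t) ^ 2 = (r * t) ^ 2 := by field_simp
      rw [e]
      gcongr
    have h5 : (2 * t)⁻¹ * ((r * t) ^ 2 / (2 + r * t)) ≤
        (2 * t)⁻¹ * ((‖x‖ ^ 2 + ‖w‖ ^ 2) * vtanh (‖x‖⁻¹ * r * t)
        + ‖x - w‖ ^ 2 * (shc (‖x‖⁻¹ * r * t))⁻¹) := by
      gcongr
      refine h3.trans ?_
      have : 0 ≤ ‖w‖ ^ 2 * vtanh (‖x‖⁻¹ * r * t) := by positivity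
      have : 0 ≤ ‖x - w‖ ^ 2 * (shc (‖x‖⁻¹ * r * t))⁻¹ := by positivity
      linarith
    refine le_trans ?_ h5
    have e6 : (2 * t)⁻¹ * ((r * t) ^ 2 / (2 + r * t)) = r ^ 2 * t / (2 * (2 + r * t)) := by
      field_simp
    rw [e6]
    have h7 : r ^ 2 * (t₀ / 2) / (2 * (2 + r * (2 * t₀))) ≤ r ^ 2 * t / (2 * (2 + r * t)) := by
      gcongr
    refine le_trans ?_ h7
    -- With s = t₀r this is (s-1)(s+1) ≤ s², the origin of the constants 1/8 and 1/(8t₀).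
    rw [div_le_div_iff₀ (by positivity) (by positivity)]
    nlinarith
  unfold mehler
  have hA : (t * shc (‖x‖⁻¹ * r * t))⁻¹ ≤ 2 / t₀ := by
    rw [inv_le_comm₀ (by positivity) (by positivity), inv_div]
    nlinarith
  calc _ ≤ (2 / t₀) ^ ((N : ℝ) / 2) * Real.exp (-((t₀ * r - 1) / (8 * t₀))) := by
        gcongr
    _ = _ := by
        rw [mul_assoc, ← Real.exp_add]
        congr 2
        field_simp
        ring

/-- Since `vtanh` v ~ v²/2 at 0 and |x+w|/|x| → 1, the large factor |x|² + |x+w|² is exactly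
compensated and t₀²r² remains. -/
theorem tendsto_mehler_rescaled {ι : Type*} {l : Filter ι} {x : ι → EuclideanSpace ℝ (Fin N)}
    {t : ι → ℝ} {t₀ : ℝ} (ht₀ : 0 < t₀) (hx : Tendsto (fun i => ‖x i‖) l atTop)
    (ht : Tendsto t l (𝓝 t₀)) (w : EuclideanSpace ℝ (Fin N)) (r : ℝ) :
    Tendsto (fun i => mehler (x i) (x i + w) (t i) (‖x i‖⁻¹ * r)) l
      (𝓝 (t₀⁻¹ ^ ((N : ℝ) / 2) * Real.exp (-((2 * t₀)⁻¹ * (‖w‖ ^ 2 + t₀ ^ 2 * r ^ 2))))) := by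
  have hinv : Tendsto (fun i => ‖x i‖⁻¹) l (𝓝 0) := tendsto_inv_atTop_zero.comp hx
  have harg : Tendsto (fun i => ‖x i‖⁻¹ * r * t i) l (𝓝 0) := by
    simpa using (hinv.mul_const r).mul ht
  have hshc : Tendsto (fun i => shc (‖x i‖⁻¹ * r * t i)) l (𝓝 1) := by
    have := (continuous_shc.tendsto 0).comp harg
    rwa [shc_zero] at this
  have hg : Tendsto (fun i => shc (‖x i‖⁻¹ * r * t i / 2) / (2 * Real.cosh (‖x i‖⁻¹ * r * t i / 2)))
      l (𝓝 (1 / 2)) := by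
    have h1 : Continuous fun v : ℝ => shc (v / 2) / (2 * Real.cosh (v / 2)) := by
      refine Continuous.div₀ (continuous_shc.comp (by fun_prop)) (by fun_prop) fun v => ?_
      have := Real.cosh_pos (v / 2)
      positivity
    have := (h1.tendsto 0).comp harg
    simpa [shc_zero, Function.comp_def] using this
  have hratio : Tendsto (fun i => ‖x i + w‖ * ‖x i‖⁻¹) l (𝓝 1) := by
    have hlow : Tendsto (fun i => 1 - ‖w‖ * ‖x i‖⁻¹) l (𝓝 1) := by
      simpa using (hinv.const_mul ‖w‖).const_sub 1
    have hup : Tendsto (fun i => 1 + ‖w‖ * ‖x i‖⁻¹) l (𝓝 1) := by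
      simpa using (hinv.const_mul ‖w‖).const_add 1
    refine tendsto_of_tendsto_of_tendsto_of_le_of_le' hlow hup ?_ ?_
    · filter_upwards [hx.eventually_gt_atTop 0] with i hi
      have h1 : ‖x i‖ - ‖w‖ ≤ ‖x i + w‖ := by
        have := norm_sub_norm_le (x i) (-w); rwa [norm_neg, sub_neg_eq_add] at this
      calc 1 - ‖w‖ * ‖x i‖⁻¹ = (‖x i‖ - ‖w‖) * ‖x i‖⁻¹ := by field_simp
        _ ≤ _ := by gcongr
    · filter_upwards [hx.eventually_gt_atTop 0] with i hi
      calc ‖x i + w‖ * ‖x i‖⁻¹ ≤ (‖x i‖ + ‖w‖) * ‖x i‖⁻¹ := by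
            gcongr; exact norm_add_le _ _
        _ = _ := by field_simp
  have hmain : Tendsto (fun i => (‖x i‖ ^ 2 + ‖x i + w‖ ^ 2) * vtanh (‖x i‖⁻¹ * r * t i)) l
      (𝓝 (t₀ ^ 2 * r ^ 2)) := by
    have h1 : Tendsto (fun i => (1 + (‖x i + w‖ * ‖x i‖⁻¹) ^ 2) * (r * t i) ^ 2 *
        (shc (‖x i‖⁻¹ * r * t i / 2) / (2 * Real.cosh (‖x i‖⁻¹ * r * t i / 2)))) l
        (𝓝 ((1 + 1 ^ 2) * (r * t₀) ^ 2 * (1 / 2))) :=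
      (((hratio.pow 2).const_add 1).mul ((ht.const_mul r).pow 2)).mul hg
    have e : (1 + 1 ^ 2) * (r * t₀) ^ 2 * (1 / 2) = t₀ ^ 2 * r ^ 2 := by ring
    rw [e] at h1
    refine h1.congr' ?_
    filter_upwards [hx.eventually_gt_atTop 0] with i hi
    rw [vtanh_eq_sq_mul]
    field_simp
  have hw : ∀ i, ‖x i - (x i + w)‖ = ‖w‖ := fun i => by
    rw [sub_add_cancel_left, norm_neg]
  unfold mehler
  simp_rw [hw]
  have hshc' := hshc.inv₀ one_ne_zero
  rw [inv_one] at hshc'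
  have hA : Tendsto (fun i => (t i * shc (‖x i‖⁻¹ * r * t i))⁻¹) l (𝓝 t₀⁻¹) := by
    simpa using (ht.mul hshc).inv₀ (by simpa using ht₀.ne')
  have hB : Tendsto (fun i => (2 * t i)⁻¹) l (𝓝 (2 * t₀)⁻¹) :=
    (ht.const_mul 2).inv₀ (by positivity)
  refine (hA.rpow_const (Or.inr (by positivity))).mul
    ((Real.continuous_exp.tendsto _).comp ((hB.mul ?_).neg))
  rw [add_comm (‖w‖ ^ 2)]
  refine hmain.add ?_
  simpa using hshc'.const_mul (‖w‖ ^ 2)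

theorem tendsto_rescaledKernel (hk : 1 ≤ k) {ι : Type*} {l : Filter ι}
    [l.IsCountablyGenerated] {x : ι → EuclideanSpace ℝ (Fin N)}
    {t : ι → ℝ} {t₀ : ℝ} (ht₀ : 0 < t₀) (hx : Tendsto (fun i => ‖x i‖) l atTop)
    (ht : Tendsto t l (𝓝 t₀)) (v : GrushinSpace N k) :
    Tendsto (fun i => rescaledKernel (x i) (t i) v) l (𝓝 (gaussLimit t₀ v)) := by
  have hev : ∀ᶠ i in l, 1 ≤ ‖x i‖ ∧ t₀ / 2 < t i ∧ t i < 2 * t₀ := by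
    filter_upwards [hx.eventually_ge_atTop 1, ht.eventually (lt_mem_nhds (half_lt_self ht₀)),
      ht.eventually (gt_mem_nhds (show t₀ < 2 * t₀ by linarith))] with i h1 h2 h3
    exact ⟨h1, h2, h3⟩
  have h : Tendsto (fun i => (rescaledKernel (x i) (t i) v : ℂ)) l (𝓝 (gaussLimit t₀ v : ℂ)) := by
    rw [gaussLimit_eq_integral ht₀]
    have h1 : Tendsto (fun i => ∫ η : EuclideanSpace ℝ (Fin k),
        (mehler (x i) (x i + v.1) (t i) (‖x i‖⁻¹ * ‖η‖) : ℂ) *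
        Complex.exp ((inner ℝ η v.2 : ℝ) * Complex.I)) l (𝓝 (∫ η : EuclideanSpace ℝ (Fin k),
      ((t₀⁻¹ ^ ((N : ℝ) / 2) * Real.exp (-((2 * t₀)⁻¹ * (‖v.1‖ ^ 2 + t₀ ^ 2 * ‖η‖ ^ 2))) : ℝ) : ℂ) *
        Complex.exp ((inner ℝ η v.2 : ℝ) * Complex.I))) := by
      refine tendsto_integral_filter_of_dominated_convergence
        (fun η => (2 / t₀) ^ ((N : ℝ) / 2) * Real.exp (1 / (8 * t₀)) * Real.exp (-(1 / 8 * ‖η‖)))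
        ?_ ?_ ((integrable_exp_neg_norm volume (by norm_num)).const_mul _) ?_
      · filter_upwards [hev] with i hi
        have hti : 0 < t i := (half_pos ht₀).trans hi.2.1
        refine Continuous.aestronglyMeasurable (Continuous.mul ?_ (by fun_prop))
        exact Complex.continuous_ofReal.comp ((continuous_mehler_last _ _ hti).comp (by fun_prop))
      · filter_upwards [hev] with i hi
        have hti : 0 < t i := (half_pos ht₀).trans hi.2.1
        refine Eventually.of_forall fun η => ?_
        rw [norm_mul, Complex.norm_exp_ofReal_mul_I, mul_one, Complex.norm_real, Real.norm_eq_abs,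
          abs_of_pos (mehler_pos _ _ hti _)]
        exact mehler_rescaled_le hi.1 hi.2.1 hi.2.2 (norm_nonneg _)
      · refine Eventually.of_forall fun η => Tendsto.mul_const _ ?_
        exact (Complex.continuous_ofReal.tendsto _).comp
          (tendsto_mehler_rescaled ht₀ hx ht v.1 ‖η‖)
    refine (h1.const_mul (grushinConst N k : ℂ)).congr' ?_
    filter_upwards [hev] with i hi
    refine (rescaledKernel_eq_integral hk ?_ ((half_pos ht₀).trans hi.2.1) v).symm
    exact norm_pos_iff.1 (one_pos.trans_le hi.1)
  have := (Complex.continuous_re.tendsto _).comp h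
  simpa [Function.comp_def] using this

end Kernel

end

/-! ### Uniform L¹ continuity of the kernel in time -/

noncomputable section

section Kernel

variable {N k : ℕ}

theorem enorm_gker (hN : 1 ≤ N) (hk : 1 ≤ k) {t : ℝ} (ht : 0 < t) (u v : GrushinSpace N k) :
    ‖gker t u v‖ₑ = ENNReal.ofReal (gker t u v) :=
  Real.enorm_of_nonneg (gker_nonneg hN hk ht u v)

theorem measurable_gker (hN : 1 ≤ N) (hk : 1 ≤ k) {t : ℝ} (ht : 0 < t) :
    Measurable (Function.uncurry (gker (N := N) (k := k) t)) :=
  (continuous_gker hN hk ht).measurable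

theorem measurable_gker_right (hN : 1 ≤ N) (hk : 1 ≤ k) {t : ℝ} (ht : 0 < t)
    (u : GrushinSpace N k) : Measurable (gker t u) :=
  (measurable_gker hN hk ht).of_uncurry_left

theorem lintegral_enorm_gker (hN : 1 ≤ N) (hk : 1 ≤ k) {t : ℝ} (ht : 0 < t)
    (u : GrushinSpace N k) : ∫⁻ v : GrushinSpace N k, ‖gker t u v‖ₑ = 1 := by
  simp_rw [enorm_gker hN hk ht]
  exact lintegral_gker hN hk ht u

theorem gker_affine (t : ℝ) (u v : GrushinSpace N k) (a r : ℝ) :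
    gker t u (u.1 + a • v.1, u.2 - r • v.2) = grushinKernel u.1 (u.1 + a • v.1) (r • v.2) t := by
  simp [gker]

theorem ofReal_mul_enorm {c : ℝ} (hc : 0 ≤ c) (a : ℝ) : ENNReal.ofReal c * ‖a‖ₑ = ‖c * a‖ₑ := by
  rw [enorm_mul, Real.enorm_of_nonneg hc]

theorem lintegral_enorm_gker_sub (hN : 1 ≤ N) (hk : 1 ≤ k) {s t : ℝ} (hs : 0 < s) (ht : 0 < t)
    {u : GrushinSpace N k} (hu : u.1 ≠ 0) :
    ∫⁻ v : GrushinSpace N k, ‖gker s u v - gker t u v‖ₑ =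
      ∫⁻ v : GrushinSpace N k, ‖rescaledKernel u.1 s v - rescaledKernel u.1 t v‖ₑ := by
  have hm : Measurable fun v : GrushinSpace N k => ‖gker s u v - gker t u v‖ₑ :=
    (((measurable_gker hN hk hs).comp measurable_prodMk_left).sub
      ((measurable_gker hN hk ht).comp measurable_prodMk_left)).enorm
  rw [lintegral_grushinSpace_affine hm u one_pos (norm_pos_iff.2 hu), one_pow, one_mul,
    ← lintegral_const_mul' _ _ ENNReal.ofReal_ne_top]
  refine lintegral_congr fun v => ?_
  rw [gker_affine, gker_affine, ofReal_mul_enorm (by positivity), one_smul, mul_sub]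
  rfl

theorem rescaledKernel_nonneg (hN : 1 ≤ N) (hk : 1 ≤ k) (x : EuclideanSpace ℝ (Fin N)) {t : ℝ}
    (ht : 0 < t) (v : GrushinSpace N k) : 0 ≤ rescaledKernel x t v :=
  mul_nonneg (by positivity) (grushinKernel_nonneg hN hk _ _ _ ht)

theorem continuous_rescaledKernel (hN : 1 ≤ N) (hk : 1 ≤ k) (x : EuclideanSpace ℝ (Fin N)) {t : ℝ}
    (ht : 0 < t) : Continuous (rescaledKernel (N := N) (k := k) x t) := by
  unfold rescaledKernel
  exact continuous_const.mul ((continuous_grushinKernel hN hk ht).comp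
    (f := fun v : GrushinSpace N k => (x, x + v.1, ‖x‖ • v.2)) (by fun_prop))

theorem lintegral_rescaledKernel (hN : 1 ≤ N) (hk : 1 ≤ k) {x : EuclideanSpace ℝ (Fin N)}
    (hx : x ≠ 0) {t : ℝ} (ht : 0 < t) :
    ∫⁻ v : GrushinSpace N k, ENNReal.ofReal (rescaledKernel x t v) = 1 := by
  have hm : Measurable fun v : GrushinSpace N k => ENNReal.ofReal (gker t (x, 0) v) :=
    ((measurable_gker hN hk ht).comp measurable_prodMk_left).ennreal_ofReal
  have h := lintegral_gker hN hk ht ((x, 0) : GrushinSpace N k)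
  rw [lintegral_grushinSpace_affine hm (x, 0) one_pos (norm_pos_iff.2 hx), one_pow, one_mul,
    ← lintegral_const_mul' _ _ ENNReal.ofReal_ne_top] at h
  rw [← h]
  refine lintegral_congr fun v => ?_
  rw [gker_affine, ← ENNReal.ofReal_mul (by positivity), one_smul]
  rfl

theorem tendsto_lintegral_rescaledKernel_sub (hN : 1 ≤ N) (hk : 1 ≤ k) {ι : Type*} {l : Filter ι}
    [l.IsCountablyGenerated] {x : ι → EuclideanSpace ℝ (Fin N)} {t : ι → ℝ} {t₀ : ℝ}
    (ht₀ : 0 < t₀) (hx : Tendsto (fun i => ‖x i‖) l atTop) (ht : Tendsto t l (𝓝 t₀)) :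
    Tendsto (fun i => ∫⁻ v : GrushinSpace N k, ‖rescaledKernel (x i) (t i) v - gaussLimit t₀ v‖ₑ) l
      (𝓝 0) := by
  refine tendsto_lintegral_enorm_sub_of_tendsto ENNReal.one_ne_top ?_
    (continuous_gaussLimit t₀).measurable.aemeasurable (gaussLimit_nonneg ht₀)
    (lintegral_gaussLimit ht₀) (Eventually.of_forall fun v =>
      tendsto_rescaledKernel hk ht₀ hx ht v)
  filter_upwards [hx.eventually_gt_atTop 0, ht.eventually (lt_mem_nhds ht₀)] with i h1 h2
  exact ⟨(continuous_rescaledKernel hN hk _ h2).measurable.aemeasurable,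
    rescaledKernel_nonneg hN hk _ h2, lintegral_rescaledKernel hN hk (norm_pos_iff.1 h1) h2⟩

theorem tendsto_lintegral_gker_sub (hN : 1 ≤ N) (hk : 1 ≤ k) {ι : Type*} {l : Filter ι}
    [l.IsCountablyGenerated] {u : ι → GrushinSpace N k} {t : ι → ℝ} {u₀ : GrushinSpace N k} {t₀ : ℝ}
    (ht₀ : 0 < t₀) (hu : Tendsto u l (𝓝 u₀)) (ht : Tendsto t l (𝓝 t₀)) :
    Tendsto (fun i => ∫⁻ v : GrushinSpace N k, ‖gker (t i) (u i) v - gker t₀ u₀ v‖ₑ) l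
      (𝓝 0) := by
  refine tendsto_lintegral_enorm_sub_of_tendsto ENNReal.one_ne_top ?_
    ((measurable_gker hN hk ht₀).comp measurable_prodMk_left).aemeasurable
    (gker_nonneg hN hk ht₀ u₀) (lintegral_gker hN hk ht₀ u₀) (Eventually.of_forall fun v => ?_)
  · filter_upwards [ht.eventually (lt_mem_nhds ht₀)] with i hi
    exact ⟨((measurable_gker hN hk hi).comp measurable_prodMk_left).aemeasurable,
      gker_nonneg hN hk hi _, lintegral_gker hN hk hi _⟩
  · have h1 : Tendsto (fun i => ((u i).1, v.1, (u i).2 - v.2, t i)) l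
        (𝓝 (u₀.1, v.1, u₀.2 - v.2, t₀)) :=
      ((continuous_fst.tendsto _).comp hu).prodMk_nhds (tendsto_const_nhds.prodMk_nhds
        ((((continuous_snd.tendsto _).comp hu).sub_const _).prodMk_nhds ht))
    have h2 := (continuousAt_grushinKernel hN hk u₀.1 v.1 (u₀.2 - v.2) ht₀).tendsto.comp h1
    simp only [Function.comp_def] at h2
    unfold gker
    exact h2

/-- The kernel sees only the difference of second variables, so uniformity in u reduces to
uniformity in x. -/
theorem lintegral_enorm_gker_sub_snd (s t : ℝ) (x : EuclideanSpace ℝ (Fin N))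
    (y : EuclideanSpace ℝ (Fin k)) :
    ∫⁻ v : GrushinSpace N k, ‖gker s (x, y) v - gker t (x, y) v‖ₑ =
      ∫⁻ v : GrushinSpace N k, ‖gker s (x, 0) v - gker t (x, 0) v‖ₑ := by
  rw [Measure.volume_eq_prod, ← lintegral_add_right_eq_self _ ((0, y) : GrushinSpace N k)]
  refine lintegral_congr fun v => ?_
  simp only [gker, Prod.fst_add, Prod.snd_add, add_zero, zero_sub, sub_add_cancel_right]

theorem lintegral_enorm_sub_le_add {X : Type*} [MeasurableSpace X] {μ : Measure X} {f g h : X → ℝ}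
    (hf : Measurable f) (hh : Measurable h) :
    ∫⁻ x, ‖f x - g x‖ₑ ∂μ ≤ ∫⁻ x, ‖f x - h x‖ₑ ∂μ + ∫⁻ x, ‖g x - h x‖ₑ ∂μ := by
  rw [← lintegral_add_left (hf.fun_sub hh).enorm]
  refine lintegral_mono fun x => ?_
  have e : f x - g x = (f x - h x) - (g x - h x) := by ring
  rw [e]
  exact enorm_sub_le

/-- After rescaling, the kernels at times t and t₀ are both L¹-close to the same Gaussian. -/
theorem eventually_lintegral_gker_sub_le_far (hN : 1 ≤ N) (hk : 1 ≤ k) {t₀ : ℝ} (ht₀ : 0 < t₀)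
    {ε : ℝ≥0∞} (hε : 0 < ε) :
    ∀ᶠ q : ℝ × EuclideanSpace ℝ (Fin N) in 𝓝 t₀ ×ˢ comap norm atTop,
      ∫⁻ v : GrushinSpace N k, ‖gker q.1 (q.2, 0) v - gker t₀ (q.2, 0) v‖ₑ ≤ ε := by
  have hx : Tendsto (fun q : ℝ × EuclideanSpace ℝ (Fin N) => ‖q.2‖)
      (𝓝 t₀ ×ˢ comap norm atTop) atTop := tendsto_comap.comp tendsto_snd
  have h1 := tendsto_lintegral_rescaledKernel_sub (k := k) hN hk ht₀ hx tendsto_fst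
  have h2 := tendsto_lintegral_rescaledKernel_sub (k := k) hN hk ht₀ hx
    (tendsto_const_nhds (x := t₀))
  have h3 := h1.add h2
  rw [add_zero] at h3
  filter_upwards [h3.eventually (gt_mem_nhds hε), hx.eventually_gt_atTop 0,
    tendsto_fst.eventually (lt_mem_nhds ht₀)] with q h4 h5 h6
  have h7 : q.2 ≠ 0 := norm_pos_iff.1 h5
  rw [lintegral_enorm_gker_sub (u := ((q.2, 0) : GrushinSpace N k)) hN hk h6 ht₀ h7]
  exact (lintegral_enorm_sub_le_add (g := rescaledKernel (N := N) (k := k) q.2 t₀)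
    (continuous_rescaledKernel hN hk q.2 h6).measurable
    (continuous_gaussLimit t₀).measurable).trans h4.le

/-- Scheffé's lemma for the joint limit: both kernels at the moving point are compared with the one
at (t₀, x). The joint neighbourhood in time and space is what compactness requires. -/
theorem eventually_lintegral_gker_sub_le_near (hN : 1 ≤ N) (hk : 1 ≤ k) {t₀ : ℝ} (ht₀ : 0 < t₀)
    {ε : ℝ≥0∞} (hε : 0 < ε) (x : EuclideanSpace ℝ (Fin N)) :
    ∀ᶠ q : ℝ × EuclideanSpace ℝ (Fin N) in 𝓝 (t₀, x),
      ∫⁻ v : GrushinSpace N k, ‖gker q.1 (q.2, 0) v - gker t₀ (q.2, 0) v‖ₑ ≤ ε := by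
  have hu : Tendsto (fun q : ℝ × EuclideanSpace ℝ (Fin N) => ((q.2, 0) : GrushinSpace N k))
      (𝓝 (t₀, x)) (𝓝 (x, 0)) :=
    Continuous.tendsto' (by fun_prop) _ _ rfl
  have ht : Tendsto (fun q : ℝ × EuclideanSpace ℝ (Fin N) => q.1) (𝓝 (t₀, x)) (𝓝 t₀) :=
    continuous_fst.tendsto' _ _ rfl
  have h1 := tendsto_lintegral_gker_sub hN hk ht₀ hu ht
  have h2 := tendsto_lintegral_gker_sub hN hk ht₀ hu (tendsto_const_nhds (x := t₀))
  have h3 := h1.add h2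
  rw [add_zero] at h3
  have e1 := h3.eventually_lt_const hε
  have e2 := ht.eventually_const_lt ht₀
  refine (e1.and e2).mono fun q hq => ?_
  obtain ⟨h4, h5⟩ := hq
  have m1 : Measurable fun v : GrushinSpace N k => gker q.1 (q.2, 0) v :=
    measurable_gker_right hN hk h5 (q.2, 0)
  have m2 : Measurable fun v : GrushinSpace N k => gker t₀ (x, 0) v :=
    measurable_gker_right hN hk ht₀ (x, 0)
  have h6 := lintegral_enorm_sub_le_add (μ := volume)
    (g := fun v : GrushinSpace N k => gker t₀ (q.2, 0) v) m1 m2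
  exact h6.trans h4.le

/-- Continuity of the kernel in `t` for the norm `sup_u ‖k(u, ·)‖_{L¹}`. -/
theorem eventually_lintegral_gker_sub_le (hN : 1 ≤ N) (hk : 1 ≤ k) {t₀ : ℝ} (ht₀ : 0 < t₀)
    {ε : ℝ≥0∞} (hε : 0 < ε) : ∀ᶠ t in 𝓝 t₀, ∀ u : GrushinSpace N k,
      ∫⁻ v : GrushinSpace N k, ‖gker t u v - gker t₀ u v‖ₑ ≤ ε := by
  obtain ⟨P, hP, Q, hQ, hPQ⟩ := eventually_prod_iff.1
    (eventually_lintegral_gker_sub_le_far (k := k) hN hk ht₀ hε)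
  obtain ⟨S, hS, hSQ⟩ := mem_comap.1 hQ
  obtain ⟨ρ, hρ⟩ := mem_atTop_sets.1 hS
  -- The far estimate fixes the radius ρ; compactness of the ball makes the local estimates uniform
  -- on the rest.
  have near := (isCompact_closedBall (0 : EuclideanSpace ℝ (Fin N)) ρ
    ).eventually_forall_of_forall_eventually
    (P := fun t x => ∫⁻ v : GrushinSpace N k, ‖gker t (x, 0) v - gker t₀ (x, 0) v‖ₑ ≤ ε)
    (x₀ := t₀) fun x _ => eventually_lintegral_gker_sub_le_near hN hk ht₀ hε x
  filter_upwards [hP, near] with t h1 h2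
  rintro ⟨x, y⟩
  rw [lintegral_enorm_gker_sub_snd]
  by_cases hx : ‖x‖ ≤ ρ
  · exact h2 x (by simpa using hx)
  · have hxQ : Q x := hSQ (show ‖x‖ ∈ S from hρ _ (not_le.1 hx).le)
    exact hPQ h1 hxQ

/-! ### Parabolic scaling and concentration at small times -/

theorem mehler_time_scaling (x w : EuclideanSpace ℝ (Fin N)) {t : ℝ} (ht : 0 < t) (l : ℝ) :
    mehler x w t l =
      t⁻¹ ^ ((N : ℝ) / 2) * mehler ((√t)⁻¹ • x) ((√t)⁻¹ • w) 1 (t * l) := by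
  have hs : 0 < √t := Real.sqrt_pos.2 ht
  have hsq : ((√t)⁻¹) ^ 2 = t⁻¹ := by rw [inv_pow, Real.sq_sqrt ht.le]
  have hshc := shc_pos (l * t)
  unfold mehler
  rw [← smul_sub, norm_smul, norm_smul, norm_smul, mul_pow, mul_pow, mul_pow, norm_inv,
    Real.norm_of_nonneg hs.le, hsq, mul_one, one_mul, mul_one, mul_comm t l, mul_inv,
    Real.mul_rpow (by positivity) (by positivity), mul_assoc]
  congr 3
  field_simp

theorem grushinKernel_time_scaling (hk : 1 ≤ k) (x w : EuclideanSpace ℝ (Fin N))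
    (y : EuclideanSpace ℝ (Fin k)) {t : ℝ} (ht : 0 < t) :
    grushinKernel x w y t = t⁻¹ ^ ((N : ℝ) / 2) * t⁻¹ ^ k *
      grushinKernel ((√t)⁻¹ • x) ((√t)⁻¹ • w) (t⁻¹ • y) 1 := by
  apply Complex.ofReal_injective
  rw [Complex.ofReal_mul, ofReal_grushinKernel, ofReal_grushinKernel,
    grushinKernelComplex_eq hk _ _ _ ht, grushinKernelComplex_eq hk _ _ _ one_pos, mul_left_comm]
  congr 1
  have h := Measure.integral_comp_smul_of_nonneg (volume : Measure (EuclideanSpace ℝ (Fin k)))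
    (fun ξ => (mehler ((√t)⁻¹ • x) ((√t)⁻¹ • w) 1 ‖ξ‖ : ℂ) *
      Complex.exp ((inner ℝ ξ (t⁻¹ • y) : ℝ) * Complex.I)) t (hR := ht.le)
  rw [finrank_euclideanSpace_fin, Complex.real_smul, ← inv_pow] at h
  rw [Complex.ofReal_mul, mul_assoc, ← h, ← integral_const_mul]
  congr 1; ext ξ
  rw [mehler_time_scaling x w ht, norm_smul, Real.norm_of_nonneg ht.le, real_inner_smul_left,
    real_inner_smul_right, ← mul_assoc t, mul_inv_cancel₀ ht.ne', one_mul, Complex.ofReal_mul,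
    mul_assoc]

/-- Near a point with x ≠ 0 the kernel has width √t in the first variable and √t|x| in the second.
In these units it is the time-one kernel based at x/√t, which escapes to infinity as t → 0. -/
theorem gker_small_time (hk : 1 ≤ k) {t : ℝ} (ht : 0 < t) (u v : GrushinSpace N k) :
    (√t) ^ N * (√t * ‖u.1‖) ^ k * gker t u (u.1 + √t • v.1, u.2 - (√t * ‖u.1‖) • v.2) =
      rescaledKernel ((√t)⁻¹ • u.1) 1 v := by
  have hs : 0 < √t := Real.sqrt_pos.2 ht
  have hsq : √t * √t = t := Real.mul_self_sqrt ht.le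
  have hN2 : t⁻¹ ^ ((N : ℝ) / 2) = ((√t) ^ N)⁻¹ := by
    rw [Real.inv_rpow ht.le, Real.sqrt_eq_rpow, ← Real.rpow_natCast, ← Real.rpow_mul ht.le]
    congr 2; ring
  rw [gker_affine, grushinKernel_time_scaling hk _ _ _ ht, rescaledKernel, smul_add, smul_smul,
    inv_mul_cancel₀ hs.ne', one_smul, smul_smul, hN2, norm_smul, norm_inv,
    Real.norm_of_nonneg hs.le]
  have e1 : t⁻¹ * (√t * ‖u.1‖) = (√t)⁻¹ * ‖u.1‖ := by
    nth_rw 1 [← hsq]; field_simp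
  have e2 : √t ^ N * (√t * ‖u.1‖) ^ k * ((√t ^ N)⁻¹ * t⁻¹ ^ k) = ((√t)⁻¹ * ‖u.1‖) ^ k := by
    rw [← e1, mul_pow t⁻¹]; field_simp
  rw [e1, ← mul_assoc, e2]

theorem lintegral_gker_small_time (hN : 1 ≤ N) (hk : 1 ≤ k) {t : ℝ} (ht : 0 < t)
    {u : GrushinSpace N k} (hu : u.1 ≠ 0) {f : GrushinSpace N k → ℝ≥0∞} (hf : Measurable f) :
    ∫⁻ v : GrushinSpace N k, ‖gker t u v‖ₑ * f v =
      ∫⁻ v : GrushinSpace N k, ‖rescaledKernel ((√t)⁻¹ • u.1) 1 v‖ₑ *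
        f (u.1 + √t • v.1, u.2 - (√t * ‖u.1‖) • v.2) := by
  have hs : 0 < √t := Real.sqrt_pos.2 ht
  have hx : 0 < ‖u.1‖ := norm_pos_iff.2 hu
  have hm : Measurable fun v : GrushinSpace N k => ‖gker t u v‖ₑ * f v :=
    ((measurable_gker hN hk ht).comp measurable_prodMk_left).enorm.mul hf
  rw [lintegral_grushinSpace_affine hm u hs (mul_pos hs hx),
    ← lintegral_const_mul' _ _ ENNReal.ofReal_ne_top]
  refine lintegral_congr fun v => ?_
  rw [← mul_assoc, ofReal_mul_enorm (by positivity), gker_small_time hk ht]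

theorem tendsto_inv_sqrt_smul {x : EuclideanSpace ℝ (Fin N)} (hx : x ≠ 0) :
    Tendsto (fun t : ℝ => ‖(√t)⁻¹ • x‖) (𝓝[>] 0) atTop := by
  have h1 : Tendsto (fun t : ℝ => √t) (𝓝[>] 0) (𝓝[>] 0) := by
    refine tendsto_nhdsWithin_iff.2 ⟨?_, ?_⟩
    · have := (Real.continuous_sqrt.tendsto 0).mono_left (nhdsWithin_le_nhds (s := Set.Ioi 0))
      rwa [Real.sqrt_zero] at this
    · filter_upwards [self_mem_nhdsWithin] with t ht
      exact Real.sqrt_pos.2 ht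
  have h2 := (tendsto_inv_nhdsGT_zero.comp h1).atTop_mul_const (norm_pos_iff.2 hx)
  refine h2.congr fun t => ?_
  rw [norm_smul, norm_inv, Real.norm_of_nonneg (Real.sqrt_nonneg t)]
  rfl

/-- Replacing the rescaled kernel by its Gaussian limit costs at most 2M times their L¹ distance.
With the Gaussian fixed, continuity of φ at u and dominated convergence finish. -/
theorem tendsto_lintegral_gker_mul_enorm_sub (hN : 1 ≤ N) (hk : 1 ≤ k) {E : Type*}
    [NormedAddCommGroup E] {φ : GrushinSpace N k → E} (hφ : Continuous φ) {M : ℝ≥0}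
    (hM : ∀ v, ‖φ v‖ₑ ≤ M) {u : GrushinSpace N k} (hu : u.1 ≠ 0) :
    Tendsto (fun t => ∫⁻ v : GrushinSpace N k, ‖gker t u v‖ₑ * ‖φ v - φ u‖ₑ) (𝓝[>] 0) (𝓝 0) := by
  have hf : Continuous fun v => ‖φ v - φ u‖ₑ := (hφ.sub continuous_const).enorm
  have hfM : ∀ v, ‖φ v - φ u‖ₑ ≤ 2 * M := fun v => by
    refine enorm_sub_le.trans ?_
    rw [two_mul]
    exact add_le_add (hM v) (hM u)
  have hR := tendsto_lintegral_rescaledKernel_sub (k := k) hN hk one_pos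
    (tendsto_inv_sqrt_smul hu) (tendsto_const_nhds (x := (1 : ℝ)))
  have h1 : Tendsto (fun t => 2 * (M : ℝ≥0∞) * ∫⁻ v : GrushinSpace N k,
      ‖rescaledKernel ((√t)⁻¹ • u.1) 1 v - gaussLimit 1 v‖ₑ) (𝓝[>] 0) (𝓝 0) := by
    have := ENNReal.Tendsto.const_mul (a := 2 * (M : ℝ≥0∞)) hR
      (Or.inr (ENNReal.mul_ne_top (by simp) ENNReal.coe_ne_top))
    rwa [mul_zero] at this
  have hsq : Tendsto (fun t : ℝ => √t) (𝓝[>] 0) (𝓝 0) := by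
    have := (Real.continuous_sqrt.tendsto 0).mono_left (nhdsWithin_le_nhds (s := Set.Ioi 0))
    rwa [Real.sqrt_zero] at this
  have h2 : Tendsto (fun t : ℝ => ∫⁻ v : GrushinSpace N k, ‖gaussLimit 1 v‖ₑ *
      ‖φ (u.1 + √t • v.1, u.2 - (√t * ‖u.1‖) • v.2) - φ u‖ₑ) (𝓝[>] 0)
      (𝓝 (∫⁻ _ : GrushinSpace N k, 0)) := by
    refine tendsto_lintegral_filter_of_dominated_convergence
      (fun v => ENNReal.ofReal (gaussLimit 1 v) * (2 * M)) ?_ ?_ ?_ ?_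
    · refine Eventually.of_forall fun t => ?_
      exact (continuous_gaussLimit 1).measurable.enorm.mul (hf.measurable.comp (by fun_prop))
    · refine Eventually.of_forall fun t => Eventually.of_forall fun v => ?_
      rw [Real.enorm_of_nonneg (gaussLimit_nonneg one_pos v)]
      gcongr
      exact hfM _
    · rw [lintegral_mul_const _ (continuous_gaussLimit 1).measurable.ennreal_ofReal,
        lintegral_gaussLimit one_pos, one_mul]
      exact ENNReal.mul_ne_top (by simp) ENNReal.coe_ne_top
    · refine Eventually.of_forall fun v => ?_
      have h3 : Tendsto (fun t : ℝ => ((u.1 + √t • v.1, u.2 - (√t * ‖u.1‖) • v.2) :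
          GrushinSpace N k)) (𝓝[>] 0) (𝓝 (u.1 + (0 : ℝ) • v.1, u.2 - ((0 : ℝ) * ‖u.1‖) • v.2)) :=
        ((hsq.smul_const _).const_add _).prodMk_nhds
          (((hsq.mul_const _).smul_const _).const_sub _)
      rw [zero_smul, zero_mul, zero_smul, add_zero, sub_zero] at h3
      have h4 := (hf.tendsto u).comp h3
      rw [sub_self, enorm_zero] at h4
      have := ENNReal.Tendsto.const_mul (a := ‖gaussLimit 1 v‖ₑ) h4 (Or.inr enorm_ne_top)
      rwa [mul_zero] at this
  rw [lintegral_zero] at h2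
  have h3 := h1.add h2
  rw [add_zero] at h3
  refine tendsto_of_tendsto_of_tendsto_of_le_of_le' tendsto_const_nhds h3
    (Eventually.of_forall fun _ => zero_le) ?_
  filter_upwards [self_mem_nhdsWithin] with t (ht : 0 < t)
  have hm : Measurable fun v : GrushinSpace N k =>
      ‖rescaledKernel ((√t)⁻¹ • u.1) 1 v - gaussLimit 1 v‖ₑ :=
    ((continuous_rescaledKernel hN hk _ one_pos).measurable.sub
      (continuous_gaussLimit 1).measurable).enorm
  rw [lintegral_gker_small_time hN hk ht hu hf.measurable, ← lintegral_const_mul _ hm,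
    ← lintegral_add_left (hm.const_mul _)]
  refine lintegral_mono fun v => ?_
  have h5 : ‖rescaledKernel ((√t)⁻¹ • u.1) 1 v‖ₑ ≤
      ‖rescaledKernel ((√t)⁻¹ • u.1) 1 v - gaussLimit 1 v‖ₑ + ‖gaussLimit 1 v‖ₑ := by
    have := enorm_add_le (rescaledKernel ((√t)⁻¹ • u.1) 1 v - gaussLimit 1 v) (gaussLimit 1 v)
    rwa [sub_add_cancel] at this
  refine (mul_le_mul_left h5 _).trans ?_
  rw [add_mul]
  gcongr ?_ + _
  rw [mul_comm (2 * (M : ℝ≥0∞))]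
  gcongr
  exact hfM _

end Kernel

end

/-! ### The operators S(t) for t > 0 -/

noncomputable section

section Operator

variable {N k : ℕ} {E : Type*} [NormedAddCommGroup E] [NormedSpace ℝ E]

/-- The operator `S(t)`, `t > 0`, on functions with values in a normed space. -/
def gop (t : ℝ) (φ : GrushinSpace N k → E) (u : GrushinSpace N k) : E :=
  ∫ v, gker t u v • φ v

theorem lintegral_enorm_gker_left (hN : 1 ≤ N) (hk : 1 ≤ k) {t : ℝ} (ht : 0 < t)
    (v : GrushinSpace N k) : ∫⁻ u : GrushinSpace N k, ‖gker t u v‖ₑ = 1 := by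
  simp_rw [fun u => gker_comm t u v]
  exact lintegral_enorm_gker hN hk ht v

theorem exists_enorm_gker_le (hN : 1 ≤ N) (hk : 1 ≤ k) : ∃ A : ℝ≥0, A ≠ 0 ∧ ∀ t : ℝ, 0 < t →
    ∀ u v : GrushinSpace N k,
      ‖gker t u v‖ₑ ≤ A * ENNReal.ofReal (t ^ (-(((N : ℝ) + 2 * k) / 2))) := by
  obtain ⟨A, hA⟩ := grushinKernel_le hN hk
  refine ⟨A + 1, by positivity, fun t ht u v => ?_⟩
  have h0 : 0 ≤ t ^ (-(((N : ℝ) + 2 * k) / 2)) := by positivity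
  rw [enorm_gker hN hk ht, ← ENNReal.ofReal_coe_nnreal, ← ENNReal.ofReal_mul (by positivity)]
  refine ENNReal.ofReal_le_ofReal ((hA u.1 v.1 (u.2 - v.2) t ht).trans ?_)
  push_cast
  nlinarith

theorem integrable_gker_smul (hN : 1 ≤ N) (hk : 1 ≤ k) {t : ℝ} (ht : 0 < t) {p : ℝ≥0∞} (hp : 1 ≤ p)
    {φ : GrushinSpace N k → E} (hφ : MemLp φ p) (u : GrushinSpace N k) :
    Integrable (fun v => gker t u v • φ v) := by
  obtain ⟨A, hA0, hA⟩ := exists_enorm_gker_le hN hk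
  refine integrable_kernel_smul (measurable_gker hN hk ht) hp
    (fun u => (lintegral_enorm_gker hN hk ht u).le) (hA t ht) ?_ ?_ hφ u
  · have : 0 < t ^ (-(((N : ℝ) + 2 * k) / 2)) := by positivity
    simp [hA0, this]
  · exact ENNReal.mul_ne_top ENNReal.coe_ne_top ENNReal.ofReal_ne_top

theorem aestronglyMeasurable_gop (hN : 1 ≤ N) (hk : 1 ≤ k) {t : ℝ} (ht : 0 < t)
    {φ : GrushinSpace N k → E} (hφ : AEStronglyMeasurable φ) : AEStronglyMeasurable (gop t φ) :=
  aestronglyMeasurable_integral_kernel_smul (measurable_gker hN hk ht) hφ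

theorem eLpNorm_gop_le (hN : 1 ≤ N) (hk : 1 ≤ k) {t : ℝ} (ht : 0 < t) {p : ℝ≥0∞} (hp : 1 ≤ p)
    {φ : GrushinSpace N k → E} (hφ : AEStronglyMeasurable φ) :
    eLpNorm (gop t φ) p volume ≤ eLpNorm φ p volume := by
  have := eLpNorm_integral_kernel_smul_le (measurable_gker hN hk ht) hp
    (fun u => (lintegral_enorm_gker hN hk ht u).le)
    (fun u => (lintegral_enorm_gker_left hN hk ht u).le) hφ
  rwa [one_mul] at this

theorem memLp_gop (hN : 1 ≤ N) (hk : 1 ≤ k) {t : ℝ} (ht : 0 < t) {p : ℝ≥0∞} (hp : 1 ≤ p)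
    {φ : GrushinSpace N k → E} (hφ : MemLp φ p) : MemLp (gop t φ) p :=
  ⟨aestronglyMeasurable_gop hN hk ht hφ.1, (eLpNorm_gop_le hN hk ht hp hφ.1).trans_lt hφ.2⟩

/-- Interpolation between the contraction on L^p and the L^p-L^∞ bound given by the supremum of the
kernel. -/
theorem exists_eLpNorm_gop_le (hN : 1 ≤ N) (hk : 1 ≤ k) {p r : ℝ≥0∞} (hp : 1 ≤ p) (hpr : p ≤ r) :
    ∃ C : ℝ≥0, ∀ t : ℝ, 0 < t → ∀ φ : GrushinSpace N k → E, MemLp φ p →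
      eLpNorm (gop t φ) r volume ≤ C * ENNReal.ofReal
        (t ^ (-(((N : ℝ) + 2 * k) / 2 * (p⁻¹.toReal - r⁻¹.toReal)))) * eLpNorm φ p volume := by
  obtain ⟨A, hA0, hA⟩ := exists_enorm_gker_le hN hk
  have hp0 : p ≠ 0 := (one_pos.trans_le hp).ne'
  have hr0 : r ≠ 0 := (one_pos.trans_le (hp.trans hpr)).ne'
  set θ : ℝ := p⁻¹.toReal - r⁻¹.toReal with hθ
  have hθ0 : 0 ≤ θ := sub_nonneg.2
    (ENNReal.toReal_mono (ENNReal.inv_ne_top.2 hp0) (ENNReal.inv_le_inv.2 hpr))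
  -- The kernel bound enters with exponent 1/p, raised to the interpolation weight 1 - p/r. For p =
  -- ∞ also r = ∞, and both sides are 0 by convention.
  have hexp : p⁻¹.toReal * (1 - p.toReal / r.toReal) = θ := by
    rw [hθ, ENNReal.toReal_inv, ENNReal.toReal_inv]
    rcases eq_or_ne p ∞ with rfl | hpt
    · have : r = ∞ := top_le_iff.1 hpr
      simp [this]
    · have : p.toReal ≠ 0 := (ENNReal.toReal_pos hp0 hpt).ne'
      rw [mul_sub, mul_one, div_eq_mul_inv, ← mul_assoc, inv_mul_cancel₀ this, one_mul]
  have hfr : 0 ≤ 1 - p.toReal / r.toReal := by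
    rw [sub_nonneg]
    rcases eq_or_ne r ∞ with rfl | hrt
    · simp
    · rw [div_le_one (ENNReal.toReal_pos hr0 hrt)]
      exact ENNReal.toReal_mono hrt hpr
  have hfr' : 0 ≤ p.toReal / r.toReal := by positivity
  refine ⟨A ^ θ, fun t ht φ hφ => ?_⟩
  have ht0 : 0 < t ^ (-(((N : ℝ) + 2 * k) / 2)) := by positivity
  set B : ℝ≥0∞ := A * ENNReal.ofReal (t ^ (-(((N : ℝ) + 2 * k) / 2))) with hB
  have hB0 : B ≠ 0 := by simp [hB, hA0, ht0]
  have hBt : B ≠ ∞ := ENNReal.mul_ne_top ENNReal.coe_ne_top ENNReal.ofReal_ne_top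
  have hsup : eLpNorm (gop t φ) ∞ volume ≤ B ^ p⁻¹.toReal * eLpNorm φ p volume := by
    rw [eLpNorm_exponent_top]
    refine eLpNormEssSup_le_of_ae_enorm_bound (Eventually.of_forall fun u => ?_)
    refine (enorm_integral_kernel_smul_le u).trans ?_
    have := lintegral_enorm_mul_le_of_bound (measurable_gker hN hk ht) hp
      (fun u => (lintegral_enorm_gker hN hk ht u).le) (hA t ht) hB0 hφ.1 u
    rwa [one_div] at this
  have hsupt : eLpNorm (gop t φ) ∞ volume ≠ ∞ :=
    (hsup.trans_lt (ENNReal.mul_lt_top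
      (ENNReal.rpow_lt_top_of_nonneg ENNReal.toReal_nonneg hBt) hφ.2)).ne
  refine (eLpNorm_le_interpolate_top hp hpr hsupt).trans ?_
  calc eLpNorm (gop t φ) p volume ^ (p.toReal / r.toReal) *
        eLpNorm (gop t φ) ∞ volume ^ (1 - p.toReal / r.toReal)
      ≤ eLpNorm φ p volume ^ (p.toReal / r.toReal) *
        (B ^ p⁻¹.toReal * eLpNorm φ p volume) ^ (1 - p.toReal / r.toReal) := by
        gcongr
        exact eLpNorm_gop_le hN hk ht hp hφ.1
    _ = B ^ θ * eLpNorm φ p volume := by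
        rw [ENNReal.mul_rpow_of_nonneg _ _ hfr, ← ENNReal.rpow_mul, hexp, mul_left_comm,
          ← ENNReal.rpow_add_of_nonneg _ _ hfr' hfr, add_sub_cancel, ENNReal.rpow_one]
    _ = _ := by
        rw [hB, ENNReal.mul_rpow_of_nonneg _ _ hθ0, ENNReal.ofReal_rpow_of_pos ht0,
          ← Real.rpow_mul ht.le, ← ENNReal.coe_rpow_of_nonneg _ hθ0, neg_mul]

theorem gop_sub (hN : 1 ≤ N) (hk : 1 ≤ k) {t : ℝ} (ht : 0 < t) {p : ℝ≥0∞} (hp : 1 ≤ p)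
    {φ ψ : GrushinSpace N k → E} (hφ : MemLp φ p) (hψ : MemLp ψ p) :
    gop t (φ - ψ) = gop t φ - gop t ψ := by
  ext u
  simp only [gop, Pi.sub_apply, smul_sub]
  exact integral_sub (integrable_gker_smul hN hk ht hp hφ u) (integrable_gker_smul hN hk ht hp hψ u)

theorem gop_add (hN : 1 ≤ N) (hk : 1 ≤ k) {t : ℝ} (ht : 0 < t) {p : ℝ≥0∞} (hp : 1 ≤ p)
    {φ ψ : GrushinSpace N k → E} (hφ : MemLp φ p) (hψ : MemLp ψ p) :
    gop t (φ + ψ) = gop t φ + gop t ψ := by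
  ext u
  simp only [gop, Pi.add_apply, smul_add]
  exact integral_add (integrable_gker_smul hN hk ht hp hφ u) (integrable_gker_smul hN hk ht hp hψ u)

theorem gop_congr_ae {t : ℝ} {φ ψ : GrushinSpace N k → E} (h : φ =ᵐ[volume] ψ) :
    gop t φ = gop t ψ := by
  ext u
  refine integral_congr_ae ?_
  filter_upwards [h] with v hv
  rw [hv]

theorem integral_gker_mul_gker (hN : 1 ≤ N) (hk : 1 ≤ k) {s t : ℝ} (hs : 0 < s) (ht : 0 < t)
    (u w : GrushinSpace N k) :
    ∫ v : GrushinSpace N k, gker s u v * gker t v w = gker (s + t) u w := by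
  have hm : Measurable fun v : GrushinSpace N k => gker s u v * gker t v w := by
    have h2 := measurable_gker_right hN hk ht w
    simp_rw [fun v => gker_comm t v w]
    exact (measurable_gker_right hN hk hs u).mul h2
  rw [integral_eq_lintegral_of_nonneg_ae (Eventually.of_forall fun v =>
    mul_nonneg (gker_nonneg hN hk hs _ _) (gker_nonneg hN hk ht _ _)) hm.aestronglyMeasurable]
  simp_rw [fun v => ENNReal.ofReal_mul (q := gker t v w) (gker_nonneg hN hk hs u v)]
  rw [lintegral_gker_mul_gker hN hk hs ht, ENNReal.toReal_ofReal
    (gker_nonneg hN hk (add_pos hs ht) _ _)]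

theorem gop_gop [CompleteSpace E] (hN : 1 ≤ N) (hk : 1 ≤ k) {s t : ℝ} (hs : 0 < s) (ht : 0 < t) {p : ℝ≥0∞}
    (hp : 1 ≤ p) {φ : GrushinSpace N k → E} (hφ : MemLp φ p) :
    gop s (gop t φ) = gop (s + t) φ := by
  ext u
  have hst := add_pos hs ht
  have hm : AEStronglyMeasurable (fun q : GrushinSpace N k × GrushinSpace N k =>
      gker s u q.1 • gker t q.1 q.2 • φ q.2) (volume.prod volume) := by
    have h1 : Continuous fun q : GrushinSpace N k × GrushinSpace N k => gker s u q.1 :=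
      (continuous_gker hN hk hs).comp (f := fun q : GrushinSpace N k × GrushinSpace N k => (u, q.1))
        (by fun_prop)
    exact h1.aestronglyMeasurable.fun_smul
      ((continuous_gker hN hk ht).aestronglyMeasurable.fun_smul hφ.1.comp_snd)
  -- By positivity the absolute values obey Chapman–Kolmogorov too, so Tonelli reduces this to the
  -- integrability already known at time s + t.
  have hint : Integrable (fun q : GrushinSpace N k × GrushinSpace N k =>
      gker s u q.1 • gker t q.1 q.2 • φ q.2) (volume.prod volume) := by
    refine ⟨hm, ?_⟩
    unfold HasFiniteIntegral
    rw [lintegral_prod_symm _ hm.enorm]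
    have e : ∀ w : GrushinSpace N k, ∫⁻ v : GrushinSpace N k,
        ‖gker s u v • gker t v w • φ w‖ₑ = ‖gker (s + t) u w‖ₑ * ‖φ w‖ₑ := by
      intro w
      have hm' : Measurable fun v : GrushinSpace N k => ‖gker s u v‖ₑ * ‖gker t v w‖ₑ := by
        simp_rw [fun v => gker_comm t v w]
        exact (measurable_gker_right hN hk hs u).enorm.mul (measurable_gker_right hN hk ht w).enorm
      simp_rw [enorm_smul, ← mul_assoc]
      rw [lintegral_mul_const _ hm']
      simp_rw [enorm_gker hN hk hs, enorm_gker hN hk ht]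
      rw [lintegral_gker_mul_gker hN hk hs ht, enorm_gker hN hk hst]
    simp_rw [e]
    have := (integrable_gker_smul hN hk hst hp hφ u).2
    unfold HasFiniteIntegral at this
    simpa only [enorm_smul] using this
  calc gop s (gop t φ) u = ∫ v, ∫ w, gker s u v • gker t v w • φ w := by
        unfold gop
        simp_rw [integral_smul]
    _ = ∫ w, ∫ v, gker s u v • gker t v w • φ w := integral_integral_swap hint
    _ = gop (s + t) φ u := by
        unfold gop
        refine integral_congr_ae (Eventually.of_forall fun w => ?_)
        simp only [smul_smul]
        rw [integral_smul_const, integral_gker_mul_gker hN hk hs ht]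

theorem eventually_eLpNorm_gop_sub_le (hN : 1 ≤ N) (hk : 1 ≤ k) {t₀ : ℝ} (ht₀ : 0 < t₀) {p : ℝ≥0∞}
    (hp : 1 ≤ p) {φ : GrushinSpace N k → E} (hφ : MemLp φ p) {ε : ℝ≥0∞} (hε : 0 < ε) :
    ∀ᶠ t in 𝓝 t₀, eLpNorm (gop t φ - gop t₀ φ) p volume ≤ ε * eLpNorm φ p volume := by
  filter_upwards [eventually_lintegral_gker_sub_le hN hk ht₀ hε, lt_mem_nhds ht₀] with t h1 ht
  have hm : Measurable (Function.uncurry fun u v : GrushinSpace N k => gker t u v - gker t₀ u v) :=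
    (measurable_gker hN hk ht).sub (measurable_gker hN hk ht₀)
  have h2 : ∀ v : GrushinSpace N k, ∫⁻ u : GrushinSpace N k, ‖gker t u v - gker t₀ u v‖ₑ ≤ ε := by
    intro v
    simp_rw [fun u => gker_comm t u v, fun u => gker_comm t₀ u v]
    exact h1 v
  have e : gop t φ - gop t₀ φ = fun u => ∫ v, (gker t u v - gker t₀ u v) • φ v := by
    ext u
    simp only [gop, Pi.sub_apply, sub_smul]
    exact (integral_sub (integrable_gker_smul hN hk ht hp hφ u)
      (integrable_gker_smul hN hk ht₀ hp hφ u)).symm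
  rw [e]
  exact eLpNorm_integral_kernel_smul_le hm hp h1 h2 hφ.1

theorem tendsto_eLpNorm_gop_sub (hN : 1 ≤ N) (hk : 1 ≤ k) {t₀ : ℝ} (ht₀ : 0 < t₀) {p : ℝ≥0∞}
    (hp : 1 ≤ p) {φ : GrushinSpace N k → E} (hφ : MemLp φ p) :
    Tendsto (fun t => eLpNorm (gop t φ - gop t₀ φ) p volume) (𝓝 t₀) (𝓝 0) := by
  rw [ENNReal.tendsto_nhds_zero]
  intro ε hε
  have hδ : 0 < ε / (eLpNorm φ p volume + 1) :=
    ENNReal.div_pos hε.ne' (ENNReal.add_ne_top.2 ⟨hφ.2.ne, ENNReal.one_ne_top⟩)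
  filter_upwards [eventually_eLpNorm_gop_sub_le hN hk ht₀ hp hφ hδ] with t ht
  refine ht.trans ?_
  calc ε / (eLpNorm φ p volume + 1) * eLpNorm φ p volume
      ≤ ε / (eLpNorm φ p volume + 1) * (eLpNorm φ p volume + 1) := by gcongr; exact le_self_add
    _ = ε := ENNReal.div_mul_cancel (by simp)
        (ENNReal.add_ne_top.2 ⟨hφ.2.ne, ENNReal.one_ne_top⟩)

/-- Factoring out S(t₀/2), which maps L^p to L^r with a fixed constant, leaves continuity on L^p at
t₀/2. -/
theorem tendsto_eLpNorm_gop_sub_of_le [CompleteSpace E] (hN : 1 ≤ N) (hk : 1 ≤ k) {t₀ : ℝ}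
    (ht₀ : 0 < t₀) {p r : ℝ≥0∞} (hp : 1 ≤ p) (hpr : p ≤ r) {φ : GrushinSpace N k → E}
    (hφ : MemLp φ p) :
    Tendsto (fun t => eLpNorm (gop t φ - gop t₀ φ) r volume) (𝓝 t₀) (𝓝 0) := by
  obtain ⟨C, hC⟩ := exists_eLpNorm_gop_le (N := N) (k := k) (E := E) hN hk hp hpr
  have h2 : 0 < t₀ / 2 := half_pos ht₀
  set c : ℝ≥0∞ := C * ENNReal.ofReal
    ((t₀ / 2) ^ (-(((N : ℝ) + 2 * k) / 2 * (p⁻¹.toReal - r⁻¹.toReal)))) with hc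
  have hct : c ≠ ∞ := ENNReal.mul_ne_top ENNReal.coe_ne_top ENNReal.ofReal_ne_top
  have hshift : Tendsto (fun t : ℝ => t - t₀ / 2) (𝓝 t₀) (𝓝 (t₀ / 2)) :=
    Continuous.tendsto' (by fun_prop) _ _ (by ring)
  have h3 := ENNReal.Tendsto.const_mul (a := c)
    ((tendsto_eLpNorm_gop_sub hN hk h2 hp hφ).comp hshift) (Or.inr hct)
  rw [mul_zero] at h3
  refine tendsto_of_tendsto_of_tendsto_of_le_of_le' tendsto_const_nhds h3
    (Eventually.of_forall fun _ => zero_le) ?_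
  filter_upwards [hshift.eventually (lt_mem_nhds h2)] with t ht
  have e1 : gop t φ = gop (t₀ / 2) (gop (t - t₀ / 2) φ) := by
    rw [gop_gop hN hk h2 ht hp hφ, add_sub_cancel]
  have e2 : gop t₀ φ = gop (t₀ / 2) (gop (t₀ / 2) φ) := by
    rw [gop_gop hN hk h2 h2 hp hφ, add_halves]
  have m1 := memLp_gop hN hk ht hp hφ
  have m2 := memLp_gop hN hk h2 hp hφ
  rw [e1, e2, ← gop_sub hN hk h2 hp m1 m2]
  exact hC _ h2 _ (m1.sub m2)

end Operator

end

/-! ### Strong continuity at time zero -/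

noncomputable section

section Initial

variable {N k : ℕ} {E : Type*} [NormedAddCommGroup E] [NormedSpace ℝ E]

theorem integrable_gker (hN : 1 ≤ N) (hk : 1 ≤ k) {t : ℝ} (ht : 0 < t) (u : GrushinSpace N k) :
    Integrable (gker t u) := by
  refine ⟨(measurable_gker_right hN hk ht u).aestronglyMeasurable, ?_⟩
  rw [HasFiniteIntegral, lintegral_enorm_gker hN hk ht]
  exact ENNReal.one_lt_top

theorem integral_gker (hN : 1 ≤ N) (hk : 1 ≤ k) {t : ℝ} (ht : 0 < t) (u : GrushinSpace N k) :
    ∫ v : GrushinSpace N k, gker t u v = 1 := by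
  rw [integral_eq_lintegral_of_nonneg_ae (Eventually.of_forall (gker_nonneg hN hk ht u))
    (measurable_gker_right hN hk ht u).aestronglyMeasurable, lintegral_gker hN hk ht,
    ENNReal.toReal_one]

theorem enorm_gop_sub_le [CompleteSpace E] (hN : 1 ≤ N) (hk : 1 ≤ k) {t : ℝ} (ht : 0 < t)
    {p : ℝ≥0∞} (hp : 1 ≤ p) {φ : GrushinSpace N k → E} (hφ : MemLp φ p) (u : GrushinSpace N k) :
    ‖gop t φ u - φ u‖ₑ ≤ ∫⁻ v : GrushinSpace N k, ‖gker t u v‖ₑ * ‖φ v - φ u‖ₑ := by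
  have e : gop t φ u - φ u = ∫ v : GrushinSpace N k, gker t u v • (φ v - φ u) := by
    simp_rw [smul_sub]
    rw [integral_sub (integrable_gker_smul hN hk ht hp hφ u)
      ((integrable_gker hN hk ht u).smul_const (φ u)), integral_smul_const,
      integral_gker hN hk ht, one_smul, gop]
  rw [e]
  refine (enorm_integral_le_lintegral_enorm _).trans ?_
  simp_rw [enorm_smul]
  exact le_rfl

theorem tendsto_gop_of_continuous [CompleteSpace E] (hN : 1 ≤ N) (hk : 1 ≤ k) {p : ℝ≥0∞}
    (hp : 1 ≤ p) {φ : GrushinSpace N k → E} (hφ : MemLp φ p) (hc : Continuous φ) {M : ℝ≥0}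
    (hM : ∀ v, ‖φ v‖ₑ ≤ M) {u : GrushinSpace N k} (hu : u.1 ≠ 0) :
    Tendsto (fun t => ‖gop t φ u - φ u‖ₑ) (𝓝[>] 0) (𝓝 0) := by
  refine tendsto_of_tendsto_of_tendsto_of_le_of_le' tendsto_const_nhds
    (tendsto_lintegral_gker_mul_enorm_sub hN hk hc hM hu) (Eventually.of_forall fun _ => zero_le) ?_
  filter_upwards [self_mem_nhdsWithin] with t ht
  exact enorm_gop_sub_le hN hk ht hp hφ u

/-- The degenerate set x = 0, where the small-time rescaling breaks down, is null. -/
theorem ae_fst_ne_zero (hN : 1 ≤ N) : ∀ᵐ u : GrushinSpace N k, u.1 ≠ 0 := by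
  have : Nonempty (Fin N) := ⟨⟨0, hN⟩⟩
  have h : ∀ᵐ x : EuclideanSpace ℝ (Fin N), x ≠ 0 := by
    rw [ae_iff]
    simp
  exact Measure.quasiMeasurePreserving_fst.ae h

theorem lintegral_gop (hN : 1 ≤ N) (hk : 1 ≤ k) {t : ℝ} (ht : 0 < t)
    {f : GrushinSpace N k → ℝ} (hf : Integrable f) (hf0 : ∀ v, 0 ≤ f v) :
    ∫⁻ u, ENNReal.ofReal (gop t f u) = ∫⁻ v, ENNReal.ofReal (f v) := by
  have e : ∀ u, ENNReal.ofReal (gop t f u) =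
      ∫⁻ v : GrushinSpace N k, ‖gker t u v‖ₑ * ENNReal.ofReal (f v) := by
    intro u
    rw [gop, ofReal_integral_eq_lintegral_ofReal
      (integrable_gker_smul hN hk ht le_rfl (memLp_one_iff_integrable.2 hf) u)
      (Eventually.of_forall fun v => smul_nonneg (gker_nonneg hN hk ht u v) (hf0 v))]
    refine lintegral_congr fun v => ?_
    rw [smul_eq_mul, ENNReal.ofReal_mul (gker_nonneg hN hk ht u v), enorm_gker hN hk ht]
  have hm : AEMeasurable (fun q : GrushinSpace N k × GrushinSpace N k =>
      ‖gker t q.1 q.2‖ₑ * ENNReal.ofReal (f q.2)) (volume.prod volume) :=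
    (measurable_gker hN hk ht).enorm.aemeasurable.mul
      hf.1.comp_snd.aemeasurable.ennreal_ofReal
  simp_rw [e]
  rw [lintegral_lintegral_swap hm]
  refine lintegral_congr fun v => ?_
  rw [lintegral_mul_const' _ _ ENNReal.ofReal_ne_top, lintegral_enorm_gker_left hN hk ht, one_mul]

/-- |S(t)φ - φ| is at most S(t)|φ| + |φ|. The moving majorant S(t)|φ| converges in L¹ to |φ| by
Scheffé's lemma, since S(t) preserves the integral of nonnegative functions. -/
theorem tendsto_lintegral_gop_sub [CompleteSpace E] (hN : 1 ≤ N) (hk : 1 ≤ k)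
    {φ : GrushinSpace N k → E} (hφ : Integrable φ) (hc : Continuous φ) {M : ℝ≥0}
    (hM : ∀ v, ‖φ v‖ₑ ≤ M) :
    Tendsto (fun t => ∫⁻ u, ‖gop t φ u - φ u‖ₑ) (𝓝[>] 0) (𝓝 0) := by
  have hn := hφ.norm
  have hn1 : MemLp (fun v => ‖φ v‖) 1 := memLp_one_iff_integrable.2 hn
  have hφ1 : MemLp φ 1 := memLp_one_iff_integrable.2 hφ
  have hb : ∫⁻ v, ENNReal.ofReal ‖φ v‖ ≠ ∞ := by
    simp_rw [ofReal_norm]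
    exact hφ.2.ne
  have hMn : ∀ v, ‖‖φ v‖‖ₑ ≤ M := fun v => by rw [enorm_norm]; exact hM v
  have ha0 : ∀ t : ℝ, 0 < t → ∀ u, 0 ≤ gop t (fun v => ‖φ v‖) u := fun t ht u =>
    integral_nonneg fun v => smul_nonneg (gker_nonneg hN hk ht u v) (norm_nonneg _)
  refine tendsto_lintegral_of_le_add (a := fun t => gop t fun v => ‖φ v‖) (b := fun v => ‖φ v‖)
    ?_ ?_ hb hn.1.aemeasurable ?_ ?_
  · filter_upwards [self_mem_nhdsWithin] with t ht
    exact ((aestronglyMeasurable_gop hN hk ht hφ.1).fun_sub hφ.1).enorm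
  · filter_upwards [self_mem_nhdsWithin] with t ht u
    refine enorm_sub_le.trans (add_le_add ?_ (ofReal_norm _).ge)
    rw [← ofReal_norm]
    refine ENNReal.ofReal_le_ofReal ((norm_integral_le_integral_norm _).trans_eq ?_)
    refine integral_congr_ae (Eventually.of_forall fun v => ?_)
    simp only [norm_smul, smul_eq_mul, Real.norm_of_nonneg (gker_nonneg hN hk ht u v)]
  · refine tendsto_lintegral_enorm_sub_of_tendsto hb ?_ hn.1.aemeasurable
      (fun v => norm_nonneg _) rfl ?_
    · filter_upwards [self_mem_nhdsWithin] with t ht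
      exact ⟨(aestronglyMeasurable_gop hN hk ht hn.1).aemeasurable, ha0 t ht,
        lintegral_gop hN hk ht hn fun v => norm_nonneg _⟩
    · filter_upwards [ae_fst_ne_zero hN] with u hu
      have h := tendsto_gop_of_continuous hN hk le_rfl hn1 hc.norm hMn hu
      exact tendsto_iff_edist_tendsto_0.2 (by simpa only [edist_eq_enorm_sub] using h)
  · filter_upwards [ae_fst_ne_zero hN] with u hu
    exact tendsto_gop_of_continuous hN hk le_rfl hφ1 hc hM hu

/-- L¹ convergence is interpolated with the uniform bound 2M. The L¹ norm enters with exponent 1/p,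
which is positive because p < ∞. -/
theorem tendsto_eLpNorm_gop_sub_self_of_continuous [CompleteSpace E] (hN : 1 ≤ N) (hk : 1 ≤ k)
    {p : ℝ≥0∞} (hp : 1 ≤ p) (hpt : p ≠ ∞) {φ : GrushinSpace N k → E} (hc : Continuous φ)
    (hs : HasCompactSupport φ) :
    Tendsto (fun t => eLpNorm (gop t φ - φ) p volume) (𝓝[>] 0) (𝓝 0) := by
  obtain ⟨M, hM⟩ : ∃ M : ℝ≥0, ∀ v, ‖φ v‖ₑ ≤ M := by
    obtain ⟨M, hM⟩ := hs.exists_bound_of_continuous hc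
    refine ⟨M.toNNReal, fun v => ?_⟩
    rw [← ofReal_norm]
    exact ENNReal.ofReal_le_ofReal (hM v)
  have h1 : Tendsto (fun t => eLpNorm (gop t φ - φ) 1 volume) (𝓝[>] 0) (𝓝 0) := by
    simp_rw [eLpNorm_one_eq_lintegral_enorm]
    exact tendsto_lintegral_gop_sub hN hk (hc.integrable_of_hasCompactSupport hs) hc hM
  have hsup : eLpNorm φ ∞ volume ≤ M := by
    rw [eLpNorm_exponent_top]
    exact eLpNormEssSup_le_of_ae_enorm_bound (Eventually.of_forall hM)
  have hp0 : 0 < p.toReal := ENNReal.toReal_pos (one_pos.trans_le hp).ne' hpt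
  have hp1 : 0 ≤ 1 - (1 : ℝ≥0∞).toReal / p.toReal := by
    rw [sub_nonneg, div_le_one hp0]
    exact ENNReal.toReal_mono hpt hp
  have hq : 0 < (1 : ℝ≥0∞).toReal / p.toReal := by
    rw [ENNReal.toReal_one]; positivity
  have h2 : Tendsto (fun t => eLpNorm (gop t φ - φ) 1 volume ^ ((1 : ℝ≥0∞).toReal / p.toReal) *
      ((M : ℝ≥0∞) + M) ^ (1 - (1 : ℝ≥0∞).toReal / p.toReal)) (𝓝[>] 0) (𝓝 0) := by
    have h3 := (ENNReal.continuous_rpow_const (y := (1 : ℝ≥0∞).toReal / p.toReal)).tendsto 0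
    rw [ENNReal.zero_rpow_of_pos hq] at h3
    have := ENNReal.Tendsto.mul_const (b := ((M : ℝ≥0∞) + M) ^ (1 - (1 : ℝ≥0∞).toReal / p.toReal))
      (h3.comp h1) (Or.inr (ENNReal.rpow_ne_top_of_nonneg hp1 (by simp)))
    rwa [zero_mul] at this
  refine tendsto_of_tendsto_of_tendsto_of_le_of_le' tendsto_const_nhds h2
    (Eventually.of_forall fun _ => zero_le) ?_
  filter_upwards [self_mem_nhdsWithin] with t ht
  have h4 : eLpNorm (gop t φ - φ) ∞ volume ≤ (M : ℝ≥0∞) + M :=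
    (eLpNorm_sub_le (aestronglyMeasurable_gop hN hk ht hc.aestronglyMeasurable)
      hc.aestronglyMeasurable le_top).trans (add_le_add
        ((eLpNorm_gop_le hN hk ht le_top hc.aestronglyMeasurable).trans hsup) hsup)
  refine (eLpNorm_le_interpolate_top le_rfl hp (h4.trans_lt (by simp)).ne).trans ?_
  gcongr

/-- Approximation by compactly supported continuous functions, dense in L^p for p < ∞; contractivity
controls the error uniformly in t. -/
theorem tendsto_eLpNorm_gop_sub_self [CompleteSpace E] (hN : 1 ≤ N) (hk : 1 ≤ k)
    {p : ℝ≥0∞} (hp : 1 ≤ p) (hpt : p ≠ ∞) {φ : GrushinSpace N k → E} (hφ : MemLp φ p) :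
    Tendsto (fun t => eLpNorm (gop t φ - φ) p volume) (𝓝[>] 0) (𝓝 0) := by
  rw [ENNReal.tendsto_nhds_zero]
  intro ε hε
  have hε3 : 0 < ε / 3 := ENNReal.div_pos hε.ne' (by simp)
  obtain ⟨g, hgs, hgε, hgc, hg⟩ := hφ.exists_hasCompactSupport_eLpNorm_sub_le hpt hε3.ne'
  filter_upwards [ENNReal.tendsto_nhds_zero.1
    (tendsto_eLpNorm_gop_sub_self_of_continuous hN hk hp hpt hgc hgs) _ hε3,
    self_mem_nhdsWithin] with t h1 ht
  have m1 : AEStronglyMeasurable (φ - g) volume := hφ.1.sub hg.1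
  have m2 := aestronglyMeasurable_gop hN hk ht m1
  have m3 := (aestronglyMeasurable_gop hN hk ht hg.1).sub hg.1
  have e : gop t φ - φ = gop t (φ - g) + (gop t g - g) - (φ - g) := by
    rw [gop_sub hN hk ht hp hφ hg]; abel
  rw [e]
  calc eLpNorm (gop t (φ - g) + (gop t g - g) - (φ - g)) p volume
      ≤ eLpNorm (gop t (φ - g)) p volume + eLpNorm (gop t g - g) p volume +
        eLpNorm (φ - g) p volume :=
        (eLpNorm_sub_le (m2.add m3) m1 hp).trans (add_le_add (eLpNorm_add_le m2 m3 hp) le_rfl)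
    _ ≤ ε / 3 + ε / 3 + ε / 3 :=
        add_le_add (add_le_add ((eLpNorm_gop_le hN hk ht hp m1).trans hgε) h1) hgε
    _ = ε := ENNReal.add_thirds ε

end Initial

/-! ### The semigroup on L^p as bounded linear operators -/

section Semigroup

variable {𝕜 : Type*} [RCLike 𝕜] {N k : ℕ}

theorem grushinSemigroup_zero (φ : GrushinSpace N k → 𝕜) : grushinSemigroup 0 φ = φ :=
  if_pos rfl

theorem grushinSemigroup_of_pos {t : ℝ} (ht : 0 < t) (φ : GrushinSpace N k → 𝕜) :
    grushinSemigroup t φ = gop t φ :=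
  if_neg ht.ne'

theorem gop_smul (t : ℝ) (c : 𝕜) (φ : GrushinSpace N k → 𝕜) : gop t (c • φ) = c • gop t φ := by
  ext u
  simp only [gop, Pi.smul_apply, smul_comm _ c]
  exact integral_smul c _

/-- The operator `S(t)`, `t > 0`, on `L^p`, as a map. -/
def gopLp (hN : 1 ≤ N) (hk : 1 ≤ k) (p : ℝ≥0∞) [hp : Fact (1 ≤ p)] {t : ℝ} (ht : 0 < t)
    (φ : Lp 𝕜 p (volume : Measure (GrushinSpace N k))) :
    Lp 𝕜 p (volume : Measure (GrushinSpace N k)) :=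
  (memLp_gop hN hk ht hp.out (Lp.memLp φ)).toLp

theorem coeFn_gopLp (hN : 1 ≤ N) (hk : 1 ≤ k) (p : ℝ≥0∞) [hp : Fact (1 ≤ p)] {t : ℝ} (ht : 0 < t)
    (φ : Lp 𝕜 p (volume : Measure (GrushinSpace N k))) :
    gopLp hN hk p ht φ =ᵐ[volume] gop t φ :=
  MemLp.coeFn_toLp (memLp_gop hN hk ht hp.out (Lp.memLp φ))

theorem gopLp_add (hN : 1 ≤ N) (hk : 1 ≤ k) (p : ℝ≥0∞) [hp : Fact (1 ≤ p)] {t : ℝ} (ht : 0 < t)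
    (φ ψ : Lp 𝕜 p (volume : Measure (GrushinSpace N k))) :
    gopLp hN hk p ht (φ + ψ) = gopLp hN hk p ht φ + gopLp hN hk p ht ψ := by
  refine Lp.ext ?_
  have h := (coeFn_gopLp hN hk p ht φ).add (coeFn_gopLp hN hk p ht ψ)
  rw [← gop_add hN hk ht hp.out (Lp.memLp φ) (Lp.memLp ψ), ← gop_congr_ae (Lp.coeFn_add φ ψ)] at h
  exact (coeFn_gopLp hN hk p ht _).trans (((Lp.coeFn_add _ _).trans h).symm)

theorem gopLp_smul (hN : 1 ≤ N) (hk : 1 ≤ k) (p : ℝ≥0∞) [hp : Fact (1 ≤ p)] {t : ℝ} (ht : 0 < t)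
    (c : 𝕜) (φ : Lp 𝕜 p (volume : Measure (GrushinSpace N k))) :
    gopLp hN hk p ht (c • φ) = c • gopLp hN hk p ht φ := by
  refine Lp.ext ?_
  have h := (coeFn_gopLp hN hk p ht φ).const_smul c
  rw [← gop_smul, ← gop_congr_ae (Lp.coeFn_smul c φ)] at h
  exact (coeFn_gopLp hN hk p ht _).trans (((Lp.coeFn_smul _ _).trans h).symm)

theorem norm_gopLp_le (hN : 1 ≤ N) (hk : 1 ≤ k) (p : ℝ≥0∞) [hp : Fact (1 ≤ p)] {t : ℝ} (ht : 0 < t)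
    (φ : Lp 𝕜 p (volume : Measure (GrushinSpace N k))) : ‖gopLp hN hk p ht φ‖ ≤ 1 * ‖φ‖ := by
  rw [one_mul, Lp.norm_def, Lp.norm_def]
  refine ENNReal.toReal_mono (Lp.eLpNorm_ne_top φ) ?_
  rw [eLpNorm_congr_ae (coeFn_gopLp hN hk p ht φ)]
  exact eLpNorm_gop_le hN hk ht hp.out (Lp.aestronglyMeasurable φ)

/-- The operator `S(t)`, `t > 0`, on `L^p`. -/
def gopCLM (hN : 1 ≤ N) (hk : 1 ≤ k) (p : ℝ≥0∞) [Fact (1 ≤ p)] {t : ℝ} (ht : 0 < t) :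
    Lp 𝕜 p (volume : Measure (GrushinSpace N k)) →L[𝕜]
      Lp 𝕜 p (volume : Measure (GrushinSpace N k)) :=
  LinearMap.mkContinuous
    { toFun := gopLp hN hk p ht
      map_add' := gopLp_add hN hk p ht
      map_smul' := gopLp_smul hN hk p ht }
    1 (norm_gopLp_le hN hk p ht)

theorem coeFn_gopCLM (hN : 1 ≤ N) (hk : 1 ≤ k) (p : ℝ≥0∞) [Fact (1 ≤ p)] {t : ℝ} (ht : 0 < t)
    (φ : Lp 𝕜 p (volume : Measure (GrushinSpace N k))) :
    gopCLM hN hk p ht φ =ᵐ[volume] gop t φ :=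
  coeFn_gopLp hN hk p ht φ

/-- The semigroup `S(t)`, `t ≥ 0`, on `L^p`. -/
def semigroupCLM (hN : 1 ≤ N) (hk : 1 ≤ k) (p : ℝ≥0∞) [Fact (1 ≤ p)] (t : ℝ≥0) :
    Lp 𝕜 p (volume : Measure (GrushinSpace N k)) →L[𝕜]
      Lp 𝕜 p (volume : Measure (GrushinSpace N k)) :=
  if ht : 0 < (t : ℝ) then gopCLM hN hk p ht else ContinuousLinearMap.id 𝕜 _

theorem semigroupCLM_zero (hN : 1 ≤ N) (hk : 1 ≤ k) (p : ℝ≥0∞) [Fact (1 ≤ p)] :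
    semigroupCLM (𝕜 := 𝕜) hN hk p 0 = ContinuousLinearMap.id 𝕜 _ :=
  dif_neg (by simp)

theorem semigroupCLM_of_pos (hN : 1 ≤ N) (hk : 1 ≤ k) (p : ℝ≥0∞) [Fact (1 ≤ p)] {t : ℝ≥0}
    (ht : 0 < (t : ℝ)) : semigroupCLM (𝕜 := 𝕜) hN hk p t = gopCLM hN hk p ht :=
  dif_pos ht

theorem coeFn_semigroupCLM (hN : 1 ≤ N) (hk : 1 ≤ k) (p : ℝ≥0∞) [Fact (1 ≤ p)] (t : ℝ≥0)
    (φ : Lp 𝕜 p (volume : Measure (GrushinSpace N k))) :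
    semigroupCLM hN hk p t φ =ᵐ[volume] grushinSemigroup (t : ℝ) φ := by
  rcases eq_zero_or_pos t with rfl | ht
  · rw [semigroupCLM_zero, NNReal.coe_zero, grushinSemigroup_zero]
    rfl
  · have ht' : 0 < (t : ℝ) := ht
    rw [semigroupCLM_of_pos hN hk p ht', grushinSemigroup_of_pos ht']
    exact coeFn_gopCLM hN hk p ht' φ

theorem semigroupCLM_add (hN : 1 ≤ N) (hk : 1 ≤ k) (p : ℝ≥0∞) [hp : Fact (1 ≤ p)] (s t : ℝ≥0) :
    semigroupCLM (𝕜 := 𝕜) hN hk p (s + t) =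
      (semigroupCLM hN hk p s).comp (semigroupCLM hN hk p t) := by
  rcases eq_zero_or_pos s with rfl | hs
  · rw [zero_add, semigroupCLM_zero, ContinuousLinearMap.id_comp]
  rcases eq_zero_or_pos t with rfl | ht
  · rw [add_zero, semigroupCLM_zero, ContinuousLinearMap.comp_id]
  have hs' : 0 < (s : ℝ) := hs
  have ht' : 0 < (t : ℝ) := ht
  have hst : 0 < ((s + t : ℝ≥0) : ℝ) := add_pos hs ht
  rw [semigroupCLM_of_pos hN hk p hs', semigroupCLM_of_pos hN hk p ht',
    semigroupCLM_of_pos hN hk p hst]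
  ext1 φ
  refine Lp.ext ((coeFn_gopCLM hN hk p hst φ).trans ?_)
  rw [ContinuousLinearMap.comp_apply, NNReal.coe_add,
    ← gop_gop hN hk hs' ht' hp.out (Lp.memLp φ), ← gop_congr_ae (coeFn_gopCLM hN hk p ht' φ)]
  exact (coeFn_gopCLM hN hk p hs' _).symm

end Semigroup

end

theorem theorem2p4 {𝕜 : Type*} [RCLike 𝕜] (N k : ℕ) (hN : 1 ≤ N) (hk : 1 ≤ k) :
    -- the defining integral converges absolutely on `L^p`, at every point
    (∀ p : ℝ≥0∞, 1 ≤ p → ∀ t : ℝ, 0 < t → ∀ φ : GrushinSpace N k → 𝕜, MemLp φ p volume →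
      ∀ u : GrushinSpace N k,
        Integrable (fun v : GrushinSpace N k => grushinKernel u.1 v.1 (u.2 - v.2) t • φ v)
          volume) ∧
    -- `S(t)`, `t ≥ 0`, is a semigroup of bounded linear operators on `L^p`
    (∀ (p : ℝ≥0∞) [Fact (1 ≤ p)],
      ∃ T : ℝ≥0 → (Lp 𝕜 p (volume : Measure (GrushinSpace N k)) →L[𝕜]
          Lp 𝕜 p (volume : Measure (GrushinSpace N k))),
        (∀ t φ, T t φ =ᵐ[volume] grushinSemigroup (t : ℝ) φ) ∧
        T 0 = ContinuousLinearMap.id 𝕜 _ ∧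
        ∀ s t, T (s + t) = (T s).comp (T t)) ∧
    -- `L^p`-`L^r` estimates
    (∀ p r : ℝ≥0∞, 1 ≤ p → p ≤ r →
      ∃ C : ℝ≥0, ∀ t : ℝ, 0 < t → ∀ φ : GrushinSpace N k → 𝕜, MemLp φ p volume →
        MemLp (grushinSemigroup t φ) r volume ∧
        eLpNorm (grushinSemigroup t φ) r volume ≤
          C * ENNReal.ofReal (t ^ (-(((N : ℝ) + 2 * k) / 2 * (p⁻¹.toReal - r⁻¹.toReal)))) *
            eLpNorm φ p volume) ∧
    -- strong continuity at every `t₀ > 0`, from `L^p` to `L^r`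
    (∀ p r : ℝ≥0∞, 1 ≤ p → p ≤ r →
      ∀ φ : GrushinSpace N k → 𝕜, MemLp φ p volume → ∀ t₀ : ℝ, 0 < t₀ →
        Tendsto (fun t : ℝ => eLpNorm (grushinSemigroup t φ - grushinSemigroup t₀ φ) r volume)
          (𝓝 t₀) (𝓝 0)) ∧
    -- strong continuity at `t₀ = 0` on `L^p`, `p < ∞`
    (∀ p : ℝ≥0∞, 1 ≤ p → p < ∞ →
      ∀ φ : GrushinSpace N k → 𝕜, MemLp φ p volume →
        Tendsto (fun t : ℝ => eLpNorm (grushinSemigroup t φ - grushinSemigroup 0 φ) p volume)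
          (𝓝[≥] 0) (𝓝 0)) := by
  refine ⟨fun p hp t ht φ hφ u => integrable_gker_smul hN hk ht hp hφ u, fun p _ =>
    ⟨semigroupCLM hN hk p, coeFn_semigroupCLM hN hk p, semigroupCLM_zero hN hk p,
      semigroupCLM_add hN hk p⟩, fun p r hp hpr => ?_, fun p r hp hpr φ hφ t₀ ht₀ => ?_,
    fun p hp hpt φ hφ => ?_⟩
  · obtain ⟨C, hC⟩ := exists_eLpNorm_gop_le (E := 𝕜) hN hk hp hpr
    refine ⟨C, fun t ht φ hφ => ?_⟩
    rw [grushinSemigroup_of_pos ht]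
    exact ⟨⟨aestronglyMeasurable_gop hN hk ht hφ.1, (hC t ht φ hφ).trans_lt (ENNReal.mul_lt_top
      (ENNReal.mul_lt_top ENNReal.coe_lt_top ENNReal.ofReal_lt_top) hφ.2)⟩, hC t ht φ hφ⟩
  · refine (tendsto_eLpNorm_gop_sub_of_le hN hk ht₀ hp hpr hφ).congr' ?_
    filter_upwards [lt_mem_nhds ht₀] with t ht
    rw [grushinSemigroup_of_pos ht, grushinSemigroup_of_pos ht₀]
  · rw [← Set.Ioi_insert, nhdsWithin_insert, tendsto_sup, grushinSemigroup_zero]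
    refine ⟨?_, (tendsto_eLpNorm_gop_sub_self hN hk hp hpt.ne hφ).congr' ?_⟩
    · rw [tendsto_pure_left]
      intro s hs
      rw [grushinSemigroup_zero, sub_self, eLpNorm_zero]
      exact mem_of_mem_nhds hs
    · filter_upwards [self_mem_nhdsWithin] with t ht
      rw [grushinSemigroup_of_pos ht]
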